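/- **Words.** Let $\mathfrak X$ be a countably infinite alphabet containing pairwise distinct letters $x$, $y_i,z_i,t_i,z_i',t_i'$ ($i\ge 1$), and let $\mathfrak X^*$ be the free monoid over $\mathfrak X$. For $n,m\ge 0$, permutations $\rho$ of $\{1,\dots,n+m\}$ act on the right ($i\mapsto i\rho$). Call $\rho$ an $(n,m)$-permutation if for every $1\le i\le n+m-1$ exactly one of $i\rho,(i+1)\rho$ belongs to $\{1,\dots,n\}$; let $S_{n,m}$ be the set of all $(n,m)$-permutations. For $n+m\ge1$ and $\rho\in S_{n,m}$ put \[ \begin{aligned} \mathbf a^{(1)}_{n,m}[\rho]&:=\Bigl(\prod_{i=1}^n z_it_i\Bigr)x\Bigl(\prod_{i=1}^{n+m}\mathbf z^{(1)}_{i\rho}\Bigr)x\Bigl(\prod_{i=n+1}^{n+m}t_iz_it_i'z_i'\Bigr),\\ \mathbf a^{(2)}_{n,m}[\rho]&:=\Bigl(\prod_{i=1}^n z_it_iz_i't_i'\Bigr)x\Bigl(\prod_{i=1}^{n+m}\mathbf z^{(2)}_{i\rho}\Bigr)x\Bigl(\prod_{i=n+1}^{n+m}t_iz_i\Bigr),\\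 \mathbf a^{(p)}_{n,m}[\rho]&:=\Bigl(\prod_{i=1}^n z_it_i\Bigr)x\Bigl(\prod_{i=1}^{n+m-1}\mathbf z^{(p)}_{i\rho}\Bigr)z_{(n+m)\rho}\,x\Bigl(\prod_{i=n+1}^{n+m}t_iz_i\Bigr)\qquad(p=3,4), \end{aligned} \] where, for $1\le i\le n$, $\mathbf z^{(1)}_i=z_i$, $\mathbf z^{(2)}_i=z_iy_i^2z_i'$, $\mathbf z^{(3)}_i=z_iy_i^2$, $\mathbf z^{(4)}_i=z_i$, and, for $n+1\le i\le n+m$, $\mathbf z^{(1)}_i=z_iy_i^2z_i'$, $\mathbf z^{(2)}_i=z_i$, $\mathbf z^{(3)}_i=z_i$, $\mathbf z^{(4)}_i=z_iy_i^2$. **Varieties and congruences.** A monoid variety is a class of monoids defined by a set of identities $\mathbf u\approx\mathbf v$ with $\mathbf u,\mathbf v\in\mathfrak X^*$; the subvarieties of a variety $\mathbf V$ form a lattice $\mathfrak L(\mathbf V)$ under inclusion. $\mathrm{FIC}(\mathbf V)$ is the congruence on $\mathfrak X^*$ of all pairs $(\mathbf u,\mathbf v)$ such that $\mathbf V$ satisfies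 $\mathbf u\approx\mathbf v$. For a congruence $\alpha$ on $\mathfrak X^*$ and a set $W$ of $\alpha$-classes, $M_\alpha(W)$ is the Rees quotient of $\mathfrak X^*/\alpha$ over the ideal of all elements that are not factors of elements of $W$ ($v$ is a factor of $u$ if $u=pvs$ for some $p,s$), and $\mathbf M_\alpha(W)$ is the variety generated by $M_\alpha(W)$; for the trivial congruence the subscript is omitted, and braces around the elements of $W$ are omitted. $[\mathbf w]^\alpha$ is the $\alpha$-class of $\mathbf w$. Let $\gamma$ be the congruence with $\mathbf u\mathrel\gamma\mathbf v$ if and only if $\mathbf u$ and $\mathbf v$ have the same letters occurring exactly once and $\mathbf u$ is obtained from $\mathbf v$ by changing the (positive) exponents of maximal powers of letters. Let \[ \gamma'':=\gamma\wedge\mathrm{FIC}\bigl(\mathbf M(xyxty,\,ytxyx)\bigr), \] where in these two words $x,y,t$ denote pairwise distinct letters. **Proposition.** Let $n,m\ge 0$ be integers with $|n-m|\le 1$ and $n+m\ge 1$, let $\pi\in S_{n,m}$ and let $p\in\{1,2,3,4\}$. Then the lattice $\mathfrak L\bigl(\mathbf M_{\gamma''}([\mathbf a^{(p)}_{n,m}[\pi]]^{\gamma''})\bigr)$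 is not distributive. -/

import Mathlib

/-- The countably infinite alphabet. The letters `zᵢ'` and `tᵢ'` are `zp` and `tp`; indices start
at `0`, so that `y i`, `z i`, … is the letter with the number `i + 1`. -/
inductive Letter : Type
  | x : Letter
  | y (i : ℕ) : Letter
  | z (i : ℕ) : Letter
  | t (i : ℕ) : Letter
  | zp (i : ℕ) : Letter
  | tp (i : ℕ) : Letter

noncomputable instance : DecidableEq Letter := Classical.decEq Letter

instance : Infinite Letter :=
  Infinite.of_injective Letter.y fun _ _ h => Letter.y.inj h

/-- An injective numbering of the letters. -/
def Letter.code : Letter → ℕ × ℕ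
  | .x => (0, 0)
  | .y i => (1, i)
  | .z i => (2, i)
  | .t i => (3, i)
  | .zp i => (4, i)
  | .tp i => (5, i)

instance : Countable Letter :=
  Function.Injective.countable (f := Letter.code) (by
    intro a b h
    cases a <;> cases b <;> simp_all [Letter.code])

/-- Words: elements of the free monoid over the alphabet. -/
abbrev Word : Type := FreeMonoid Letter

/-! ### Varieties of monoids -/

/-- The monoid `M` satisfies the identity `e.1 ≈ e.2`. -/
def Satisfies (M : Type) [Monoid M] (e : Word × Word) : Prop :=
  ∀ φ : Letter → M, FreeMonoid.lift φ e.1 = FreeMonoid.lift φ e.2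

/-- A monoid variety: a class of monoids that is defined by a set of identities. -/
structure MonoidVariety where
  Mem : (M : Type) → [Monoid M] → Prop
  equational : ∃ E : Set (Word × Word), ∀ (M : Type) [Monoid M],
    Mem M ↔ ∀ e ∈ E, Satisfies M e

namespace MonoidVariety

/-- `var E`: the variety defined by the set `E` of identities. -/
def ofIdentities (E : Set (Word × Word)) : MonoidVariety where
  Mem M _ := ∀ e ∈ E, Satisfies M e
  equational := ⟨E, fun _ _ => Iff.rfl⟩

/-- The set of all identities satisfied by a variety. -/
def identities (V : MonoidVariety) : Set (Word × Word) :=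
  {e | ∀ (M : Type) [Monoid M], V.Mem M → Satisfies M e}

theorem mem_iff (V : MonoidVariety) (M : Type) [Monoid M] :
    V.Mem M ↔ ∀ e ∈ V.identities, Satisfies M e := by
  obtain ⟨E, hE⟩ := V.equational
  refine ⟨fun h e he => he M h, fun h => (hE M).2 fun e he => h e ?_⟩
  intro N _ hN
  exact (hE N).1 hN e he

/-- Varieties are ordered by inclusion. -/
instance : PartialOrder MonoidVariety where
  le V W := ∀ (M : Type) [Monoid M], V.Mem M → W.Mem M
  le_refl _ _ _ h := h
  le_trans _ _ _ h₁ h₂ M _ h := h₂ M (h₁ M h)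
  le_antisymm V W h₁ h₂ := by
    obtain ⟨v, hv⟩ := V
    obtain ⟨w, hw⟩ := W
    have : @v = @w := by
      funext M _
      exact propext ⟨h₁ M, h₂ M⟩
    subst this
    rfl

/-- The lattice of varieties: the meet is the intersection, the join is the variety defined by the
common identities. -/
instance : Lattice MonoidVariety where
  inf V W :=
    { Mem := fun M _ => V.Mem M ∧ W.Mem M
      equational := by
        obtain ⟨E, hE⟩ := V.equational
        obtain ⟨F, hF⟩ := W.equational
        refine ⟨E ∪ F, fun M _ => ?_⟩
        rw [hE, hF]
        simp only [Set.mem_union, or_imp, forall_and] }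
  inf_le_left _ _ _ _ h := h.1
  inf_le_right _ _ _ _ h := h.2
  le_inf _ _ _ h₁ h₂ M _ h := ⟨h₁ M h, h₂ M h⟩
  sup V W := ofIdentities (V.identities ∩ W.identities)
  le_sup_left _ _ M _ h := fun _ he => he.1 M h
  le_sup_right _ _ M _ h := fun _ he => he.2 M h
  sup_le U V W h₁ h₂ M _ h := by
    rw [mem_iff]
    intro e he
    exact h e ⟨fun N _ hN => he N (h₁ N hN), fun N _ hN => he N (h₂ N hN)⟩

/-- The variety generated by the monoid `M`. -/
def generatedBy (M : Type) [Monoid M] : MonoidVariety :=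
  ofIdentities {e | Satisfies M e}

theorem isLeast_generatedBy (M : Type) [Monoid M] :
    IsLeast {V : MonoidVariety | V.Mem M} (generatedBy M) := by
  refine ⟨fun _ he => he, fun V hV N _ hN => ?_⟩
  rw [mem_iff]
  intro e he
  exact hN e (he M hV)

/-- `FIC(V)`: the fully invariant congruence on the free monoid corresponding to `V`. -/
def fic (V : MonoidVariety) : Con Word where
  r u v := (u, v) ∈ V.identities
  iseqv :=
    { refl := fun _ _ _ _ _ => rfl
      symm := fun h M _ hM φ => (h M hM φ).symm
      trans := fun h₁ h₂ M _ hM φ => (h₁ M hM φ).trans (h₂ M hM φ) }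
  mul' := fun h₁ h₂ M _ hM φ => by
    have e₁ := h₁ M hM φ
    have e₂ := h₂ M hM φ
    simp only [map_mul] at e₁ e₂ ⊢
    rw [e₁, e₂]

/-- `𝔏(V)`: the lattice of subvarieties of `V`. -/
abbrev Subvarieties (V : MonoidVariety) : Type 1 := Set.Iic V

end MonoidVariety

/-- Distributivity of a lattice. -/
def IsDistributiveLattice (L : Type*) [Lattice L] : Prop :=
  ∀ a b c : L, (a ⊔ b) ⊓ c = (a ⊓ c) ⊔ (b ⊓ c)

/-! ### Rees quotients -/

/-- `W^≤`: all factors of elements of `W`. -/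
def factorClosure {S : Type} [Monoid S] (W : Set S) : Set S :=
  {v | ∃ u ∈ W, ∃ p s : S, u = p * v * s}

/-- The Rees congruence of the ideal `S \ W^≤`. -/
def reesCon {S : Type} [Monoid S] (W : Set S) : Con S where
  r a b := a = b ∨ (a ∉ factorClosure W ∧ b ∉ factorClosure W)
  iseqv :=
    { refl := fun _ => Or.inl rfl
      symm := by
        rintro a b (h | h)
        · exact Or.inl h.symm
        · exact Or.inr h.symm
      trans := by
        rintro a b c (rfl | h₁) (rfl | h₂)
        · exact Or.inl rfl
        · exact Or.inr h₂
        · exact Or.inr h₁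
        · exact Or.inr ⟨h₁.1, h₂.2⟩ }
  mul' := by
    have hl : ∀ a c : S, a ∉ factorClosure W → a * c ∉ factorClosure W := by
      rintro a c ha ⟨u, hu, p, s, rfl⟩
      exact ha ⟨_, hu, p, c * s, by simp only [mul_assoc]⟩
    have hr : ∀ a c : S, c ∉ factorClosure W → a * c ∉ factorClosure W := by
      rintro a c hc ⟨u, hu, p, s, rfl⟩
      exact hc ⟨_, hu, p * a, s, by simp only [mul_assoc]⟩
    rintro a b c d (rfl | h₁) (rfl | h₂)
    · exact Or.inl rfl
    · exact Or.inr ⟨hr _ _ h₂.1, hr _ _ h₂.2⟩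
    · exact Or.inr ⟨hl _ _ h₁.1, hl _ _ h₁.2⟩
    · exact Or.inr ⟨hl _ _ h₁.1, hl _ _ h₁.2⟩

/-- The Rees quotient of `S` over the ideal `S \ W^≤`. For the free monoid `S` this is `M(W)`. -/
abbrev ReesQuotient {S : Type} [Monoid S] (W : Set S) : Type := (reesCon W).Quotient

/-- `M_α(W)` for a congruence `α` on the free monoid and a set `W` of `α`-classes. -/
abbrev SapirMonoid (α : Con Word) (W : Set α.Quotient) : Type := ReesQuotient W

/-! ### The congruences `γ` and `γ''` -/

/-- The set of simple letters of a word: those that occur exactly once. -/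
def simpleLetters (w : Word) : Set Letter := {c | w.toList.count c = 1}

/-- The sequence of the letters that form the consecutive islands (maximal powers of a letter) of
a word. Two words differ only in the exponents of their islands if and only if they have the same
sequence. -/
noncomputable def islandLetters (w : Word) : List Letter := w.toList.destutter (· ≠ ·)

namespace GammaAux

noncomputable def glue (a : Letter) (l : List Letter) : List Letter :=
  if l.head? = some a then l else a :: l

theorem destutter_eq (l : List Letter) : l.destutter (· ≠ ·) = l.foldr glue [] := by
  induction l with
  | nil => rfl
  | cons a l ih =>
    rw [List.foldr_cons, ← ih]
    cases l with
    | nil => rfl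
    | cons b l =>
      have hd : ∀ (c : Letter) (m : List Letter),
          (List.destutter' (· ≠ ·) c m).head? = some c := by
        intro c m
        induction m with
        | nil => rfl
        | cons d m ihm =>
          by_cases h : c ≠ d
          · rw [List.destutter'_cons_pos m h]; rfl
          · rw [List.destutter'_cons_neg m h]; exact ihm
      rw [List.destutter_cons', List.destutter_cons', glue, hd]
      by_cases h : a = b
      · subst h
        rw [List.destutter'_cons_neg l (by simp), if_pos rfl]
      · rw [List.destutter'_cons_pos l h, if_neg (by simpa using Ne.symm h)]

theorem glue_glue (a : Letter) (l : List Letter) : glue a (glue a l) = glue a l := by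
  unfold glue
  split_ifs <;> simp_all

theorem foldr_glue (a : Letter) (l w : List Letter) :
    (glue a l).foldr glue w = glue a (l.foldr glue w) := by
  by_cases h : l.head? = some a
  · rw [glue, if_pos h]
    cases l with
    | nil => simp at h
    | cons b l =>
      obtain rfl : b = a := by simpa using h
      rw [List.foldr_cons, glue_glue]
  · rw [glue, if_neg h, List.foldr_cons]

theorem foldr_destutter (u w : List Letter) :
    (u.destutter (· ≠ ·)).foldr glue w = u.foldr glue w := by
  rw [destutter_eq]
  induction u with
  | nil => rfl
  | cons a u ih => rw [List.foldr_cons, foldr_glue, ih, List.foldr_cons]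

theorem destutter_append (u w : List Letter) :
    (u ++ w).destutter (· ≠ ·) =
      (u.destutter (· ≠ ·)).foldr glue (w.destutter (· ≠ ·)) := by
  rw [foldr_destutter, destutter_eq, destutter_eq, List.foldr_append]

theorem mem_destutter (a : Letter) (l : List Letter) :
    a ∈ l.destutter (· ≠ ·) ↔ a ∈ l := by
  rw [destutter_eq]
  induction l with
  | nil => rfl
  | cons b l ih =>
    rw [List.foldr_cons, List.mem_cons, ← ih, glue]
    split_ifs with h
    · refine ⟨Or.inr, ?_⟩
      rintro (rfl | h')
      · exact List.mem_of_mem_head? h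
      · exact h'
    · exact List.mem_cons

theorem count_zero_iff {u v : Word} (h : islandLetters u = islandLetters v) (c : Letter) :
    u.toList.count c = 0 ↔ v.toList.count c = 0 := by
  have h' : u.toList.destutter (· ≠ ·) = v.toList.destutter (· ≠ ·) := h
  rw [List.count_eq_zero, List.count_eq_zero, ← mem_destutter c u.toList, h', mem_destutter]

end GammaAux

/-- `u γ v`: the words `u` and `v` have the same simple letters, and `u` can be obtained from `v`
by changing the exponents of islands. -/
noncomputable def gammaCon : Con Word where
  r u v := simpleLetters u = simpleLetters v ∧ islandLetters u = islandLetters v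
  iseqv :=
    { refl := fun _ => ⟨rfl, rfl⟩
      symm := fun h => ⟨h.1.symm, h.2.symm⟩
      trans := fun h₁ h₂ => ⟨h₁.1.trans h₂.1, h₁.2.trans h₂.2⟩ }
  mul' := by
    intro u u' v v' h₁ h₂
    constructor
    · ext c
      have a₁ := GammaAux.count_zero_iff h₁.2 c
      have a₂ := GammaAux.count_zero_iff h₂.2 c
      have b₁ : u.toList.count c = 1 ↔ u'.toList.count c = 1 := Set.ext_iff.1 h₁.1 c
      have b₂ : v.toList.count c = 1 ↔ v'.toList.count c = 1 := Set.ext_iff.1 h₂.1 c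
      simp only [simpleLetters, Set.mem_ofPred_eq, FreeMonoid.toList_mul, List.count_append]
      omega
    · have e₁ : u.toList.destutter (· ≠ ·) = u'.toList.destutter (· ≠ ·) := h₁.2
      have e₂ : v.toList.destutter (· ≠ ·) = v'.toList.destutter (· ≠ ·) := h₂.2
      simp only [islandLetters, FreeMonoid.toList_mul]
      rw [GammaAux.destutter_append, GammaAux.destutter_append, e₁, e₂]

/-- The letters as one-letter words. -/
def Letter.word (a : Letter) : Word := FreeMonoid.of a

/-- The word `xyxty`. -/
def wordXYXTY : Word :=
  Letter.x.word * (Letter.y 0).word * Letter.x.word * (Letter.t 0).word * (Letter.y 0).word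

/-- The word `ytxyx`. -/
def wordYTXYX : Word :=
  (Letter.y 0).word * (Letter.t 0).word * Letter.x.word * (Letter.y 0).word * Letter.x.word

/-- `γ'' = γ ∧ FIC(𝐌(xyxty, ytxyx))`. -/
noncomputable def gammaPP : Con Word :=
  gammaCon ⊓
    (MonoidVariety.generatedBy (ReesQuotient ({wordXYXTY, wordYTXYX} : Set Word))).fic

/-! ### The words `a^{(p)}_{n,m}[ρ]` -/

/-- `(n,m)`-permutations: among any two consecutive values `iρ`, `(i+1)ρ`, exactly one is one of
the first `n` numbers. -/
def IsNMPerm (n m : ℕ) (ρ : Equiv.Perm (Fin (n + m))) : Prop :=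
  ∀ i j : Fin (n + m), (i : ℕ) + 1 = j →
    ((ρ i : ℕ) < n ∧ n ≤ (ρ j : ℕ)) ∨ ((ρ j : ℕ) < n ∧ n ≤ (ρ i : ℕ))

/-- `z_i t_i` -/
def zt (i : ℕ) : Word := (Letter.z i).word * (Letter.t i).word

/-- `t_i z_i` -/
def tz (i : ℕ) : Word := (Letter.t i).word * (Letter.z i).word

/-- `z_i y_i²` -/
def zyy (i : ℕ) : Word := (Letter.z i).word * (Letter.y i).word ^ 2

/-- `z_i y_i² z_i'` -/
def zyyz (i : ℕ) : Word := zyy i * (Letter.zp i).word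

/-- `a^{(1)}_{n,m}[ρ]` -/
def aWord1 (n m : ℕ) (ρ : Equiv.Perm (Fin (n + m))) : Word :=
  (List.ofFn fun i : Fin n => zt i).prod *
    Letter.x.word *
    (List.ofFn fun i : Fin (n + m) =>
      if (ρ i : ℕ) < n then (Letter.z (ρ i)).word else zyyz (ρ i)).prod *
    Letter.x.word *
    (List.ofFn fun i : Fin m =>
      tz (n + i) * (Letter.tp (n + i)).word * (Letter.zp (n + i)).word).prod

/-- `a^{(2)}_{n,m}[ρ]` -/
def aWord2 (n m : ℕ) (ρ : Equiv.Perm (Fin (n + m))) : Word :=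
  (List.ofFn fun i : Fin n => zt i * (Letter.zp i).word * (Letter.tp i).word).prod *
    Letter.x.word *
    (List.ofFn fun i : Fin (n + m) =>
      if (ρ i : ℕ) < n then zyyz (ρ i) else (Letter.z (ρ i)).word).prod *
    Letter.x.word *
    (List.ofFn fun i : Fin m => tz (n + i)).prod

/-- `a^{(3)}_{n,m}[ρ]`; the last factor of the middle product has its letter `y` deleted. -/
def aWord3 (n m : ℕ) (ρ : Equiv.Perm (Fin (n + m))) : Word :=
  (List.ofFn fun i : Fin n => zt i).prod *
    Letter.x.word *
    (List.ofFn fun i : Fin (n + m) =>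
      if (ρ i : ℕ) < n ∧ (i : ℕ) + 1 < n + m then zyy (ρ i) else (Letter.z (ρ i)).word).prod *
    Letter.x.word *
    (List.ofFn fun i : Fin m => tz (n + i)).prod

/-- `a^{(4)}_{n,m}[ρ]`; the last factor of the middle product has its letter `y` deleted. -/
def aWord4 (n m : ℕ) (ρ : Equiv.Perm (Fin (n + m))) : Word :=
  (List.ofFn fun i : Fin n => zt i).prod *
    Letter.x.word *
    (List.ofFn fun i : Fin (n + m) =>
      if n ≤ (ρ i : ℕ) ∧ (i : ℕ) + 1 < n + m then zyy (ρ i) else (Letter.z (ρ i)).word).prod *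
    Letter.x.word *
    (List.ofFn fun i : Fin m => tz (n + i)).prod

/-- `a^{(p + 1)}_{n,m}[ρ]` for `p = 0, 1, 2, 3`. -/
def aWord (p : Fin 4) (n m : ℕ) (ρ : Equiv.Perm (Fin (n + m))) : Word :=
  match p with
  | 0 => aWord1 n m ρ
  | 1 => aWord2 n m ρ
  | 2 => aWord3 n m ρ
  | 3 => aWord4 n m ρ

/-- `[w]^α`: the `α`-class of the word `w`. -/
def conClass (α : Con Word) (w : Word) : α.Quotient := (w : α.Quotient)

/-- `𝐌_α(w)`: the variety generated by the monoid `M_α({w})`, where `w` is an `α`-class. -/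
def sapirVariety (α : Con Word) (w : α.Quotient) : MonoidVariety :=
  MonoidVariety.generatedBy (SapirMonoid α {w})

/-! ### A criterion for nondistributivity -/

/-! Three identities carry the argument. For words F, I₁, I₂ let X, Y, Z be the subvarieties of V
given by F ≈ I₁, F ≈ I₂, I₁ ≈ I₂. Both X ∧ Z and Y ∧ Z satisfy F ≈ I₁, hence so does their join, and
it suffices to find a monoid in (X ∨ Y) ∧ Z that violates F ≈ I₁. A set of words saturated for
FIC(V) has a fully invariant syntactic congruence whose quotient lies in V. If T₁ and T₂ are
saturated, T₁ does not separate F from I₁, T₂ does not separate F from I₂, T₁ ∩ T₂ does not separate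
I₁ from I₂ (in all contexts and under all substitutions), and T₁ ∩ T₂ contains F but not I₁, then
the syntactic quotient of T₁ ∩ T₂ is the desired monoid (`not_isDistributiveLattice_of_sets`).

Let w = Lf x za M₀ zc x Rt be the given word and A its γ''-class; words of A differ from w only in
letters y between the two x. In F the pair x…x is replaced by six pairs of "bounds", and copies of
za and zc are added: the middle of F is g A₁ h A₂ k c₁ A₃ g' c₂ · za M₀ zc · c₁ g C₁ c₂ k C₂ h C₃
g', and the outer occurrence of za (of zc) is accompanied by A₁, A₂, A₃ (by C₁, C₂, C₃). A test
reads one bound as x, one of za, Aᵢ as za, one of zc, Cᵢ as zc, erases the other auxiliary letters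
and asks whether the result lies in A. So it detects which letters lie in the interval of a bound.
I₁ is F with the first c₁ doubled, I₂ is F with the second c₂ doubled; T₁ consists of the words that
pass the same tests as F for g, h, k, c₂, and T₂ of those that do so for g', h, k, c₁.

Doubling c₁ under a substitution φ is invisible to a test whose bound is not in φ(c₁): in a word of
A the read factor contains no x, no t because its letters repeat, hence no z because a t separates
the two occurrences of a z; it is a power of some y, whose exponent is irrelevant
(`mem_double_iff`). It remains to keep tested bounds out of φ(c₁) (`notMem_of_Q₁`, `notMem_of_Q₂`).
The tests force intervals to overlap in the image as in F. If φ(c₁) contains a bound, each bound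
overlapping it lies in the image of a letter with one occurrence between the two c₁ and one outside
(`exists_mem_of_crosses`); outer letters are excluded by counting the letters t
(`not_mem_outer_right`). On the left no letter remains, on the right only g' and c₂. Since g
overlaps h, k, c₂ from the left, only g could lie in φ(c₁), and then h, k, c₂ must share two images,
although the tests separate any two of them. For I₂, where c₂ occurs three times, only g' remains on
the right and cannot house both c₂ and g'. The remaining cases follow by reversing words.

If the middle of w is a single letter, za and zc would coincide. Then w is z t x z x or x z x t z,
and the construction is applied to an isoterm of the same variety, z t z' t' x z z' x or its mirror
image, with a singleton as A. -/

/-- The fully invariant syntactic congruence of a set of words. -/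
def synCon (T : Set Word) : Con Word where
  r u v := ∀ (p q : Word) (φ : Letter → Word),
    p * FreeMonoid.lift φ u * q ∈ T ↔ p * FreeMonoid.lift φ v * q ∈ T
  iseqv :=
    { refl := fun _ _ _ _ => Iff.rfl
      symm := fun h p q φ => (h p q φ).symm
      trans := fun h₁ h₂ p q φ => (h₁ p q φ).trans (h₂ p q φ) }
  mul' := by
    intro u u' v v' h₁ h₂ p q φ
    have e₁ := h₁ p (FreeMonoid.lift φ v * q) φ
    have e₂ := h₂ (p * FreeMonoid.lift φ u') q φ
    simp only [map_mul, mul_assoc] at e₁ e₂ ⊢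
    exact e₁.trans e₂

theorem lift_lift (φ ψ : Letter → Word) (w : Word) :
    FreeMonoid.lift φ (FreeMonoid.lift ψ w) =
      FreeMonoid.lift (fun l => FreeMonoid.lift φ (ψ l)) w := by
  have : (FreeMonoid.lift φ).comp (FreeMonoid.lift ψ) =
      FreeMonoid.lift (fun l => FreeMonoid.lift φ (ψ l)) := by
    ext l; simp
  exact DFunLike.congr_fun this w

theorem lift_mk {c : Con Word} (φ : Letter → Word) (w : Word) :
    FreeMonoid.lift (fun l => (φ l : c.Quotient)) w = (FreeMonoid.lift φ w : Word) := by
  have : FreeMonoid.lift (fun l => (φ l : c.Quotient)) = c.mk'.comp (FreeMonoid.lift φ) := by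
    ext l; simp
  rw [this]; rfl

theorem satisfies_quotient_iff (c : Con Word) (e : Word × Word) :
    Satisfies c.Quotient e ↔
      ∀ φ : Letter → Word, c (FreeMonoid.lift φ e.1) (FreeMonoid.lift φ e.2) := by
  constructor
  · intro h φ
    have := h (fun l => (φ l : c.Quotient))
    rw [lift_mk, lift_mk] at this
    exact (Con.eq c).1 this
  · intro h φ
    have hs : ∀ l, ∃ w : Word, (w : c.Quotient) = φ l := fun l => Quotient.exists_rep (φ l)
    choose φ' hφ' using hs
    have : φ = fun l => (φ' l : c.Quotient) := funext fun l => (hφ' l).symm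
    rw [this, lift_mk, lift_mk]
    exact (Con.eq c).2 (h φ')

theorem lift_of_self (w : Word) : FreeMonoid.lift FreeMonoid.of w = w := by
  have : FreeMonoid.lift (FreeMonoid.of : Letter → Word) = MonoidHom.id _ := by
    ext l; simp
  rw [this]; rfl

/-- Full invariance: a substitution of the variables is absorbed by the `φ` in `synCon`. -/
theorem satisfies_synCon_iff (T : Set Word) (e : Word × Word) :
    Satisfies (synCon T).Quotient e ↔ synCon T e.1 e.2 := by
  rw [satisfies_quotient_iff]
  constructor
  · intro h
    have := h FreeMonoid.of
    rwa [lift_of_self, lift_of_self] at this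
  · intro h φ p q χ
    have := h p q (fun l => FreeMonoid.lift χ (φ l))
    rwa [← lift_lift, ← lift_lift] at this

theorem MonoidVariety.identities_lift {V : MonoidVariety} {u v : Word}
    (h : (u, v) ∈ V.identities) (φ : Letter → Word) :
    (FreeMonoid.lift φ u, FreeMonoid.lift φ v) ∈ V.identities := by
  intro M _ hM χ
  have hu : ∀ w, FreeMonoid.lift χ (FreeMonoid.lift φ w) =
      FreeMonoid.lift (fun l => FreeMonoid.lift χ (φ l)) w := by
    intro w
    have : (FreeMonoid.lift χ).comp (FreeMonoid.lift φ) =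
        FreeMonoid.lift (fun l => FreeMonoid.lift χ (φ l)) := by
      ext l; simp
    exact DFunLike.congr_fun this w
  simp only [hu]
  exact h M hM _

theorem MonoidVariety.identities_symm {V : MonoidVariety} {u v : Word}
    (h : (u, v) ∈ V.identities) : (v, u) ∈ V.identities :=
  fun M _ hM χ => (h M hM χ).symm

theorem MonoidVariety.identities_mul {V : MonoidVariety} {u v : Word}
    (h : (u, v) ∈ V.identities) (p q : Word) : (p * u * q, p * v * q) ∈ V.identities := by
  intro M _ hM χ
  have := h M hM χ
  simp only [map_mul] at this ⊢
  rw [this]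

/-- The set `T` is a union of classes of the congruence `FIC(V)`. -/
def StableSet (V : MonoidVariety) (T : Set Word) : Prop :=
  ∀ u v, (u, v) ∈ V.identities → u ∈ T → v ∈ T

/-- Contexts and substitutions carry identities of `V` to identities of `V`, so the syntactic
congruence of a saturated set contains `FIC(V)`. -/
theorem mem_synCon_quotient {V : MonoidVariety} {T : Set Word} (h : StableSet V T) :
    V.Mem (synCon T).Quotient := by
  rw [MonoidVariety.mem_iff]
  rintro ⟨u, v⟩ he
  rw [satisfies_synCon_iff]
  intro p q φ
  have := MonoidVariety.identities_mul (MonoidVariety.identities_lift he φ) p q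
  exact ⟨h _ _ this, h _ _ (MonoidVariety.identities_symm this)⟩

/-- The syntactic quotient of `T₁ ∩ T₂` lies in `(X ⊔ Y) ⊓ Z` but violates `F ≈ I₁`, which holds
throughout `(X ⊓ Z) ⊔ (Y ⊓ Z)`. -/
theorem not_isDistributiveLattice_of_sets (V : MonoidVariety) (F I₁ I₂ : Word) (T₁ T₂ : Set Word)
    (hV₁ : StableSet V T₁) (hV₂ : StableSet V T₂)
    (h₁ : synCon T₁ F I₁) (h₂ : synCon T₂ F I₂) (h₃ : synCon (T₁ ∩ T₂) I₁ I₂)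
    (hF : F ∈ T₁ ∩ T₂) (hI : I₁ ∉ T₁ ∩ T₂) :
    ¬ IsDistributiveLattice V.Subvarieties := by
  intro hd
  have hV₃ : StableSet V (T₁ ∩ T₂) := fun u v e hu => ⟨hV₁ u v e hu.1, hV₂ u v e hu.2⟩
  let X : V.Subvarieties := ⟨V ⊓ .ofIdentities {(F, I₁)}, Set.mem_Iic.2 inf_le_left⟩
  let Y : V.Subvarieties := ⟨V ⊓ .ofIdentities {(F, I₂)}, Set.mem_Iic.2 inf_le_left⟩
  let Z : V.Subvarieties := ⟨V ⊓ .ofIdentities {(I₁, I₂)}, Set.mem_Iic.2 inf_le_left⟩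
  have key : ((X ⊔ Y) ⊓ Z : V.Subvarieties).1.Mem (synCon (T₁ ∩ T₂)).Quotient := by
    constructor
    -- The quotients for `T₁` and `T₂` lie in `X` and `Y`; a common identity of both respects each
    -- set, hence the intersection.
    · rintro ⟨u, v⟩ ⟨hx, hy⟩
      rw [satisfies_synCon_iff]
      have e₁ : Satisfies (synCon T₁).Quotient (u, v) := hx _ ⟨mem_synCon_quotient hV₁, by
        rintro e rfl; rw [satisfies_synCon_iff]; exact h₁⟩
      have e₂ : Satisfies (synCon T₂).Quotient (u, v) := hy _ ⟨mem_synCon_quotient hV₂, by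
        rintro e rfl; rw [satisfies_synCon_iff]; exact h₂⟩
      rw [satisfies_synCon_iff] at e₁ e₂
      intro p q φ
      exact and_congr (e₁ p q φ) (e₂ p q φ)
    · exact ⟨mem_synCon_quotient hV₃, by
        rintro e rfl; rw [satisfies_synCon_iff]; exact h₃⟩
  rw [hd X Y Z] at key
  have hs : Satisfies (synCon (T₁ ∩ T₂)).Quotient (F, I₁) := by
    refine key (F, I₁) ⟨?_, ?_⟩
    · intro M _ hM
      exact hM.1.2 _ rfl
    -- In `Y ⊓ Z` the identity `F ≈ I₁` is derived through `I₂`.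
    · intro M _ hM φ
      have e₁ : Satisfies M (F, I₂) := hM.1.2 _ rfl
      have e₂ : Satisfies M (I₁, I₂) := hM.2.2 _ rfl
      exact (e₁ φ).trans (e₂ φ).symm
  rw [satisfies_synCon_iff] at hs
  have := hs 1 1 FreeMonoid.of
  simp only [lift_of_self, one_mul, mul_one] at this
  exact hI (this.1 hF)

/-! ### Stability of the class of a word -/

/-- Evaluate the identity at the letters themselves: the class of `u` is `[w]`, which lies outside
the ideal, and in a Rees quotient such an element is identified with nothing else. -/
theorem stableSet_conClass (α : Con Word) (w : Word) :
    StableSet (sapirVariety α (conClass α w)) {u | α u w} := by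
  intro u v he hu
  have hs : Satisfies (SapirMonoid α {conClass α w}) (u, v) :=
    he _ ((MonoidVariety.isLeast_generatedBy _).1)
  let R := reesCon ({conClass α w} : Set α.Quotient)
  have hm : ∀ x : Word, FreeMonoid.lift
      (fun l => (((FreeMonoid.of l : Word) : α.Quotient) : R.Quotient)) x =
      ((x : α.Quotient) : R.Quotient) := by
    intro x
    have : FreeMonoid.lift (fun l => (((FreeMonoid.of l : Word) : α.Quotient) : R.Quotient)) =
        R.mk'.comp α.mk' := by
      ext l; simp
    rw [this]; rfl
  have h := hs (fun l => (((FreeMonoid.of l : Word) : α.Quotient) : R.Quotient))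
  rw [hm, hm] at h
  have h' : R u v := (Con.eq R).1 h
  have huw : (u : α.Quotient) = conClass α w := (Con.eq α).2 hu
  have hf : (u : α.Quotient) ∈ factorClosure ({conClass α w} : Set α.Quotient) :=
    ⟨_, rfl, 1, 1, by simp [huw]⟩
  rcases h' with h' | h'
  · exact (Con.eq α).1 (h'.symm.trans huw)
  · exact absurd hf h'.1

/-! ### Positions of the occurrences of letters -/

section Pos

variable {α β : Type*} [DecidableEq α] [DecidableEq β]

/-- The length of the shortest prefix of `u` with at least `i` occurrences of `a`. -/
noncomputable def pos (u : List α) (a : α) (i : ℕ) : ℕ := sInf {k | i ≤ (u.take k).count a}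

theorem count_take_le_count_take (u : List α) (a : α) {k l : ℕ} (h : k ≤ l) :
    (u.take k).count a ≤ (u.take l).count a :=
  (List.take_sublist_take_left h).count_le a

/-- The hypothesis makes the set in `pos` nonempty; beyond the number of occurrences `sInf` returns
the default value `0`. -/
theorem pos_le_iff {u : List α} {a : α} {i k : ℕ} (h : i ≤ u.count a) :
    pos u a i ≤ k ↔ i ≤ (u.take k).count a := by
  have hne : {k | i ≤ (u.take k).count a}.Nonempty := ⟨u.length, by simpa using h⟩
  constructor
  · intro hk
    have := Nat.sInf_mem hne
    exact le_trans this (count_take_le_count_take u a hk)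
  · intro hk
    exact Nat.sInf_le hk

theorem pos_append_le_iff {P Q : List α} {a : α} {i : ℕ} (h : i ≤ (P ++ Q).count a) :
    pos (P ++ Q) a i ≤ P.length ↔ i ≤ P.count a := by
  rw [pos_le_iff h]; simp

/-- An order of occurrences becomes a cut of the word, and cuts survive substitutions. -/
theorem pos_lt_iff {u : List α} {a b : α} {i j : ℕ} (hi : i ≤ u.count a) (hj : j ≤ u.count b) :
    pos u a i < pos u b j ↔ ∃ P Q, u = P ++ Q ∧ i ≤ P.count a ∧ P.count b < j := by
  constructor
  · intro h
    refine ⟨u.take (pos u a i), u.drop (pos u a i), (List.take_append_drop _ _).symm, ?_, ?_⟩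
    · exact (pos_le_iff hi).1 le_rfl
    · by_contra hc
      exact absurd ((pos_le_iff hj).2 (not_lt.1 hc)) (not_le.2 h)
  · rintro ⟨P, Q, rfl, h₁, h₂⟩
    have e₁ := (pos_append_le_iff hi).2 h₁
    have e₂ := mt (pos_append_le_iff hj).1 (not_le.2 h₂)
    omega

/-- The last letter of the shortest prefix would have to be both `a` and `b`. For `i = 0` the prefix
is empty, whence `1 ≤ i`. -/
theorem pos_ne_pos {u : List α} {a b : α} {i j : ℕ} (hab : a ≠ b) (hi₀ : 1 ≤ i)
    (hi : i ≤ u.count a) (hj : j ≤ u.count b) : pos u a i ≠ pos u b j := by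
  intro he
  set k := pos u a i with hk
  have h₁ : i ≤ (u.take k).count a := (pos_le_iff hi).1 le_rfl
  have h₁' : j ≤ (u.take k).count b := (pos_le_iff hj).1 he.symm.le
  have hk0 : 0 < k := by
    rcases Nat.eq_zero_or_pos k with h0 | h0
    · rw [h0] at h₁; simp at h₁; omega
    · exact h0
  have h₂ : ¬ i ≤ (u.take (k - 1)).count a := by
    rw [← pos_le_iff hi]; omega
  have h₂' : ¬ j ≤ (u.take (k - 1)).count b := by
    rw [← pos_le_iff hj]; omega
  have : k = (k - 1) + 1 := by omega
  rw [this, List.take_add_one, List.count_append] at h₁ h₁'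
  cases hx : u[k - 1]? with
  | none => simp [hx] at h₁; omega
  | some x =>
    simp only [hx, Option.toList_some, List.count_singleton] at h₁ h₁'
    have e₁ : x = a := by by_contra hc; simp [hc] at h₁; omega
    have e₂ : x = b := by by_contra hc; simp [hc] at h₁'; omega
    exact hab (e₁.symm.trans e₂)

/-- The occurrences of a letter in the middle factor. -/
theorem pos_mem_middle {P r Q : List α} {a : α} {i : ℕ} (h₁ : P.count a < i)
    (h₂ : i ≤ (P ++ r).count a) :
    P.length < pos (P ++ r ++ Q) a i ∧ pos (P ++ r ++ Q) a i ≤ P.length + r.length := by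
  have hi : i ≤ (P ++ r ++ Q).count a := by rw [List.count_append]; omega
  constructor
  · by_contra hc
    have : i ≤ P.count a := by
      rw [List.append_assoc] at hc hi
      exact (pos_append_le_iff hi).1 (not_lt.1 hc)
    omega
  · have := (pos_append_le_iff hi).2 h₂
    simpa using this

theorem pos_not_mem_middle {P r Q : List α} {a : α} {i : ℕ} (hr : a ∉ r)
    (hi : i ≤ (P ++ r ++ Q).count a) :
    pos (P ++ r ++ Q) a i ≤ P.length ∨ P.length + r.length < pos (P ++ r ++ Q) a i := by
  by_cases h : i ≤ P.count a
  · left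
    rw [List.append_assoc] at hi ⊢
    exact (pos_append_le_iff hi).2 h
  · right
    by_contra hc
    have : pos (P ++ r ++ Q) a i ≤ (P ++ r).length := by simpa using hc
    rw [pos_append_le_iff hi, List.count_append, List.count_eq_zero.2 hr] at this
    omega

theorem count_flatMap_of_count {W : List α} {φ : α → List β} {a : α} {a' : β}
    (h : ∀ e ∈ W, (φ e).count a' = if e = a then 1 else 0) :
    (W.flatMap φ).count a' = W.count a := by
  induction W with
  | nil => simp
  | cons e W ih =>
    rw [List.flatMap_cons, List.count_append, h e (by simp), ih fun e' he' => h e' (by simp [he']),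
      List.count_cons]
    by_cases hea : e = a <;> simp [hea, Nat.add_comm]

/-- A cut of `W` induces a cut of the image with the same numbers of `a'` and `b'`; only `b'` in the
prefix `p` could spoil the upper bound. -/
theorem pos_lt_of_transfer {W : List α} {p q : List β} {φ : α → List β} {a b : α} {a' b' : β}
    {i j : ℕ}
    (ha : ∀ e ∈ W, (φ e).count a' = if e = a then 1 else 0)
    (hb : ∀ e ∈ W, (φ e).count b' = if e = b then 1 else 0)
    (hpb : b' ∉ p)
    (hi : i ≤ W.count a) (hj : j ≤ W.count b)
    (h : pos W a i < pos W b j) :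
    pos (p ++ W.flatMap φ ++ q) a' i < pos (p ++ W.flatMap φ ++ q) b' j := by
  obtain ⟨P, Q, rfl, h₁, h₂⟩ := (pos_lt_iff hi hj).1 h
  have cP : (P.flatMap φ).count a' = P.count a :=
    count_flatMap_of_count fun e he => ha e (by simp [he])
  have cPb : (P.flatMap φ).count b' = P.count b :=
    count_flatMap_of_count fun e he => hb e (by simp [he])
  have ca := count_flatMap_of_count ha
  have cb := count_flatMap_of_count hb
  refine (pos_lt_iff ?_ ?_).2 ⟨p ++ P.flatMap φ, Q.flatMap φ ++ q, by simp, ?_, ?_⟩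
  · simp only [List.count_append, ca] at *; omega
  · simp only [List.count_append, cb] at *; omega
  · rw [List.count_append]; omega
  · rw [List.count_append, List.count_eq_zero.2 hpb]; omega

theorem pos_lt_iff_transfer {W : List α} {p q : List β} {φ : α → List β} {a b : α} {a' b' : β}
    {i j : ℕ} (hab : a ≠ b)
    (ha : ∀ e ∈ W, (φ e).count a' = if e = a then 1 else 0)
    (hb : ∀ e ∈ W, (φ e).count b' = if e = b then 1 else 0)
    (hpa : a' ∉ p) (hpb : b' ∉ p) (hi₀ : 1 ≤ i)
    (hi : i ≤ W.count a) (hj : j ≤ W.count b) :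
    pos W a i < pos W b j ↔
      pos (p ++ W.flatMap φ ++ q) a' i < pos (p ++ W.flatMap φ ++ q) b' j := by
  refine ⟨pos_lt_of_transfer ha hb hpb hi hj, fun h => ?_⟩
  by_contra hc
  have : pos W b j < pos W a i := by
    have := pos_ne_pos hab hi₀ hi hj
    omega
  have := pos_lt_of_transfer (q := q) hb ha hpa hj hi this
  omega

/-- Two letters that occur in a repeated factor are separated from a letter that does not occur in
the factor in the same way. -/
theorem pos_iff_of_repeated {w₁ w₂ w₃ r : List α} {f f' s : α} {m : ℕ}
    (hf : f ∈ r) (hf' : f' ∈ r) (hs : s ∉ r)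
    (cf : (w₁ ++ r ++ w₂ ++ r ++ w₃).count f = 2) (cf' : (w₁ ++ r ++ w₂ ++ r ++ w₃).count f' = 2)
    (hm : m ≤ (w₁ ++ r ++ w₂ ++ r ++ w₃).count s) :
    let u := w₁ ++ r ++ w₂ ++ r ++ w₃
    (pos u f 1 < pos u s m ∧ pos u s m < pos u f 2) ↔
      (pos u f' 1 < pos u s m ∧ pos u s m < pos u f' 2) := by
  intro u
  have key : ∀ l : α, l ∈ r → u.count l = 2 →
      (w₁.length < pos u l 1 ∧ pos u l 1 ≤ w₁.length + r.length) ∧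
      ((w₁ ++ r ++ w₂).length < pos u l 2 ∧
        pos u l 2 ≤ (w₁ ++ r ++ w₂).length + r.length) := by
    intro l hl hc
    have h1 : 1 ≤ r.count l := List.one_le_count_iff.2 hl
    simp only [u, List.count_append] at hc
    constructor
    · have := pos_mem_middle (P := w₁) (r := r) (Q := w₂ ++ r ++ w₃) (a := l) (i := 1)
        (by omega) (by rw [List.count_append]; omega)
      simpa [u, List.append_assoc] using this
    · exact pos_mem_middle (P := w₁ ++ r ++ w₂) (r := r) (Q := w₃) (a := l) (i := 2)
        (by simp only [List.count_append]; omega) (by simp only [List.count_append]; omega)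
  have s1 : pos u s m ≤ w₁.length ∨ w₁.length + r.length < pos u s m := by
    have := pos_not_mem_middle (P := w₁) (r := r) (Q := w₂ ++ r ++ w₃) (i := m) hs
      (by simpa [List.append_assoc] using hm)
    simpa [u, List.append_assoc] using this
  have s2 : pos u s m ≤ (w₁ ++ r ++ w₂).length ∨
      (w₁ ++ r ++ w₂).length + r.length < pos u s m :=
    pos_not_mem_middle (P := w₁ ++ r ++ w₂) (r := r) (Q := w₃) (i := m) hs hm
  have k1 := key f hf cf
  have k2 := key f' hf' cf'
  omega

/-- A letter between two occurrences in the same factor belongs to the factor. -/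
theorem mem_of_pos_between {P r Q : List α} {a b t : α} {i j : ℕ}
    (ha₁ : P.count a < i) (ha₂ : i ≤ (P ++ r).count a)
    (hb₁ : P.count b < j) (hb₂ : j ≤ (P ++ r).count b)
    (ht : 1 ≤ (P ++ r ++ Q).count t)
    (h₁ : pos (P ++ r ++ Q) a i < pos (P ++ r ++ Q) t 1)
    (h₂ : pos (P ++ r ++ Q) t 1 < pos (P ++ r ++ Q) b j) : t ∈ r := by
  by_contra hc
  have e₁ := pos_mem_middle (Q := Q) ha₁ ha₂
  have e₂ := pos_mem_middle (Q := Q) hb₁ hb₂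
  have e₃ := pos_not_mem_middle (P := P) (Q := Q) hc ht
  omega

/-- The position of the occurrence that follows a given prefix. -/
theorem pos_append_cons (P Q : List α) (a : α) :
    pos (P ++ a :: Q) a (P.count a + 1) = P.length + 1 := by
  have hi : P.count a + 1 ≤ (P ++ a :: Q).count a := by
    rw [List.count_append, List.count_cons_self]; omega
  have h₁ : ¬ pos (P ++ a :: Q) a (P.count a + 1) ≤ P.length := by
    rw [pos_append_le_iff hi]; omega
  have h₂ : pos (P ++ [a] ++ Q) a (P.count a + 1) ≤ (P ++ [a]).length := by
    rw [pos_append_le_iff (by simp), List.count_append]; simp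
  simp only [List.append_assoc, List.singleton_append, List.length_append,
    List.length_singleton] at h₂
  omega

theorem exists_split_of_count_two {u : List α} {c : α} (h : u.count c = 2) :
    ∃ u₁ u₂ u₃, u = u₁ ++ c :: u₂ ++ c :: u₃ ∧ c ∉ u₁ ∧ c ∉ u₂ ∧ c ∉ u₃ := by
  have h1 : c ∈ u := List.count_pos_iff.1 (by omega)
  obtain ⟨u₁, v, hu, hu₁⟩ := List.eq_append_cons_of_mem h1
  subst hu
  have c1 := List.count_eq_zero.2 hu₁
  simp only [List.count_append, List.count_cons_self, c1] at h
  have h2 : c ∈ v := List.count_pos_iff.1 (by omega)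
  obtain ⟨u₂, u₃, hv, hu₂⟩ := List.eq_append_cons_of_mem h2
  subst hv
  have c2 := List.count_eq_zero.2 hu₂
  simp only [List.count_append, List.count_cons_self, c2] at h
  exact ⟨u₁, u₂, u₃, by simp, hu₁, hu₂, List.count_eq_zero.1 (by omega)⟩

theorem split_unique {γ : Type*} {u₁ u₂ u₃ v₁ v₂ v₃ : List γ} {c : γ}
    (h : u₁ ++ c :: u₂ ++ c :: u₃ = v₁ ++ c :: v₂ ++ c :: v₃)
    (h₁ : c ∉ u₁) (h₂ : c ∉ u₂) (k₁ : c ∉ v₁) (k₂ : c ∉ v₂) :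
    u₁ = v₁ ∧ u₂ = v₂ ∧ u₃ = v₃ := by
  have aux : ∀ {p q p' q' : List γ}, p ++ c :: q = p' ++ c :: q' → c ∉ p → c ∉ p' →
      p = p' ∧ q = q' := by
    intro p
    induction p with
    | nil =>
      intro q p' q' h _ hp'
      cases p' with
      | nil => simpa using h
      | cons x p' =>
        simp only [List.nil_append, List.cons_append, List.cons.injEq] at h
        simp [h.1] at hp'
    | cons x p ih =>
      intro q p' q' h hp hp'
      cases p' with
      | nil =>
        simp only [List.nil_append, List.cons_append, List.cons.injEq] at h
        simp [h.1] at hp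
      | cons x' p' =>
        simp only [List.cons_append, List.cons.injEq, List.mem_cons, not_or] at h hp hp'
        obtain ⟨e₁, e₂⟩ := ih h.2 hp.2 hp'.2
        exact ⟨by rw [h.1, e₁], e₂⟩
  have h' : u₁ ++ c :: (u₂ ++ c :: u₃) = v₁ ++ c :: (v₂ ++ c :: v₃) := by simpa using h
  obtain ⟨e₁, e₂⟩ := aux h' h₁ k₁
  obtain ⟨e₂, e₃⟩ := aux e₂ h₂ k₂
  exact ⟨e₁, e₂, e₃⟩

/-- Two letters whose images contain a common letter contribute to its number of occurrences. -/
theorem count_add_count_le_count_flatMap {W : List α} {φ : α → List β} {a b : α} {l : β}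
    (hab : a ≠ b) (ha : l ∈ φ a) (hb : l ∈ φ b) :
    W.count a + W.count b ≤ (W.flatMap φ).count l := by
  induction W with
  | nil => simp
  | cons e W ih =>
    rw [List.flatMap_cons, List.count_append, List.count_cons, List.count_cons]
    by_cases h₁ : e = a
    · subst h₁
      have := List.one_le_count_iff.2 ha
      simp [hab]; omega
    · by_cases h₂ : e = b
      · subst h₂
        have := List.one_le_count_iff.2 hb
        simp [h₁]; omega
      · simp [h₁, h₂]; omega

theorem count_le_count_flatMap {W : List α} {φ : α → List β} {a : α} {l : β} (ha : l ∈ φ a) :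
    W.count a ≤ (W.flatMap φ).count l := by
  induction W with
  | nil => simp
  | cons e W ih =>
    rw [List.flatMap_cons, List.count_append, List.count_cons]
    by_cases h₁ : e = a
    · subst h₁
      have := List.one_le_count_iff.2 ha
      simp; omega
    · simp [h₁]; omega

end Pos

/-! ### Patterns -/

/-- The letters `tᵢ` and `tᵢ'`. -/
def Letter.isT : Letter → Bool
  | .t _ => true
  | .tp _ => true
  | _ => false

/-- The letters `zᵢ` and `zᵢ'`. -/
def Letter.isZ : Letter → Bool
  | .z _ => true
  | .zp _ => true
  | _ => false

/-- The letters `yᵢ`. -/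
def Letter.isY : Letter → Bool
  | .y _ => true
  | _ => false

theorem Letter.ne_of_isT_of_isZ {a b : Letter} (ha : a.isT = true) (hb : b.isZ = true) :
    a ≠ b := by
  rintro rfl; cases a <;> simp_all [Letter.isT, Letter.isZ]

theorem Letter.ne_of_isY_of_isZ {a b : Letter} (ha : a.isY = true) (hb : b.isZ = true) :
    a ≠ b := by
  rintro rfl; cases a <;> simp_all [Letter.isY, Letter.isZ]

theorem Letter.ne_of_isT_of_isY {a b : Letter} (ha : a.isT = true) (hb : b.isY = true) :
    a ≠ b := by
  rintro rfl; cases a <;> simp_all [Letter.isT, Letter.isY]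

/-- The names of the auxiliary letters. -/
inductive Mark : Type
  | g | h | k | c₁ | g' | c₂ | A₁ | A₂ | A₃ | C₁ | C₂ | C₃

/-- The reversal of the names of the auxiliary letters. -/
def Mark.dual : Mark → Mark
  | .g => .g'
  | .h => .h
  | .k => .k
  | .c₁ => .c₂
  | .g' => .g
  | .c₂ => .c₁
  | .A₁ => .C₃
  | .A₂ => .C₂
  | .A₃ => .C₁
  | .C₁ => .A₃
  | .C₂ => .A₂
  | .C₃ => .A₁

@[simp]
theorem Mark.dual_dual (m : Mark) : m.dual.dual = m := by cases m <;> rfl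

/-- The marks whose two occurrences bound an interval. -/
def Mark.IsBound : Mark → Prop
  | .g | .h | .k | .c₁ | .g' | .c₂ => True
  | _ => False

/-- The marks `A₁`, `A₂`, `A₃`. -/
def Mark.IsA : Mark → Prop
  | .A₁ | .A₂ | .A₃ => True
  | _ => False

/-- The marks `C₁`, `C₂`, `C₃`. -/
def Mark.IsC : Mark → Prop
  | .C₁ | .C₂ | .C₃ => True
  | _ => False

/-- `tbl m a` tells if `a` lies between the two occurrences of `m` in the word `F`. -/
def Mark.tbl : Mark → Mark → Bool
  | .g, .A₁ | .g, .A₂ | .g, .A₃ => true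
  | .h, .A₂ | .h, .A₃ | .h, .C₁ | .h, .C₂ => true
  | .k, .A₃ | .k, .C₁ => true
  | .c₁, .A₃ => true
  | .g', .C₁ | .g', .C₂ | .g', .C₃ => true
  | .c₂, .C₁ => true
  | _, _ => false

theorem Mark.isA_dual {m : Mark} : m.dual.IsA ↔ m.IsC := by cases m <;> rfl
theorem Mark.isC_dual {m : Mark} : m.dual.IsC ↔ m.IsA := by cases m <;> rfl

theorem Mark.IsBound.not_isA {m : Mark} (h : m.IsBound) : ¬ m.IsA := by
  cases m <;> simp_all [Mark.IsBound, Mark.IsA]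

theorem Mark.IsBound.not_isC {m : Mark} (h : m.IsBound) : ¬ m.IsC := by
  cases m <;> simp_all [Mark.IsBound, Mark.IsC]

/-- The combinatorial data of a word `Lf x za M₀ zc x Rt`. -/
structure Frame where
  Lf : List Letter
  M₀ : List Letter
  Rt : List Letter
  za : Letter
  zc : Letter
  mem_Lf : ∀ l ∈ Lf, l.isT = true ∨ l.isZ = true
  mem_Rt : ∀ l ∈ Rt, l.isT = true ∨ l.isZ = true
  mem_M₀ : ∀ l ∈ M₀, l.isZ = true ∨ l.isY = true
  isZ_za : za.isZ = true
  isZ_zc : zc.isZ = true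
  za_ne_zc : za ≠ zc
  count_T : ∀ l, l.isT = true → Lf.count l + Rt.count l ≤ 1
  count_Z : ∀ l, l.isZ = true → l ∈ Lf ∨ l ∈ Rt ∨ l ∈ za :: (M₀ ++ [zc]) →
    Lf.count l + Rt.count l = 1 ∧ (za :: (M₀ ++ [zc])).count l = 1
  count_Y : ∀ l ∈ M₀, l.isY = true → 2 ≤ M₀.count l
  -- No two letters `t` are adjacent in the outer factors: this allows the image of a single `t` at
  -- most one `t` in the counting of `not_mem_outer_right`.
  chain_Lf : Lf.IsChain fun a b => ¬ (a.isT = true ∧ b.isT = true)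
  chain_Rt : Rt.IsChain fun a b => ¬ (a.isT = true ∧ b.isT = true)
  head_Lf : ∀ l, Lf.head? = some l → l.isZ = true
  last_Lf : ∀ l, Lf.getLast? = some l → l.isT = true
  head_Rt : ∀ l, Rt.head? = some l → l.isT = true
  last_Rt : ∀ l, Rt.getLast? = some l → l.isZ = true

/-- A frame together with a set of words `A` that contains its word and with auxiliary letters. -/
structure Pattern extends Frame where
  A : Set (List Letter)
  e : Mark → Letter
  LA : List Letter
  LC : List Letter
  mem_A : Lf ++ .x :: (za :: (M₀ ++ [zc])) ++ .x :: Rt ∈ A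
  form_A : ∀ b ∈ A, ∃ M', b = Lf ++ .x :: M' ++ .x :: Rt ∧
    M'.filter (fun l => !l.isY) = (za :: (M₀ ++ [zc])).filter (fun l => !l.isY)
  -- This condition and the next make doubling a power of a `y` harmless.
  contiguous_A : ∀ (y : Letter) (B₁ B₂ B₃ : List Letter), y.isY = true →
    B₁ ++ y :: B₂ ++ y :: B₃ ∈ A → ∀ l ∈ B₂, l = y
  exponent_A : ∀ (y : Letter) (w₁ w₂ : List Letter), y.isY = true →
    (w₁ ++ y :: y :: w₂ ∈ A ↔ w₁ ++ y :: y :: y :: w₂ ∈ A)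
  inj_e : Function.Injective e
  isY_e : ∀ m, (e m).isY = true
  notMem_e : ∀ m, e m ∉ M₀
  -- Only the multiset matters, since a reading keeps one of the four letters and erases the others.
  -- The order is left free so that reversal gives a pattern again.
  perm_LA : LA.Perm [za, e .A₁, e .A₂, e .A₃]
  perm_LC : LC.Perm [zc, e .C₁, e .C₂, e .C₃]

namespace Pattern

variable (S : Pattern)

/-- The factor between the two occurrences of `x`. -/
def md : List Letter := S.za :: (S.M₀ ++ [S.zc])

/-- The reversal of a pattern. -/
def dual : Pattern where
  Lf := S.Rt.reverse
  M₀ := S.M₀.reverse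
  Rt := S.Lf.reverse
  za := S.zc
  zc := S.za
  A := {u | u.reverse ∈ S.A}
  e m := S.e m.dual
  LA := S.LC.reverse
  LC := S.LA.reverse
  mem_Lf l hl := S.mem_Rt l (by simpa using hl)
  mem_Rt l hl := S.mem_Lf l (by simpa using hl)
  mem_M₀ l hl := S.mem_M₀ l (by simpa using hl)
  isZ_za := S.isZ_zc
  isZ_zc := S.isZ_za
  za_ne_zc := S.za_ne_zc.symm
  count_T l hl := by
    have := S.count_T l hl
    simp only [List.count_reverse]; omega
  count_Z l hl h := by
    have := S.count_Z l hl (by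
      simp only [List.mem_reverse, List.mem_cons, List.mem_append] at h ⊢
      tauto)
    simp only [List.count_reverse, List.count_cons, List.count_append, List.count_nil] at this ⊢
    omega
  count_Y l hl h := by
    have := S.count_Y l (by simpa using hl) h
    simpa using this
  chain_Lf := by
    rw [List.isChain_reverse]
    exact S.chain_Rt.imp fun a b h => by simpa [flip, and_comm] using h
  chain_Rt := by
    rw [List.isChain_reverse]
    exact S.chain_Lf.imp fun a b h => by simpa [flip, and_comm] using h
  head_Lf l hl := S.last_Rt l (by simpa using hl)
  last_Lf l hl := S.head_Rt l (by simpa using hl)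
  head_Rt l hl := S.last_Lf l (by simpa using hl)
  last_Rt l hl := S.head_Lf l (by simpa using hl)
  mem_A := by
    have := S.mem_A
    simpa [List.append_assoc] using this
  form_A b hb := by
    obtain ⟨M', h₁, h₂⟩ := S.form_A _ hb
    refine ⟨M'.reverse, ?_, ?_⟩
    · rw [← b.reverse_reverse, h₁]; simp
    · rw [List.filter_reverse, h₂, ← List.filter_reverse]; simp
  contiguous_A y B₁ B₂ B₃ hy h l hl := by
    refine S.contiguous_A y B₃.reverse B₂.reverse B₁.reverse hy ?_ l (by simpa using hl)
    have h' : (B₁ ++ y :: B₂ ++ y :: B₃).reverse ∈ S.A := h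
    simpa [List.append_assoc] using h'
  exponent_A y w₁ w₂ hy := by
    have := S.exponent_A y w₂.reverse w₁.reverse hy
    simpa [List.append_assoc] using this
  inj_e := S.inj_e.comp (Function.LeftInverse.injective Mark.dual_dual)
  isY_e _ := S.isY_e _
  notMem_e m := by simpa using S.notMem_e m.dual
  perm_LA := by
    refine (List.reverse_perm _).trans (S.perm_LC.trans ?_)
    refine List.Perm.cons _ ?_
    exact (List.reverse_perm [S.e .C₁, S.e .C₂, S.e .C₃]).symm
  perm_LC := by
    refine (List.reverse_perm _).trans (S.perm_LA.trans ?_)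
    refine List.Perm.cons _ ?_
    exact (List.reverse_perm [S.e .A₁, S.e .A₂, S.e .A₃]).symm

@[simp] theorem dual_Lf : S.dual.Lf = S.Rt.reverse := rfl
@[simp] theorem dual_M₀ : S.dual.M₀ = S.M₀.reverse := rfl
@[simp] theorem dual_Rt : S.dual.Rt = S.Lf.reverse := rfl
@[simp] theorem dual_za : S.dual.za = S.zc := rfl
@[simp] theorem dual_zc : S.dual.zc = S.za := rfl
@[simp] theorem dual_LA : S.dual.LA = S.LC.reverse := rfl
@[simp] theorem dual_LC : S.dual.LC = S.LA.reverse := rfl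
@[simp] theorem dual_e (m : Mark) : S.dual.e m = S.e m.dual := rfl
/-- The letters that can stand for `za`. -/
def IsA (α : Letter) : Prop := α = S.za ∨ ∃ m : Mark, m.IsA ∧ α = S.e m

/-- The letters that can stand for `zc`. -/
def IsC (β : Letter) : Prop := β = S.zc ∨ ∃ m : Mark, m.IsC ∧ β = S.e m

theorem isA_dual {α : Letter} : S.dual.IsA α ↔ S.IsC α := by
  constructor
  · rintro (h | ⟨m, hm, h⟩)
    · exact Or.inl h
    · exact Or.inr ⟨m.dual, Mark.isC_dual.2 hm, h⟩
  · rintro (h | ⟨m, hm, h⟩)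
    · exact Or.inl h
    · exact Or.inr ⟨m.dual, Mark.isA_dual.2 hm, by simpa [dual] using h⟩

theorem isC_dual {α : Letter} : S.dual.IsC α ↔ S.IsA α := by
  constructor
  · rintro (h | ⟨m, hm, h⟩)
    · exact Or.inl h
    · exact Or.inr ⟨m.dual, Mark.isA_dual.2 hm, h⟩
  · rintro (h | ⟨m, hm, h⟩)
    · exact Or.inl h
    · exact Or.inr ⟨m.dual, Mark.isC_dual.2 hm, by simpa [dual] using h⟩

/-- The letters other than `x`, `za`, `zc` of the pattern. -/
def Plain (l : Letter) : Prop := (l ∈ S.Lf ∨ l ∈ S.M₀ ∨ l ∈ S.Rt) ∧ l ≠ S.za ∧ l ≠ S.zc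

open Classical in
/-- The substitution that reads `c` as `x`, `α` as `za`, `β` as `zc` and forgets all letters that
do not occur in the pattern. -/
noncomputable def psi (c α β l : Letter) : List Letter :=
  if l = c then [.x] else if l = α then [S.za] else if l = β then [S.zc]
  else if S.Plain l then [l] else []

/-- `u` belongs to `A` if `c`, `α`, `β` are read as `x`, `za`, `zc`. -/
def Sees (u : List Letter) (c α β : Letter) : Prop := u.flatMap (S.psi c α β) ∈ S.A

variable {S}

@[simp]
theorem e_inj {m n : Mark} : S.e m = S.e n ↔ m = n := S.inj_e.eq_iff

theorem not_isY_of_mem_Lf {l : Letter} (h : l ∈ S.Lf ∨ l ∈ S.Rt) : l.isY = false := by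
  rcases h with h | h
  · rcases S.mem_Lf l h with h | h <;> cases l <;> simp_all [Letter.isT, Letter.isZ, Letter.isY]
  · rcases S.mem_Rt l h with h | h <;> cases l <;> simp_all [Letter.isT, Letter.isZ, Letter.isY]

theorem e_notMem_Lf (m : Mark) : S.e m ∉ S.Lf := fun h => by
  have := not_isY_of_mem_Lf (Or.inl h)
  simp [S.isY_e] at this

theorem e_notMem_Rt (m : Mark) : S.e m ∉ S.Rt := fun h => by
  have := not_isY_of_mem_Lf (Or.inr h)
  simp [S.isY_e] at this

theorem e_ne_za (m : Mark) : S.e m ≠ S.za := Letter.ne_of_isY_of_isZ (S.isY_e m) S.isZ_za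
theorem e_ne_zc (m : Mark) : S.e m ≠ S.zc := Letter.ne_of_isY_of_isZ (S.isY_e m) S.isZ_zc

theorem za_ne_x : S.za ≠ .x := fun h => by
  have := S.isZ_za
  simp [h, Letter.isZ] at this

theorem zc_ne_x : S.zc ≠ .x := fun h => by
  have := S.isZ_zc
  simp [h, Letter.isZ] at this

theorem not_plain_e (m : Mark) : ¬ S.Plain (S.e m) := by
  rintro ⟨h | h | h, -⟩
  · exact e_notMem_Lf m h
  · exact S.notMem_e m h
  · exact e_notMem_Rt m h

theorem x_notMem_Lf : Letter.x ∉ S.Lf := fun h => by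
  rcases S.mem_Lf _ h with h | h <;> simp [Letter.isT, Letter.isZ] at h

theorem x_notMem_Rt : Letter.x ∉ S.Rt := fun h => by
  rcases S.mem_Rt _ h with h | h <;> simp [Letter.isT, Letter.isZ] at h

theorem x_notMem_M₀ : Letter.x ∉ S.M₀ := fun h => by
  rcases S.mem_M₀ _ h with h | h <;> simp [Letter.isY, Letter.isZ] at h

theorem not_plain_x : ¬ S.Plain .x := by
  rintro ⟨h | h | h, -⟩
  · exact x_notMem_Lf h
  · exact x_notMem_M₀ h
  · exact x_notMem_Rt h

theorem IsA.ne_e {α : Letter} (h : S.IsA α) {m : Mark} (hm : ¬ m.IsA) : α ≠ S.e m := by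
  rcases h with rfl | ⟨n, hn, rfl⟩
  · exact (e_ne_za m).symm
  · simp only [ne_eq, e_inj]; rintro rfl; exact hm hn

theorem IsC.ne_e {α : Letter} (h : S.IsC α) {m : Mark} (hm : ¬ m.IsC) : α ≠ S.e m := by
  rcases h with rfl | ⟨n, hn, rfl⟩
  · exact (e_ne_zc m).symm
  · simp only [ne_eq, e_inj]; rintro rfl; exact hm hn

theorem IsA.ne_isC {α β : Letter} (h : S.IsA α) (h' : S.IsC β) : α ≠ β := by
  rcases h with rfl | ⟨n, hn, rfl⟩
  · rcases h' with rfl | ⟨n', hn', rfl⟩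
    · exact S.za_ne_zc
    · exact (e_ne_za _).symm
  · refine (h'.ne_e ?_).symm
    cases n <;> simp_all [Mark.IsA, Mark.IsC]

theorem IsA.not_plain {α : Letter} (h : S.IsA α) : ¬ S.Plain α := by
  rcases h with rfl | ⟨n, hn, rfl⟩
  · exact fun h => h.2.1 rfl
  · exact not_plain_e _

theorem IsC.not_plain {α : Letter} (h : S.IsC α) : ¬ S.Plain α := by
  rcases h with rfl | ⟨n, hn, rfl⟩
  · exact fun h => h.2.2 rfl
  · exact not_plain_e _

theorem isA_za : S.IsA S.za := Or.inl rfl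
theorem isC_zc : S.IsC S.zc := Or.inl rfl
theorem isA_e {m : Mark} (h : m.IsA) : S.IsA (S.e m) := Or.inr ⟨m, h, rfl⟩
theorem isC_e {m : Mark} (h : m.IsC) : S.IsC (S.e m) := Or.inr ⟨m, h, rfl⟩

theorem plain_dual {l : Letter} : S.dual.Plain l ↔ S.Plain l := by
  simp only [Plain, dual, List.mem_reverse]
  tauto

theorem psi_dual {c α β : Letter} (h : α ≠ β) : S.dual.psi c α β = S.psi c β α := by
  funext l
  simp only [psi]
  by_cases h₁ : l = c
  · simp [h₁]
  · by_cases h₂ : l = α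
    · subst h₂; simp [h₁, h]
    · by_cases h₃ : l = β
      · subst h₃; simp [h₁, h.symm]
      · by_cases h₄ : S.Plain l
        · simp [h₁, h₂, h₃, h₄, plain_dual.2 h₄]
        · simp [h₁, h₂, h₃, h₄, mt plain_dual.1 h₄]

theorem psi_reverse (c α β l : Letter) : (S.psi c α β l).reverse = S.psi c α β l := by
  unfold psi; split_ifs <;> rfl

theorem flatMap_psi_reverse (u : List Letter) (c α β : Letter) :
    (u.flatMap (S.psi c α β)).reverse = u.reverse.flatMap (S.psi c α β) := by
  rw [List.reverse_flatMap]
  congr 1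
  funext l
  exact psi_reverse c α β l

theorem sees_dual {u : List Letter} {c α β : Letter} (h : α ≠ β) :
    S.dual.Sees u.reverse c α β ↔ S.Sees u c β α := by
  unfold Sees
  rw [psi_dual h, ← flatMap_psi_reverse]
  simp [dual]

/-- The letter `l` of a word corresponds to the letter `l'` of its image. -/
def Tracks (c α β l l' : Letter) : Prop :=
  ∀ d, (S.psi c α β d).count l' = if d = l then 1 else 0

theorem tracks_x {m : Mark} {α β : Letter} : Tracks (S := S) (S.e m) α β (S.e m) .x := by
  intro d
  unfold psi
  split_ifs with h₁ h₂ h₃ h₄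
  · simp
  · simp [za_ne_x]
  · simp [zc_ne_x]
  · have : d ≠ .x := by rintro rfl; exact not_plain_x h₄
    simp [this]
  · simp

theorem tracks_za {m : Mark} (hm : m.IsBound) {α β : Letter} (hα : S.IsA α) :
    Tracks (S := S) (S.e m) α β α S.za := by
  have hne := hα.ne_e hm.not_isA
  intro d
  unfold psi
  split_ifs with h₁ h₂ h₃ h₄ h₅
  · subst h₁; exact absurd h₂.symm hne
  · simp [za_ne_x.symm]
  · simp
  · simp [S.za_ne_zc.symm]
  · have : d ≠ S.za := fun h => h₅.2.1 h
    simp [this]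
  · simp

theorem tracks_zc {m : Mark} (hm : m.IsBound) {α β : Letter} (hα : S.IsA α) (hβ : S.IsC β) :
    Tracks (S := S) (S.e m) α β β S.zc := by
  have hne := hβ.ne_e hm.not_isC
  have hne' := hα.ne_isC hβ
  intro d
  unfold psi
  by_cases h₁ : d = S.e m
  · have : d ≠ β := by rintro rfl; exact hne h₁
    simp [h₁, zc_ne_x.symm, hne.symm]
  · by_cases h₂ : d = α
    · have : d ≠ β := by rintro rfl; exact hne' h₂.symm
      simp [h₂, hne', S.za_ne_zc, h₂ ▸ h₁]
    · by_cases h₃ : d = β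
      · simp [h₃, hne, hne'.symm]
      · by_cases h₄ : S.Plain d
        · have : d ≠ S.zc := fun h => h₄.2.2 h
          simp [h₁, h₂, h₃, h₄, this]
        · simp [h₁, h₂, h₃, h₄]

theorem tracks_plain {m : Mark} {α β t : Letter} (hα : S.IsA α) (hβ : S.IsC β)
    (ht : S.Plain t) : Tracks (S := S) (S.e m) α β t t := by
  have e₁ : t ≠ S.e m := by rintro rfl; exact not_plain_e _ ht
  have e₂ : t ≠ α := by rintro rfl; exact hα.not_plain ht
  have e₃ : t ≠ β := by rintro rfl; exact hβ.not_plain ht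
  have e₄ : t ≠ .x := by rintro rfl; exact not_plain_x ht
  have e₅ := ht.2.1
  have e₆ := ht.2.2
  intro d
  unfold psi
  by_cases h : d = t
  · subst h; simp [e₁, e₂, e₃, ht]
  · rw [if_neg h]
    split_ifs
    · simp [e₄.symm]
    · simp [e₅.symm]
    · simp [e₆.symm]
    · simp [h]
    · simp

theorem Tracks.count {c α β l l' : Letter} (h : Tracks (S := S) c α β l l') (u : List Letter) :
    (u.flatMap (S.psi c α β)).count l' = u.count l :=
  count_flatMap_of_count fun d _ => h d

/-- The order of the positions is preserved by the substitution. -/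
theorem Tracks.pos_lt {c α β l₁ l₁' l₂ l₂' : Letter} (h₁ : Tracks (S := S) c α β l₁ l₁')
    (h₂ : Tracks (S := S) c α β l₂ l₂') (hne : l₁ ≠ l₂) {u P Q : List Letter} {i j : ℕ}
    (hu : u.flatMap (S.psi c α β) = P ++ Q) (hi : 1 ≤ i) (hi' : i ≤ P.count l₁')
    (hj' : P.count l₂' < j) (hj'' : j ≤ (P ++ Q).count l₂') :
    pos u l₁ i < pos u l₂ j := by
  have hc : i ≤ (P ++ Q).count l₁' := by rw [List.count_append]; omega
  have := (pos_lt_iff_transfer (p := []) (q := []) (W := u) (i := i) (j := j) hne (fun d _ => h₁ d) (fun d _ => h₂ d)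
    (by simp) (by simp) hi (by rw [← h₁.count, hu]; exact hc)
    (by rw [← h₂.count, hu]; exact hj'')).2
  simp only [List.nil_append, List.append_nil, hu] at this
  exact this ((pos_lt_iff hc hj'').2 ⟨P, Q, rfl, hi', hj'⟩)

end Pattern

/-! ### Reading a word through one bound -/

namespace Pattern

variable {S : Pattern}

/-- The `i`-th occurrence of `l` lies between the first two occurrences of `c`. -/
def In (u : List Letter) (c l : Letter) (i : ℕ) : Prop :=
  pos u c 1 < pos u l i ∧ pos u l i < pos u c 2

theorem mem_md_iff {l : Letter} : l ∈ S.md ↔ l = S.za ∨ l ∈ S.M₀ ∨ l = S.zc := by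
  simp [md]

theorem count_Lf_add_count_Rt {z : Letter} (hz : z.isZ = true)
    (h : z ∈ S.Lf ∨ z ∈ S.Rt ∨ z ∈ S.md) : S.Lf.count z + S.Rt.count z = 1 :=
  (S.count_Z z hz h).1

theorem count_md {z : Letter} (hz : z.isZ = true) (h : z ∈ S.Lf ∨ z ∈ S.Rt ∨ z ∈ S.md) :
    S.md.count z = 1 :=
  (S.count_Z z hz h).2

theorem za_mem_md : S.za ∈ S.md := by simp [md]
theorem zc_mem_md : S.zc ∈ S.md := by simp [md]

theorem plain_of_isT {t : Letter} (h : t ∈ S.Lf ∨ t ∈ S.Rt) (ht : t.isT = true) : S.Plain t :=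
  ⟨by tauto, Letter.ne_of_isT_of_isZ ht S.isZ_za, Letter.ne_of_isT_of_isZ ht S.isZ_zc⟩

theorem count_eq_of_filter {M' : List Letter}
    (h : M'.filter (fun l => !l.isY) = S.md.filter (fun l => !l.isY)) {l : Letter}
    (hl : l.isY = false) : M'.count l = S.md.count l := by
  have h₁ : (M'.filter (fun l => !l.isY)).count l = M'.count l := List.count_filter (by simp [hl])
  have h₂ : (S.md.filter (fun l => !l.isY)).count l = S.md.count l :=
    List.count_filter (by simp [hl])
  rw [← h₁, h, h₂]

theorem Letter.isY_eq_false_of_isZ {l : Letter} (h : l.isZ = true) : l.isY = false := by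
  cases l <;> simp_all [Letter.isZ, Letter.isY]

theorem Letter.isY_eq_false_of_isT {l : Letter} (h : l.isT = true) : l.isY = false := by
  cases l <;> simp_all [Letter.isT, Letter.isY]

theorem count_T_md {t : Letter} (ht : t.isT = true) : S.md.count t = 0 := by
  rw [List.count_eq_zero, mem_md_iff]
  rintro (h | h | h)
  · exact Letter.ne_of_isT_of_isZ ht S.isZ_za h
  · rcases S.mem_M₀ t h with h' | h'
    · exact Letter.ne_of_isT_of_isZ ht h' rfl
    · exact Letter.ne_of_isT_of_isY ht h' rfl
  · exact Letter.ne_of_isT_of_isZ ht S.isZ_zc h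

theorem x_notMem_md : Letter.x ∉ S.md := by
  rw [mem_md_iff]
  rintro (h | h | h)
  · exact za_ne_x h.symm
  · exact x_notMem_M₀ h
  · exact zc_ne_x h.symm

theorem count_x_of_filter {M' : List Letter}
    (h : M'.filter (fun l => !l.isY) = S.md.filter (fun l => !l.isY)) : Letter.x ∉ M' := by
  rw [← List.count_eq_zero, count_eq_of_filter h (by rfl), List.count_eq_zero]
  exact x_notMem_md

section Seen

variable {u : List Letter} {m : Mark} {α β : Letter}

theorem Sees.form (h : S.Sees u (S.e m) α β) : ∃ M',
    u.flatMap (S.psi (S.e m) α β) = S.Lf ++ .x :: M' ++ .x :: S.Rt ∧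
      M'.filter (fun l => !l.isY) = S.md.filter (fun l => !l.isY) :=
  S.form_A _ h

theorem Sees.count_bound (h : S.Sees u (S.e m) α β) : u.count (S.e m) = 2 := by
  obtain ⟨M', h₁, h₂⟩ := h.form
  rw [← tracks_x.count, h₁]
  simp [List.count_eq_zero.2 (x_notMem_Lf (S := S)), List.count_eq_zero.2 (x_notMem_Rt (S := S)),
    List.count_eq_zero.2 (count_x_of_filter h₂)]

theorem Sees.split (h : S.Sees u (S.e m) α β) : ∃ u₁ u₂ u₃,
    u = u₁ ++ S.e m :: u₂ ++ S.e m :: u₃ ∧ S.e m ∉ u₁ ∧ S.e m ∉ u₂ ∧ S.e m ∉ u₃ ∧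
      u₁.flatMap (S.psi (S.e m) α β) = S.Lf ∧ u₃.flatMap (S.psi (S.e m) α β) = S.Rt ∧
      (u₂.flatMap (S.psi (S.e m) α β)).filter (fun l => !l.isY) =
        S.md.filter (fun l => !l.isY) := by
  obtain ⟨M', h₁, h₂⟩ := h.form
  obtain ⟨u₁, u₂, u₃, rfl, k₁, k₂, k₃⟩ := exists_split_of_count_two h.count_bound
  have hx : S.psi (S.e m) α β (S.e m) = [.x] := by simp [psi]
  have hn : ∀ v : List Letter, S.e m ∉ v → .x ∉ v.flatMap (S.psi (S.e m) α β) := by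
    intro v hv
    rw [← List.count_eq_zero, tracks_x.count, List.count_eq_zero]
    exact hv
  have h₁' : u₁.flatMap (S.psi (S.e m) α β) ++ .x :: u₂.flatMap (S.psi (S.e m) α β) ++
      .x :: u₃.flatMap (S.psi (S.e m) α β) = S.Lf ++ .x :: M' ++ .x :: S.Rt := by
    rw [← h₁]; simp [List.flatMap_append, hx]
  obtain ⟨e₁, e₂, e₃⟩ := split_unique h₁' (hn _ k₁) (hn _ k₂) x_notMem_Lf (count_x_of_filter h₂)
  exact ⟨u₁, u₂, u₃, rfl, k₁, k₂, k₃, e₁, e₃, by rw [e₂, h₂]⟩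

variable {l z t : Letter}

theorem Sees.count_of_tracks (h : S.Sees u (S.e m) α β) (hl : Tracks (S := S) (S.e m) α β l z)
    (hz : z.isZ = true) (hz' : z ∈ S.md) : u.count l = 2 := by
  obtain ⟨M', h₁, h₂⟩ := h.form
  have e₁ := count_Lf_add_count_Rt hz (Or.inr (Or.inr hz'))
  have e₂ := count_md hz (Or.inr (Or.inr hz'))
  have e₃ := count_eq_of_filter h₂ (Letter.isY_eq_false_of_isZ hz)
  have e₄ : Letter.x ≠ z := by rintro rfl; simp [Letter.isZ] at hz
  rw [← hl.count, h₁]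
  simp only [List.count_append, List.count_cons, beq_iff_eq, e₄, if_false]
  omega

theorem Sees.count_T (h : S.Sees u (S.e m) α β) (hα : S.IsA α) (hβ : S.IsC β)
    (ht : t.isT = true) (ht' : t ∈ S.Lf ∨ t ∈ S.Rt) : u.count t = 1 := by
  obtain ⟨M', h₁, h₂⟩ := h.form
  have e₁ := S.count_T t ht
  have e₂ := count_T_md (S := S) ht
  have e₃ := count_eq_of_filter h₂ (Letter.isY_eq_false_of_isT ht)
  have e₄ : Letter.x ≠ t := by rintro rfl; simp [Letter.isT] at ht
  have e₅ : 1 ≤ S.Lf.count t + S.Rt.count t := by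
    rcases ht' with h | h
    · have := List.one_le_count_iff.2 h; omega
    · have := List.one_le_count_iff.2 h; omega
  rw [← (tracks_plain hα hβ (plain_of_isT ht' ht)).count, h₁]
  simp only [List.count_append, List.count_cons, beq_iff_eq, e₄, if_false]
  omega

/-- Of the two occurrences of `z` one is outer. The middle one is preceded only by those in `Lf`,
hence its number `S.Lf.count z + 1`. -/
theorem Sees.in_of_tracks (h : S.Sees u (S.e m) α β) (hl : Tracks (S := S) (S.e m) α β l z)
    (hlm : l ≠ S.e m) (hz : z.isZ = true) (hz' : z ∈ S.md) :
    In u (S.e m) l (S.Lf.count z + 1) := by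
  obtain ⟨M', h₁, h₂⟩ := h.form
  have e₁ := count_Lf_add_count_Rt hz (Or.inr (Or.inr hz'))
  have e₂ := count_md hz (Or.inr (Or.inr hz'))
  have e₃ := count_eq_of_filter h₂ (Letter.isY_eq_false_of_isZ hz)
  have e₄ : Letter.x ≠ z := by rintro rfl; simp [Letter.isZ] at hz
  have e₅ := List.count_eq_zero.2 (x_notMem_Lf (S := S))
  have e₆ := List.count_eq_zero.2 (count_x_of_filter h₂)
  constructor
  · refine tracks_x.pos_lt hl hlm.symm (P := S.Lf ++ [.x]) (Q := M' ++ .x :: S.Rt)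
      (by rw [h₁]; simp) le_rfl ?_ ?_ ?_
    · simp
    · simp [e₄]
    · simp only [List.count_append, List.count_cons, beq_iff_eq, e₄, if_false]
      omega
  · refine hl.pos_lt tracks_x hlm (P := S.Lf ++ .x :: M') (Q := .x :: S.Rt)
      h₁ (by omega) ?_ ?_ ?_
    · simp only [List.count_append, List.count_cons, beq_iff_eq, e₄, if_false]
      omega
    · simp [e₅, e₆]
    · simp [e₅, e₆]

/-- Apart from letters `y`, the middle factor of every word of `A` begins with `za`. -/
theorem Sees.pos_A_lt_pos_C (h : S.Sees u (S.e m) α β) (hm : m.IsBound) (hα : S.IsA α)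
    (hβ : S.IsC β) : pos u α (S.Lf.count S.za + 1) < pos u β (S.Lf.count S.zc + 1) := by
  obtain ⟨M', h₁, h₂⟩ := h.form
  have hY : (!S.za.isY) = true := by simp [Letter.isY_eq_false_of_isZ S.isZ_za]
  rw [md, List.filter_cons_of_pos (by simpa using hY), List.filter_eq_cons_iff] at h₂
  obtain ⟨M₁, M₂, rfl, h₃, -, h₄⟩ := h₂
  have hc : M₁.count S.zc = 0 := by
    rw [List.count_eq_zero]
    intro hc
    have := h₃ _ hc
    simp [Letter.isY_eq_false_of_isZ S.isZ_zc] at this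
  have hc' : 1 ≤ M₂.count S.zc := by
    rw [List.one_le_count_iff]
    have : S.zc ∈ M₂.filter (fun l => !l.isY) := by
      rw [h₄]; simp [Letter.isY_eq_false_of_isZ S.isZ_zc]
    exact (List.mem_filter.1 this).1
  refine (tracks_za hm hα).pos_lt (tracks_zc hm hα hβ) (hα.ne_isC hβ)
    (P := S.Lf ++ .x :: M₁ ++ [S.za]) (Q := M₂ ++ .x :: S.Rt) (by rw [h₁]; simp) (by omega) ?_ ?_ ?_
  · simp only [List.count_append, List.count_cons, List.count_nil, beq_self_eq_true, if_true]
    omega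
  · simp only [List.count_append, List.count_cons, List.count_nil, beq_iff_eq, zc_ne_x.symm,
      S.za_ne_zc, if_false, hc]
    omega
  · simp only [List.count_append, List.count_cons, List.count_nil, beq_iff_eq, zc_ne_x.symm,
      S.za_ne_zc, if_false, hc]
    omega

theorem Sees.pos_T_left (h : S.Sees u (S.e m) α β) (hα : S.IsA α) (hβ : S.IsC β)
    (ht : t.isT = true) (ht' : t ∈ S.Lf) : pos u t 1 < pos u (S.e m) 1 := by
  obtain ⟨M', h₁, h₂⟩ := h.form
  refine (tracks_plain hα hβ (plain_of_isT (Or.inl ht') ht)).pos_lt tracks_x ?_ (P := S.Lf)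
    (Q := .x :: M' ++ .x :: S.Rt) (by rw [h₁]; simp) le_rfl (List.one_le_count_iff.2 ht') ?_ ?_
  · rintro rfl; exact e_notMem_Lf _ ht'
  · rw [List.count_eq_zero.2 x_notMem_Lf]; omega
  · simp only [List.count_append, List.count_cons_self]; omega

theorem Sees.pos_T_right (h : S.Sees u (S.e m) α β) (hα : S.IsA α) (hβ : S.IsC β)
    (ht : t.isT = true) (ht' : t ∈ S.Rt) : pos u (S.e m) 2 < pos u t 1 := by
  obtain ⟨M', h₁, h₂⟩ := h.form
  have e₁ := S.count_T t ht
  have e₂ := count_T_md (S := S) ht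
  have e₃ := count_eq_of_filter h₂ (Letter.isY_eq_false_of_isT ht)
  have e₄ : Letter.x ≠ t := by rintro rfl; simp [Letter.isT] at ht
  have e₅ := List.one_le_count_iff.2 ht'
  refine tracks_x.pos_lt (tracks_plain hα hβ (plain_of_isT (Or.inr ht') ht)) ?_
    (P := S.Lf ++ .x :: M' ++ [.x]) (Q := S.Rt) (by rw [h₁]; simp) (by omega) ?_ ?_ ?_
  · rintro rfl; exact e_notMem_Rt _ ht'
  · simp only [List.count_append, List.count_cons_self]; omega
  · simp only [List.count_append, List.count_cons, List.count_nil, beq_iff_eq, e₄, if_false]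
    omega
  · simp only [List.count_append]; omega

/-- The witness is the last letter of `Lf`. Being a `t`, it precedes every bound that sees the base
word, so it keeps the outer occurrence of `l` out of all those intervals at once. -/
theorem Sees.outer_left (h : S.Sees u (S.e m) α β) (hα : S.IsA α) (hβ : S.IsC β)
    (hl : Tracks (S := S) (S.e m) α β l z) (hz : z.isZ = true) (hz' : z ∈ S.Lf)
    (hlT : l.isT = false) :
    ∃ t ∈ S.Lf, t.isT = true ∧ pos u l 1 < pos u t 1 := by
  obtain ⟨M', h₁, h₂⟩ := h.form
  have hne : S.Lf ≠ [] := List.ne_nil_of_mem hz'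
  have hlast := S.last_Lf _ (List.getLast?_eq_some_getLast hne)
  have hmem : S.Lf.getLast hne ∈ S.Lf := List.getLast_mem hne
  have hdec := List.dropLast_append_getLast hne
  generalize S.Lf.getLast hne = t at *
  have hzt : t ≠ z := Letter.ne_of_isT_of_isZ hlast hz
  refine ⟨t, hmem, hlast, ?_⟩
  have c₁ : S.Lf.count t ≤ 1 := by have := S.count_T t hlast; omega
  have c₂ := List.one_le_count_iff.2 hz'
  rw [← hdec] at c₁ c₂
  simp only [List.count_append, List.count_cons, List.count_nil, beq_iff_eq, hzt, if_false,
    if_true] at c₁ c₂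
  refine hl.pos_lt (tracks_plain hα hβ (plain_of_isT (Or.inl hmem) hlast)) ?_
    (P := S.Lf.dropLast) (Q := t :: .x :: M' ++ .x :: S.Rt) ?_ le_rfl (by omega) (by omega) ?_
  · rintro rfl; simp [hlT] at hlast
  · rw [h₁]; nth_rw 1 [← hdec]; simp
  · simp only [List.count_append, List.cons_append, List.count_cons_self]; omega

theorem Sees.outer_right (h : S.Sees u (S.e m) α β) (hα : S.IsA α) (hβ : S.IsC β)
    (hl : Tracks (S := S) (S.e m) α β l z) (hz : z.isZ = true) (hz' : z ∈ S.Rt)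
    (hlT : l.isT = false) :
    ∃ t ∈ S.Rt, t.isT = true ∧ pos u t 1 < pos u l 2 := by
  obtain ⟨M', h₁, h₂⟩ := h.form
  obtain ⟨t, R', hR⟩ := List.exists_cons_of_ne_nil (List.ne_nil_of_mem hz')
  have hhead := S.head_Rt t (by rw [hR]; rfl)
  have hmem : t ∈ S.Rt := by rw [hR]; simp
  have hzt : t ≠ z := Letter.ne_of_isT_of_isZ hhead hz
  have e₁ := count_Lf_add_count_Rt hz (Or.inr (Or.inl hz'))
  have e₂ := count_md hz (Or.inr (Or.inl hz'))
  have e₃ := count_eq_of_filter h₂ (Letter.isY_eq_false_of_isZ hz)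
  have e₄ : Letter.x ≠ z := by rintro rfl; simp [Letter.isZ] at hz
  have c₂ := List.one_le_count_iff.2 hz'
  refine ⟨t, hmem, hhead, ?_⟩
  refine (tracks_plain hα hβ (plain_of_isT (Or.inr hmem) hhead)).pos_lt hl ?_
    (P := S.Lf ++ .x :: M' ++ [.x, t]) (Q := R') (by rw [h₁, hR]; simp) le_rfl ?_ ?_ ?_
  · rintro rfl; simp [hlT] at hhead
  · rw [List.one_le_count_iff]; simp
  · simp only [List.count_append, List.count_cons, List.count_nil, beq_iff_eq, e₄, if_false, hzt]
    omega
  · rw [hR, List.count_cons, if_neg (by simpa using hzt)] at c₂ e₁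
    simp only [List.count_append, List.count_cons, List.count_nil, beq_iff_eq, e₄, if_false, hzt]
    omega

/-- The hypothesis `hin` puts the middle occurrence of `l` between the two `S.e n`. A `t` that lies
outside the intervals of both bounds keeps the outer occurrence on its side. -/
theorem Sees.count_of_in {n : Mark} (h : S.Sees u (S.e m) α β) (hα : S.IsA α) (hβ : S.IsC β)
    (hl : Tracks (S := S) (S.e m) α β l z) (hz : z.isZ = true) (hz' : z ∈ S.md)
    (hlT : l.isT = false) (hb : S.Sees u (S.e n) S.za S.zc) (hln : l ≠ S.e n)
    (hin : In u (S.e n) l (S.Lf.count z + 1)) {u₁ u₂ u₃ : List Letter}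
    (hu : u = u₁ ++ S.e n :: u₂ ++ S.e n :: u₃) (k₁ : S.e n ∉ u₁) (k₂ : S.e n ∉ u₂) :
    u₁.count l = S.Lf.count z ∧ u₂.count l = 1 ∧ u₃.count l = S.Rt.count z := by
  have hc := h.count_of_tracks hl hz hz'
  have e₁ := count_Lf_add_count_Rt hz (Or.inr (Or.inr hz'))
  have p₁ : pos u (S.e n) 1 = u₁.length + 1 := by
    have := pos_append_cons u₁ (u₂ ++ S.e n :: u₃) (S.e n)
    rw [List.count_eq_zero.2 k₁] at this
    simpa [hu] using this
  have p₂ : pos u (S.e n) 2 = (u₁ ++ S.e n :: u₂).length + 1 := by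
    have := pos_append_cons (u₁ ++ S.e n :: u₂) u₃ (S.e n)
    rw [List.count_append, List.count_cons_self, List.count_eq_zero.2 k₁,
      List.count_eq_zero.2 k₂] at this
    simpa [hu] using this
  have hle₁ : ∀ i ≤ 2, pos u l i ≤ u₁.length ↔ i ≤ u₁.count l := by
    intro i hi
    have hu' : u = u₁ ++ (S.e n :: u₂ ++ S.e n :: u₃) := by rw [hu]; simp
    rw [hu'] at hc ⊢
    exact pos_append_le_iff (by omega)
  have hle₁' : ∀ i ≤ 2, pos u l i ≤ u₁.length + 1 ↔ i ≤ u₁.count l := by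
    intro i hi
    have hu' : u = (u₁ ++ [S.e n]) ++ (u₂ ++ S.e n :: u₃) := by rw [hu]; simp
    rw [hu'] at hc ⊢
    have := pos_append_le_iff (P := u₁ ++ [S.e n]) (Q := u₂ ++ S.e n :: u₃) (a := l) (i := i)
      (by omega)
    simpa [List.count_cons, hln.symm] using this
  have hle₂ : ∀ i ≤ 2, pos u l i ≤ (u₁ ++ S.e n :: u₂).length ↔
      i ≤ u₁.count l + u₂.count l := by
    intro i hi
    rw [hu] at hc ⊢
    have := pos_append_le_iff (P := u₁ ++ S.e n :: u₂) (Q := S.e n :: u₃) (a := l) (i := i)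
      (by omega)
    rw [this, List.count_append, List.count_cons, if_neg (by simpa using hln.symm), Nat.add_zero]
  have hle₂' : ∀ i ≤ 2, pos u l i ≤ (u₁ ++ S.e n :: u₂).length + 1 ↔
      i ≤ u₁.count l + u₂.count l := by
    intro i hi
    have hu' : u = (u₁ ++ S.e n :: u₂ ++ [S.e n]) ++ u₃ := by rw [hu]; simp
    rw [hu'] at hc ⊢
    have := pos_append_le_iff (P := u₁ ++ S.e n :: u₂ ++ [S.e n]) (Q := u₃) (a := l) (i := i)
      (by omega)
    rw [List.length_append, List.length_singleton] at this
    rw [this, List.count_append, List.count_append, List.count_cons, List.count_singleton]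
    simp [hln.symm]
  have htot : u₁.count l + u₂.count l + u₃.count l = 2 := by
    rw [hu] at hc
    simpa [List.count_cons, hln.symm, add_assoc] using hc
  obtain ⟨i₁, i₂⟩ := hin
  rw [p₁] at i₁
  rw [p₂] at i₂
  have a₁ := hle₁' (S.Lf.count z + 1) (by omega)
  have a₂ := hle₂ (S.Lf.count z + 1) (by omega)
  rcases Nat.eq_zero_or_pos (S.Lf.count z) with h0 | h0
  · obtain ⟨t, ht, htT, hlt⟩ :=
      h.outer_right hα hβ hl hz (List.one_le_count_iff.1 (by omega : 1 ≤ S.Rt.count z)) hlT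
    have := hb.pos_T_right isA_za isC_zc htT ht
    have a₃ := hle₂' 2 le_rfl
    omega
  · obtain ⟨t, ht, htT, hlt⟩ := h.outer_left hα hβ hl hz (List.one_le_count_iff.1 h0) hlT
    have := hb.pos_T_left isA_za isC_zc htT ht
    have a₃ := hle₁ 1 (by omega)
    omega

/-- Together with `Sees.count_of_in`, this gives the outer pieces of two readings the same length.
-/
theorem length_flatMap_psi {n : Mark} (hn : n.IsBound) (hα : S.IsA α) (hβ : S.IsC β)
    (v : List Letter) :
    (v.flatMap (S.psi (S.e n) α β)).length + v.count S.za + v.count S.zc =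
      (v.flatMap (S.psi (S.e n) S.za S.zc)).length + v.count α + v.count β := by
  induction v with
  | nil => simp
  | cons d v ih =>
    have key : (S.psi (S.e n) α β d).length + (if d = S.za then 1 else 0) +
        (if d = S.zc then 1 else 0) = (S.psi (S.e n) S.za S.zc d).length +
        (if d = α then 1 else 0) + (if d = β then 1 else 0) := by
      have a₁ := hα.ne_e hn.not_isA
      have a₂ := hβ.ne_e hn.not_isC
      have a₃ := hα.ne_isC hβ
      have a₄ := e_ne_za (S := S) n
      have a₅ := e_ne_zc (S := S) n
      have a₆ := S.za_ne_zc
      unfold psi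
      by_cases h₁ : d = S.e n
      · subst h₁; simp [a₁.symm, a₂.symm, a₄, a₅]
      · by_cases h₂ : S.Plain d
        · have b₁ : d ≠ α := by rintro rfl; exact hα.not_plain h₂
          have b₂ : d ≠ β := by rintro rfl; exact hβ.not_plain h₂
          simp [h₁, h₂, b₁, b₂, h₂.2.1, h₂.2.2]
        · simp only [h₁, h₂, if_false]
          by_cases b₁ : d = α
          · subst b₁; simp only [a₃, if_true, if_false]; split_ifs <;> simp_all
          · by_cases b₂ : d = β
            · subst b₂; simp only [b₁, if_true, if_false]; split_ifs <;> simp_all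
            · simp only [b₁, b₂, if_false]; split_ifs <;> simp_all
    simp only [List.flatMap_cons, List.length_append, List.count_cons, beq_iff_eq]
    omega

/-- Changing the bound only moves the letters `x`. -/
theorem filter_flatMap_psi {n n' : Mark} (hn : n.IsBound) (hn' : n'.IsBound) (hα : S.IsA α)
    (hβ : S.IsC β) (v : List Letter) :
    (v.flatMap (S.psi (S.e n) α β)).filter (· ≠ .x) =
      (v.flatMap (S.psi (S.e n') α β)).filter (· ≠ .x) := by
  induction v with
  | nil => simp
  | cons d v ih =>
    have key : (S.psi (S.e n) α β d).filter (· ≠ .x) = (S.psi (S.e n') α β d).filter (· ≠ .x) := by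
      have a₁ : ∀ {n : Mark}, n.IsBound → S.e n ≠ α := fun hn => (hα.ne_e hn.not_isA).symm
      have a₂ : ∀ {n : Mark}, n.IsBound → S.e n ≠ β := fun hn => (hβ.ne_e hn.not_isC).symm
      unfold psi
      by_cases h₁ : d = S.e n
      · subst h₁
        by_cases h₂ : S.e n = S.e n'
        · simp [h₂]
        · simp [a₁ hn, a₂ hn, not_plain_e, if_neg h₂]
      · by_cases h₂ : d = S.e n'
        · subst h₂
          simp [a₁ hn', a₂ hn', not_plain_e, if_neg h₁]
        · simp [h₁, h₂]
    rw [List.flatMap_cons, List.flatMap_cons, List.filter_append, List.filter_append, key, ih]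

/-- The readings through `m` and through `n` agree after deletion of `x`. The pieces cut off by `n`
have the lengths of `Lf` and `Rt`, so the letters `x` also stand in the same places and the two
readings are equal. -/
theorem sees_of_in {n : Mark} (hm : m.IsBound) (hn : n.IsBound) (hα : S.IsA α) (hβ : S.IsC β)
    (h : S.Sees u (S.e m) α β) (hb : S.Sees u (S.e n) S.za S.zc)
    (h₁ : In u (S.e n) α (S.Lf.count S.za + 1)) (h₂ : In u (S.e n) β (S.Lf.count S.zc + 1)) :
    S.Sees u (S.e n) α β := by
  obtain ⟨u₁, u₂, u₃, hu, k₁, k₂, k₃, f₁, f₃, f₂⟩ := hb.split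
  have hαT : α.isT = false := by
    rcases hα with rfl | ⟨n, -, rfl⟩
    · have := S.isZ_za; cases h : S.za <;> simp_all [Letter.isT, Letter.isZ]
    · have := S.isY_e n; cases h : S.e n <;> simp_all [Letter.isT, Letter.isY]
  have hβT : β.isT = false := by
    rcases hβ with rfl | ⟨n, -, rfl⟩
    · have := S.isZ_zc; cases h : S.zc <;> simp_all [Letter.isT, Letter.isZ]
    · have := S.isY_e n; cases h : S.e n <;> simp_all [Letter.isT, Letter.isY]
  have cα := h.count_of_in hα hβ (tracks_za hm hα) S.isZ_za za_mem_md hαT hb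
    (hα.ne_e hn.not_isA) h₁ hu k₁ k₂
  have cβ := h.count_of_in hα hβ (tracks_zc hm hα hβ) S.isZ_zc zc_mem_md hβT hb
    (hβ.ne_e hn.not_isC) h₂ hu k₁ k₂
  have za₁ : u₁.count S.za = S.Lf.count S.za := by
    rw [← (tracks_za hn isA_za).count u₁ (β := S.zc), f₁]
  have zc₁ : u₁.count S.zc = S.Lf.count S.zc := by
    rw [← (tracks_zc hn isA_za isC_zc).count u₁, f₁]
  have za₃ : u₃.count S.za = S.Rt.count S.za := by
    rw [← (tracks_za hn isA_za).count u₃ (β := S.zc), f₃]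
  have zc₃ : u₃.count S.zc = S.Rt.count S.zc := by
    rw [← (tracks_zc hn isA_za isC_zc).count u₃, f₃]
  have l₁ := length_flatMap_psi hn hα hβ u₁
  have l₃ := length_flatMap_psi hn hα hβ u₃
  rw [f₁] at l₁
  rw [f₃] at l₃
  obtain ⟨M', g₁, g₂⟩ := h.form
  have hx : S.psi (S.e n) α β (S.e n) = [.x] := by simp [psi]
  have hnx : ∀ v : List Letter, S.e n ∉ v →
      (v.flatMap (S.psi (S.e n) α β)).filter (· ≠ .x) = v.flatMap (S.psi (S.e n) α β) := by
    intro v hv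
    rw [List.filter_eq_self]
    intro l hl
    have : Letter.x ∉ v.flatMap (S.psi (S.e n) α β) := by
      rw [← List.count_eq_zero, tracks_x.count, List.count_eq_zero]
      exact hv
    simp only [ne_eq, decide_not, Bool.not_eq_eq_eq_not, Bool.not_true, decide_eq_false_iff_not]
    rintro rfl
    exact this hl
  have hno : ∀ v : List Letter, .x ∉ v → v.filter (· ≠ .x) = v := by
    intro v hv
    rw [List.filter_eq_self]
    intro l hl
    simp only [ne_eq, decide_not, Bool.not_eq_eq_eq_not, Bool.not_true, decide_eq_false_iff_not]
    rintro rfl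
    exact hv hl
  have hfil := filter_flatMap_psi hn hm hα hβ u
  rw [g₁] at hfil
  nth_rw 1 [hu] at hfil
  simp only [List.flatMap_append, List.flatMap_cons, List.filter_append, hx, List.filter_cons,
    hnx _ k₁, hnx _ k₂, hnx _ k₃, hno _ x_notMem_Lf, hno _ x_notMem_Rt,
    hno _ (count_x_of_filter g₂)] at hfil
  simp only [List.filter_nil, ne_eq, not_true_eq_false, decide_false, Bool.false_eq_true, if_false,
    List.nil_append, List.append_assoc] at hfil
  obtain ⟨r₁, hfil⟩ := List.append_inj hfil (by omega)
  obtain ⟨r₂, r₃⟩ := List.append_inj' hfil (by omega)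
  unfold Sees
  have : u.flatMap (S.psi (S.e n) α β) = S.Lf ++ .x :: M' ++ .x :: S.Rt := by
    rw [hu]
    simp [List.flatMap_append, List.flatMap_cons, hx, r₁, r₂, r₃]
  rw [this, ← g₁]
  exact h

end Seen

end Pattern

namespace Pattern

variable {S : Pattern}

/-! ### The words -/

/-- The substitution that inserts the auxiliary letters into the outer factors. -/
noncomputable def sig (S : Pattern) (l : Letter) : List Letter :=
  if l = S.za then S.LA else if l = S.zc then S.LC else [l]

/-- The word `F` with `i` copies of the first `c₁` and `j` copies of the second `c₂`. -/
noncomputable def word (S : Pattern) (i j : ℕ) : List Letter :=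
  S.Lf.flatMap S.sig ++ [S.e .g, S.e .A₁, S.e .h, S.e .A₂, S.e .k] ++
    List.replicate i (S.e .c₁) ++ [S.e .A₃, S.e .g', S.e .c₂] ++ S.md ++
    [S.e .c₁, S.e .g, S.e .C₁] ++ List.replicate j (S.e .c₂) ++
    [S.e .k, S.e .C₂, S.e .h, S.e .C₃, S.e .g'] ++ S.Rt.flatMap S.sig

theorem md_dual : S.dual.md = S.md.reverse := by simp [md]

theorem sig_dual : S.dual.sig = List.reverse ∘ S.sig := by
  funext l
  simp only [sig, dual_za, dual_zc, dual_LA, dual_LC, Function.comp]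
  by_cases h₁ : l = S.za
  · simp [h₁, S.za_ne_zc]
  · by_cases h₂ : l = S.zc
    · simp [h₂, S.za_ne_zc.symm]
    · simp [h₁, h₂]

theorem word_dual (i j : ℕ) : S.dual.word i j = (S.word j i).reverse := by
  simp only [word, dual_Lf, dual_Rt, md_dual, sig_dual, dual_e, Mark.dual, List.reverse_append,
    List.reverse_flatMap, List.reverse_replicate]
  simp [List.append_assoc]

theorem mem_LA {l : Letter} : l ∈ S.LA ↔ l = S.za ∨ ∃ m : Mark, m.IsA ∧ l = S.e m := by
  rw [S.perm_LA.mem_iff]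
  constructor
  · simp only [List.mem_cons, List.not_mem_nil, or_false]
    rintro (h | h | h | h)
    · exact Or.inl h
    · exact Or.inr ⟨.A₁, trivial, h⟩
    · exact Or.inr ⟨.A₂, trivial, h⟩
    · exact Or.inr ⟨.A₃, trivial, h⟩
  · rintro (h | ⟨m, hm, h⟩)
    · simp [h]
    · cases m <;> simp_all [Mark.IsA]

theorem mem_LC {l : Letter} : l ∈ S.LC ↔ l = S.zc ∨ ∃ m : Mark, m.IsC ∧ l = S.e m := by
  rw [S.perm_LC.mem_iff]
  constructor
  · simp only [List.mem_cons, List.not_mem_nil, or_false]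
    rintro (h | h | h | h)
    · exact Or.inl h
    · exact Or.inr ⟨.C₁, trivial, h⟩
    · exact Or.inr ⟨.C₂, trivial, h⟩
    · exact Or.inr ⟨.C₃, trivial, h⟩
  · rintro (h | ⟨m, hm, h⟩)
    · simp [h]
    · cases m <;> simp_all [Mark.IsC]

theorem count_LA_e (m : Mark) [Decidable m.IsA] :
    S.LA.count (S.e m) = if m.IsA then 1 else 0 := by
  rw [S.perm_LA.count_eq]
  cases m <;> simp_all [Mark.IsA, (e_ne_za _).symm]

theorem count_LC_e (m : Mark) [Decidable m.IsC] :
    S.LC.count (S.e m) = if m.IsC then 1 else 0 := by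
  rw [S.perm_LC.count_eq]
  cases m <;> simp_all [Mark.IsC, (e_ne_zc _).symm]

open Classical in
theorem count_flatMap_sig_e (v : List Letter) (hv : ∀ m, S.e m ∉ v) (m : Mark) :
    (v.flatMap S.sig).count (S.e m) =
      (if m.IsA then v.count S.za else 0) + (if m.IsC then v.count S.zc else 0) := by
  induction v with
  | nil => simp
  | cons l v ih =>
    have hl : l ≠ S.e m := fun h => hv m (by simp [h])
    rw [List.flatMap_cons, List.count_append, ih fun m h => hv m (by simp [h]),
      List.count_cons, List.count_cons]
    have key : (S.sig l).count (S.e m) =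
        (if m.IsA then (if l = S.za then 1 else 0) else 0) +
          (if m.IsC then (if l = S.zc then 1 else 0) else 0) := by
      unfold sig
      by_cases h₁ : l = S.za
      · simp [h₁, count_LA_e, S.za_ne_zc]
      · by_cases h₂ : l = S.zc
        · simp [h₂, count_LC_e, S.za_ne_zc.symm]
        · simp [h₁, h₂, hl]
    rw [key]
    simp only [beq_iff_eq]
    split_ifs <;> omega

theorem count_sig_of_not_isY {l d : Letter} (hd : d.isY = false) :
    (S.sig l).count d = if l = d then 1 else 0 := by
  have he : ∀ m, S.e m ≠ d := fun m h => by
    have := S.isY_e m; rw [h, hd] at this; simp at this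
  unfold sig
  by_cases h₁ : l = S.za
  · rw [if_pos h₁, S.perm_LA.count_eq, h₁]
    simp [List.count_cons, he]
  · by_cases h₂ : l = S.zc
    · rw [if_neg h₁, if_pos h₂, S.perm_LC.count_eq, h₂]
      simp [List.count_cons, he]
    · rw [if_neg h₁, if_neg h₂]
      simp [List.count_singleton]

theorem count_flatMap_sig {v : List Letter} {d : Letter} (hd : d.isY = false) :
    (v.flatMap S.sig).count d = v.count d :=
  count_flatMap_of_count fun _ _ => count_sig_of_not_isY hd

section Psi

variable {m : Mark} {α β : Letter}

theorem psi_of_plain {l : Letter} (hα : S.IsA α) (hβ : S.IsC β) (hl : S.Plain l) :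
    S.psi (S.e m) α β l = [l] := by
  have e₁ : l ≠ S.e m := by rintro rfl; exact not_plain_e _ hl
  have e₂ : l ≠ α := by rintro rfl; exact hα.not_plain hl
  have e₃ : l ≠ β := by rintro rfl; exact hβ.not_plain hl
  simp [psi, e₁, e₂, e₃, hl]

theorem psi_of_bound {n : Mark} (hn : n.IsBound) (hα : S.IsA α) (hβ : S.IsC β)
    [Decidable (n = m)] : S.psi (S.e m) α β (S.e n) = if n = m then [.x] else [] := by
  have e₂ := (hα.ne_e hn.not_isA).symm
  have e₃ := (hβ.ne_e hn.not_isC).symm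
  by_cases h : n = m
  · simp [h, psi]
  · simp [h, psi, e₂, e₃, not_plain_e]

theorem psi_of_isA (hm : m.IsBound) {n : Mark} (hn : n.IsA) (hβ : S.IsC β)
    [Decidable (S.e n = α)] : S.psi (S.e m) α β (S.e n) = if S.e n = α then [S.za] else [] := by
  have e₁ : n ≠ m := by rintro rfl; exact hm.not_isA hn
  have e₃ := ((isA_e hn).ne_isC hβ)
  by_cases h : S.e n = α
  · subst h; simp [psi, e₁]
  · rw [if_neg h]; simp [h, psi, e₁, e₃, not_plain_e]

theorem psi_of_isC (hm : m.IsBound) {n : Mark} (hn : n.IsC) (hα : S.IsA α)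
    [Decidable (S.e n = β)] : S.psi (S.e m) α β (S.e n) = if S.e n = β then [S.zc] else [] := by
  have e₁ : n ≠ m := by rintro rfl; exact hm.not_isC hn
  have e₃ := (hα.ne_isC (isC_e hn)).symm
  by_cases h : S.e n = β
  · subst h; simp [psi, e₁, e₃]
  · rw [if_neg h]; simp [h, psi, e₁, e₃, not_plain_e]

theorem psi_za (hβ : S.IsC β) [Decidable (α = S.za)] :
    S.psi (S.e m) α β S.za = if α = S.za then [S.za] else [] := by
  have e₁ := (e_ne_za (S := S) m).symm
  have e₃ := isA_za.ne_isC hβ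
  by_cases h : α = S.za
  · subst h; simp [psi, e₁]
  · rw [if_neg h]; simp [Ne.symm h, psi, e₁, e₃, isA_za.not_plain]

theorem psi_zc (hα : S.IsA α) [Decidable (β = S.zc)] :
    S.psi (S.e m) α β S.zc = if β = S.zc then [S.zc] else [] := by
  have e₁ := (e_ne_zc (S := S) m).symm
  have e₃ := (hα.ne_isC isC_zc).symm
  by_cases h : β = S.zc
  · subst h; simp [psi, e₁, e₃]
  · rw [if_neg h]; simp [Ne.symm h, psi, e₁, e₃, isC_zc.not_plain]

theorem flatMap_psi_LA (hm : m.IsBound) (hα : S.IsA α) (hβ : S.IsC β) :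
    S.LA.flatMap (S.psi (S.e m) α β) = [S.za] := by
  classical
  have hp : (S.LA.flatMap (S.psi (S.e m) α β)).Perm
      ([S.za, S.e .A₁, S.e .A₂, S.e .A₃].flatMap (S.psi (S.e m) α β)) :=
    S.perm_LA.flatMap_right _
  rw [← List.perm_singleton]
  refine hp.trans ?_
  simp only [List.flatMap_cons, List.flatMap_nil, psi_za hβ,
    psi_of_isA hm (n := .A₁) trivial hβ, psi_of_isA hm (n := .A₂) trivial hβ,
    psi_of_isA hm (n := .A₃) trivial hβ]
  rcases hα with rfl | ⟨n, hn, rfl⟩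
  · simp [e_ne_za]
  · cases n <;> simp_all [Mark.IsA, e_ne_za]

theorem flatMap_psi_LC (hm : m.IsBound) (hα : S.IsA α) (hβ : S.IsC β) :
    S.LC.flatMap (S.psi (S.e m) α β) = [S.zc] := by
  classical
  have hp : (S.LC.flatMap (S.psi (S.e m) α β)).Perm
      ([S.zc, S.e .C₁, S.e .C₂, S.e .C₃].flatMap (S.psi (S.e m) α β)) :=
    S.perm_LC.flatMap_right _
  rw [← List.perm_singleton]
  refine hp.trans ?_
  simp only [List.flatMap_cons, List.flatMap_nil, psi_zc hα,
    psi_of_isC hm (n := .C₁) trivial hα, psi_of_isC hm (n := .C₂) trivial hα,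
    psi_of_isC hm (n := .C₃) trivial hα]
  rcases hβ with rfl | ⟨n, hn, rfl⟩
  · simp [e_ne_zc]
  · cases n <;> simp_all [Mark.IsC, e_ne_zc]

theorem flatMap_sig_psi (hm : m.IsBound) (hα : S.IsA α) (hβ : S.IsC β) {v : List Letter}
    (hv : ∀ l ∈ v, l ∈ S.Lf ∨ l ∈ S.Rt) :
    (v.flatMap S.sig).flatMap (S.psi (S.e m) α β) = v := by
  induction v with
  | nil => rfl
  | cons l v ih =>
    have key : (S.sig l).flatMap (S.psi (S.e m) α β) = [l] := by
      unfold sig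
      by_cases h₁ : l = S.za
      · rw [if_pos h₁, flatMap_psi_LA hm hα hβ, h₁]
      · by_cases h₂ : l = S.zc
        · rw [if_neg h₁, if_pos h₂, flatMap_psi_LC hm hα hβ, h₂]
        · rw [if_neg h₁, if_neg h₂]
          have : S.Plain l := ⟨by have := hv l (by simp); tauto, h₁, h₂⟩
          simp [psi_of_plain hα hβ this]
    rw [List.flatMap_cons, List.flatMap_append, key, ih fun l hl => hv l (by simp [hl])]
    rfl

theorem za_notMem_M₀ : S.za ∉ S.M₀ := by
  have := count_md S.isZ_za (Or.inr (Or.inr za_mem_md))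
  rw [md, List.count_cons_self, List.count_append] at this
  exact List.count_eq_zero.1 (by omega)

theorem zc_notMem_M₀ : S.zc ∉ S.M₀ := by
  have := count_md S.isZ_zc (Or.inr (Or.inr zc_mem_md))
  rw [md, List.count_cons, List.count_append] at this
  simp only [List.count_singleton_self] at this
  exact List.count_eq_zero.1 (by omega)

theorem flatMap_psi_M₀ (hα : S.IsA α) (hβ : S.IsC β) :
    S.M₀.flatMap (S.psi (S.e m) α β) = S.M₀ := by
  have : ∀ v : List Letter, (∀ l ∈ v, l ∈ S.M₀) → v.flatMap (S.psi (S.e m) α β) = v := by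
    intro v hv
    induction v with
    | nil => rfl
    | cons l v ih =>
      have hl := hv l (by simp)
      have : S.Plain l := ⟨by tauto, by rintro rfl; exact za_notMem_M₀ hl,
        by rintro rfl; exact zc_notMem_M₀ hl⟩
      rw [List.flatMap_cons, psi_of_plain hα hβ this, ih fun l hl => hv l (by simp [hl])]
      rfl
  exact this _ fun _ h => h

theorem sees_word_base (hm : m.IsBound) : S.Sees (S.word 1 1) (S.e m) S.za S.zc := by
  classical
  unfold Sees word
  have hL := flatMap_sig_psi hm isA_za isC_zc (S := S) (v := S.Lf) fun l h => Or.inl h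
  have hR := flatMap_sig_psi hm isA_za isC_zc (S := S) (v := S.Rt) fun l h => Or.inr h
  simp only [List.flatMap_append, hL, hR, md, List.flatMap_cons, List.flatMap_nil,
    flatMap_psi_M₀ isA_za isC_zc, psi_za isC_zc, psi_zc isA_za, if_true, List.replicate_one,
    psi_of_isA hm (n := .A₁) trivial isC_zc, psi_of_isA hm (n := .A₂) trivial isC_zc,
    psi_of_isA hm (n := .A₃) trivial isC_zc, psi_of_isC hm (n := .C₁) trivial isA_za,
    psi_of_isC hm (n := .C₂) trivial isA_za, psi_of_isC hm (n := .C₃) trivial isA_za,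
    psi_of_bound (n := .g) trivial isA_za isC_zc,
    psi_of_bound (n := .h) trivial isA_za isC_zc,
    psi_of_bound (n := .k) trivial isA_za isC_zc,
    psi_of_bound (n := .c₁) trivial isA_za isC_zc,
    psi_of_bound (n := .c₂) trivial isA_za isC_zc,
    psi_of_bound (n := .g') trivial isA_za isC_zc, e_ne_za, e_ne_zc, if_false]
  have := S.mem_A
  cases m <;> simp [Mark.IsBound] at hm <;> simpa using this

/-- Every middle letter `A` stands between the first `g` and `md`. Read as `za`, it replaces the
`za` of `md`, which is erased, and only erased letters separate it from `M₀`. -/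
theorem sees_word_A {a : Mark} (ha : a.IsA) : S.Sees (S.word 1 1) (S.e .g) (S.e a) S.zc := by
  classical
  have hm : Mark.g.IsBound := trivial
  have hα := isA_e (S := S) ha
  unfold Sees word
  have hL := flatMap_sig_psi hm hα isC_zc (S := S) (v := S.Lf) fun l h => Or.inl h
  have hR := flatMap_sig_psi hm hα isC_zc (S := S) (v := S.Rt) fun l h => Or.inr h
  simp only [List.flatMap_append, hL, hR, md, List.flatMap_cons, List.flatMap_nil,
    flatMap_psi_M₀ hα isC_zc, psi_za isC_zc, psi_zc hα, if_true, List.replicate_one,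
    psi_of_isA hm (n := .A₁) trivial isC_zc, psi_of_isA hm (n := .A₂) trivial isC_zc,
    psi_of_isA hm (n := .A₃) trivial isC_zc, psi_of_isC hm (n := .C₁) trivial hα,
    psi_of_isC hm (n := .C₂) trivial hα, psi_of_isC hm (n := .C₃) trivial hα,
    psi_of_bound (n := .g) trivial hα isC_zc,
    psi_of_bound (n := .h) trivial hα isC_zc,
    psi_of_bound (n := .k) trivial hα isC_zc,
    psi_of_bound (n := .c₁) trivial hα isC_zc,
    psi_of_bound (n := .c₂) trivial hα isC_zc,
    psi_of_bound (n := .g') trivial hα isC_zc, e_ne_za, e_ne_zc, if_false]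
  have := S.mem_A
  cases a <;> simp [Mark.IsA] at ha <;> simpa using this

theorem sees_word_C {a : Mark} (ha : a.IsC) : S.Sees (S.word 1 1) (S.e .g') S.za (S.e a) := by
  have := sees_word_A (S := S.dual) (Mark.isA_dual.2 ha)
  rw [word_dual] at this
  have h := (sees_dual (S := S) (u := S.word 1 1) (c := S.e .g') (α := S.e a) (β := S.za)
    (e_ne_za a)).1
  apply h
  have hd : Mark.g.dual = .g' := rfl
  simpa [hd] using this

end Psi

/-! ### Positions in the word `F` -/

/-- The occurrence of the letter in the middle factor. -/
noncomputable def idx (S : Pattern) : Mark → ℕ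
  | .A₁ | .A₂ | .A₃ => S.Lf.count S.za + 1
  | .C₁ | .C₂ | .C₃ => S.Lf.count S.zc + 1
  | _ => 1

/-- The letter `a` of the middle factor lies between the two occurrences of `m`. -/
def InM (S : Pattern) (u : List Letter) (m a : Mark) : Prop := In u (S.e m) (S.e a) (S.idx a)

theorem pos_eq_of_eq_append {w P Q : List Letter} {l : Letter} {i : ℕ} (h : w = P ++ l :: Q)
    (hi : P.count l + 1 = i) : pos w l i = P.length + 1 := by
  rw [h, ← hi]; exact pos_append_cons P Q l

theorem e_notMem_md (m : Mark) : S.e m ∉ S.md := by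
  rw [mem_md_iff]
  rintro (h | h | h)
  · exact e_ne_za m h
  · exact S.notMem_e m h
  · exact e_ne_zc m h

theorem inM_word {m a : Mark} (hm : m.IsBound) (ha : a.IsA ∨ a.IsC) :
    S.InM (S.word 1 1) m a ↔ m.tbl a = true := by
  classical
  have cL : ∀ n : Mark, (S.Lf.flatMap S.sig).count (S.e n) =
      (if n.IsA then S.Lf.count S.za else 0) + (if n.IsC then S.Lf.count S.zc else 0) :=
    count_flatMap_sig_e _ fun m => e_notMem_Lf m
  have cM : ∀ n : Mark, S.md.count (S.e n) = 0 := fun n => List.count_eq_zero.2 (e_notMem_md n)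
  have hw : S.word 1 1 = S.Lf.flatMap S.sig ++
      [Mark.g, .A₁, .h, .A₂, .k, .c₁, .A₃, .g', .c₂].map S.e ++ S.md ++
      [Mark.c₁, .g, .C₁, .c₂, .k, .C₂, .h, .C₃, .g'].map S.e ++ S.Rt.flatMap S.sig := by
    simp [word]
  generalize S.Lf.flatMap S.sig = L at *
  generalize S.Rt.flatMap S.sig = R at *
  -- `first` and `second` locate the marks in the blocks of nine letters before and after `md`; the
  -- final `+ 1` counts the occurrence itself.
  have first : ∀ (p q : List Mark) (n : Mark),
      [Mark.g, .A₁, .h, .A₂, .k, .c₁, .A₃, .g', .c₂] = p ++ n :: q → n ∉ p →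
      pos (S.word 1 1) (S.e n) (L.count (S.e n) + 1) = L.length + p.length + 1 := by
    intro p q n hpq hn
    rw [hpq] at hw
    have := pos_eq_of_eq_append (w := S.word 1 1) (P := L ++ p.map S.e) (l := S.e n)
      (i := L.count (S.e n) + 1) (by rw [hw]; simp; rfl)
      (by rw [List.count_append, List.count_map_of_injective _ _ S.inj_e,
            List.count_eq_zero.2 hn])
    simpa using this
  have second : ∀ (p q : List Mark) (n : Mark),
      [Mark.c₁, .g, .C₁, .c₂, .k, .C₂, .h, .C₃, .g'] = p ++ n :: q → n ∉ p → ∀ i,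
      L.count (S.e n) + [Mark.g, .A₁, .h, .A₂, .k, .c₁, .A₃, .g', .c₂].count n + 1 = i →
      pos (S.word 1 1) (S.e n) i = L.length + 9 + S.md.length + p.length + 1 := by
    intro p q n hpq hn i hi
    rw [hpq] at hw
    have := pos_eq_of_eq_append (w := S.word 1 1)
      (P := L ++ [Mark.g, .A₁, .h, .A₂, .k, .c₁, .A₃, .g', .c₂].map S.e ++ S.md ++ p.map S.e)
      (l := S.e n) (i := i) (by rw [hw]; simp; rfl) (by
        rw [List.count_append, List.count_append, List.count_append, cM,
          List.count_map_of_injective _ _ S.inj_e, List.count_map_of_injective _ _ S.inj_e,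
          List.count_eq_zero.2 hn]
        omega)
    simp only [List.length_append, List.length_map, List.length_cons, List.length_nil] at this
    omega
  have a₁ := first [] _ .g rfl (by simp)
  have a₂ := first [.g] _ .A₁ rfl (by simp)
  have a₃ := first [.g, .A₁] _ .h rfl (by simp)
  have a₄ := first [.g, .A₁, .h] _ .A₂ rfl (by simp)
  have a₅ := first [.g, .A₁, .h, .A₂] _ .k rfl (by simp)
  have a₆ := first [.g, .A₁, .h, .A₂, .k] _ .c₁ rfl (by simp)
  have a₇ := first [.g, .A₁, .h, .A₂, .k, .c₁] _ .A₃ rfl (by simp)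
  have a₈ := first [.g, .A₁, .h, .A₂, .k, .c₁, .A₃] _ .g' rfl (by simp)
  have a₉ := first [.g, .A₁, .h, .A₂, .k, .c₁, .A₃, .g'] _ .c₂ rfl (by simp)
  have b₁ := second [] _ .c₁ rfl (by simp) 2
  have b₂ := second [.c₁] _ .g rfl (by simp) 2
  have b₃ := second [.c₁, .g] _ .C₁ rfl (by simp) (S.Lf.count S.zc + 1)
  have b₄ := second [.c₁, .g, .C₁] _ .c₂ rfl (by simp) 2
  have b₅ := second [.c₁, .g, .C₁, .c₂] _ .k rfl (by simp) 2
  have b₆ := second [.c₁, .g, .C₁, .c₂, .k] _ .C₂ rfl (by simp) (S.Lf.count S.zc + 1)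
  have b₇ := second [.c₁, .g, .C₁, .c₂, .k, .C₂] _ .h rfl (by simp) 2
  have b₈ := second [.c₁, .g, .C₁, .c₂, .k, .C₂, .h] _ .C₃ rfl (by simp) (S.Lf.count S.zc + 1)
  have b₉ := second [.c₁, .g, .C₁, .c₂, .k, .C₂, .h, .C₃] _ .g' rfl (by simp) 2
  clear first second
  simp [cL, Mark.IsA, Mark.IsC] at a₁ a₂ a₃ a₄ a₅ a₆ a₇ a₈ a₉ b₁ b₂ b₃ b₄ b₅ b₆ b₇ b₈ b₉
  cases m <;> simp only [Mark.IsBound] at hm <;>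
    cases a <;> simp only [Mark.IsA, Mark.IsC, or_self] at ha <;>
    simp only [InM, In, idx, Mark.tbl, a₁, a₂, a₃, a₄, a₅, a₆, a₇, a₈, a₉, b₁, b₂, b₃, b₄, b₅, b₆,
      b₇, b₈, b₉] <;> simp only [iff_true, Bool.false_eq_true, iff_false] <;> omega

end Pattern

/-! ### Sets of words cut out by tests -/

namespace Pattern

variable {S : Pattern}

theorem inM_of_sees_A {u : List Letter} {m a : Mark} (hm : m.IsBound) (ha : a.IsA)
    (h : S.Sees u (S.e m) (S.e a) S.zc) : S.InM u m a := by
  have := h.in_of_tracks (tracks_za hm (isA_e ha)) ((isA_e ha).ne_e hm.not_isA) S.isZ_za za_mem_md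
  cases a <;> first | exact this | exact absurd ha id

theorem inM_of_sees_C {u : List Letter} {m a : Mark} (hm : m.IsBound) (ha : a.IsC)
    (h : S.Sees u (S.e m) S.za (S.e a)) : S.InM u m a := by
  have := h.in_of_tracks (tracks_zc hm isA_za (isC_e ha)) ((isC_e ha).ne_e hm.not_isC) S.isZ_zc
    zc_mem_md
  cases a <;> first | exact this | exact absurd ha id

theorem in_za_of_sees {u : List Letter} {m : Mark} (hm : m.IsBound)
    (h : S.Sees u (S.e m) S.za S.zc) : In u (S.e m) S.za (S.Lf.count S.za + 1) :=
  h.in_of_tracks (tracks_za hm isA_za) (isA_za.ne_e hm.not_isA) S.isZ_za za_mem_md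

theorem in_zc_of_sees {u : List Letter} {m : Mark} (hm : m.IsBound)
    (h : S.Sees u (S.e m) S.za S.zc) : In u (S.e m) S.zc (S.Lf.count S.zc + 1) :=
  h.in_of_tracks (tracks_zc hm isA_za isC_zc) (isC_zc.ne_e hm.not_isC) S.isZ_zc zc_mem_md

theorem sees_A_of_inM {u : List Letter} {m n a : Mark} (hm : m.IsBound) (hn : n.IsBound)
    (ha : a.IsA) (h : S.Sees u (S.e m) (S.e a) S.zc) (hb : S.Sees u (S.e n) S.za S.zc)
    (hin : S.InM u n a) : S.Sees u (S.e n) (S.e a) S.zc := by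
  refine sees_of_in hm hn (isA_e ha) isC_zc h hb ?_ (in_zc_of_sees hn hb)
  cases a <;> first | exact hin | exact absurd ha id

theorem sees_C_of_inM {u : List Letter} {m n a : Mark} (hm : m.IsBound) (hn : n.IsBound)
    (ha : a.IsC) (h : S.Sees u (S.e m) S.za (S.e a)) (hb : S.Sees u (S.e n) S.za S.zc)
    (hin : S.InM u n a) : S.Sees u (S.e n) S.za (S.e a) := by
  refine sees_of_in hm hn isA_za (isC_e ha) h hb (in_za_of_sees hn hb) ?_
  cases a <;> first | exact hin | exact absurd ha id

theorem sees_word_of_tbl_A {m a : Mark} (hm : m.IsBound) (ha : a.IsA) (h : m.tbl a = true) :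
    S.Sees (S.word 1 1) (S.e m) (S.e a) S.zc :=
  sees_A_of_inM (m := .g) trivial hm ha (sees_word_A ha) (sees_word_base hm)
    ((inM_word hm (Or.inl ha)).2 h)

theorem sees_word_of_tbl_C {m a : Mark} (hm : m.IsBound) (ha : a.IsC) (h : m.tbl a = true) :
    S.Sees (S.word 1 1) (S.e m) S.za (S.e a) :=
  sees_C_of_inM (m := .g') trivial hm ha (sees_word_C ha) (sees_word_base hm)
    ((inM_word hm (Or.inr ha)).2 h)

/-- The words that are indistinguishable from `F` by the marks in `Q`. -/
def T (S : Pattern) (Q : Mark → Prop) : Set (List Letter) :=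
  {u | ∀ m, Q m → ∀ α β, S.IsA α → S.IsC β →
    (S.Sees u (S.e m) α β ↔ S.Sees (S.word 1 1) (S.e m) α β)}

/-- Reversal exchanges the letters `A` with the letters `C` and the tests of `Q₁` with those of
`Q₂`; it turns every statement about doubling `c₁` into one about `c₂`. -/
theorem mem_T_dual {Q : Mark → Prop} {u : List Letter} :
    u.reverse ∈ S.dual.T Q ↔ u ∈ S.T fun m => Q m.dual := by
  constructor
  · intro h m hm α β hα hβ
    have := h m.dual hm β α (isA_dual S |>.2 hβ) (isC_dual S |>.2 hα)
    rwa [word_dual, sees_dual (hα.ne_isC hβ).symm, sees_dual (hα.ne_isC hβ).symm, dual_e,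
      Mark.dual_dual] at this
  · intro h m hm α β hα hβ
    have hα' := (isA_dual S).1 hα
    have hβ' := (isC_dual S).1 hβ
    rw [word_dual, sees_dual (hβ'.ne_isC hα').symm, sees_dual (hβ'.ne_isC hα').symm, dual_e]
    exact h m.dual (by simpa using hm) β α hβ' hα'

section MemT

variable {u : List Letter} {Q : Mark → Prop}

theorem sees_base_of_mem (hQ : ∀ m, Q m → m.IsBound) (hu : u ∈ S.T Q) {m : Mark} (hm : Q m) :
    S.Sees u (S.e m) S.za S.zc :=
  (hu m hm _ _ isA_za isC_zc).2 (sees_word_base (hQ m hm))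

/-- A tested bound `n` whose interval contains `a` makes `a` readable in `u`. By `sees_of_in` the
reading passes to `m` as soon as `a` lies in the interval of `m`, and then the test of `m` decides
as in `F`. -/
theorem inM_iff_of_mem (hQ : ∀ m, Q m → m.IsBound) (hu : u ∈ S.T Q) {m n a : Mark} (hm : Q m)
    (hn : Q n) (ha : a.IsA ∨ a.IsC) (ht : n.tbl a = true) :
    S.InM u m a ↔ m.tbl a = true := by
  have hm' := hQ m hm
  have hn' := hQ n hn
  rcases ha with ha | ha
  · constructor
    · intro h
      have h₁ := (hu n hn _ _ (isA_e ha) isC_zc).2 (sees_word_of_tbl_A hn' ha ht)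
      have h₂ := sees_A_of_inM hn' hm' ha h₁ (sees_base_of_mem hQ hu hm) h
      have h₃ := (hu m hm _ _ (isA_e ha) isC_zc).1 h₂
      exact (inM_word hm' (Or.inl ha)).1 (inM_of_sees_A hm' ha h₃)
    · intro h
      exact inM_of_sees_A hm' ha
        ((hu m hm _ _ (isA_e ha) isC_zc).2 (sees_word_of_tbl_A hm' ha h))
  · constructor
    · intro h
      have h₁ := (hu n hn _ _ isA_za (isC_e ha)).2 (sees_word_of_tbl_C hn' ha ht)
      have h₂ := sees_C_of_inM hn' hm' ha h₁ (sees_base_of_mem hQ hu hm) h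
      have h₃ := (hu m hm _ _ isA_za (isC_e ha)).1 h₂
      exact (inM_word hm' (Or.inr ha)).1 (inM_of_sees_C hm' ha h₃)
    · intro h
      exact inM_of_sees_C hm' ha
        ((hu m hm _ _ isA_za (isC_e ha)).2 (sees_word_of_tbl_C hm' ha h))

/-- The intervals of `c` and `d` overlap, that of `c` comes first. -/
def Crosses (u : List Letter) (c d : Letter) : Prop :=
  pos u c 1 < pos u d 1 ∧ pos u d 1 < pos u c 2 ∧ pos u c 2 < pos u d 2

/-- The letter `a` precedes `zc`, which lies in the interval of `n`; being outside that interval,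
`a` comes before it. Symmetrically `b` comes after the interval of `m`. The two intervals meet
because both contain `za`. -/
theorem crosses_of_tbl (hQ : ∀ m, Q m → m.IsBound) (hu : u ∈ S.T Q) {m n : Mark} (hm : Q m)
    (hn : Q n) (a b : Mark) (ha : a.IsA) (hb : b.IsC) (h₁ : m.tbl a = true) (h₂ : n.tbl a = false)
    (h₃ : n.tbl b = true) (h₄ : m.tbl b = false) : Crosses u (S.e m) (S.e n) := by
  have hm' := hQ m hm
  have hn' := hQ n hn
  have i₁ := (inM_iff_of_mem hQ hu hm hm (Or.inl ha) h₁).2 h₁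
  have i₂ : ¬ S.InM u n a := by
    rw [inM_iff_of_mem hQ hu hn hm (Or.inl ha) h₁, h₂]; simp
  have i₃ := (inM_iff_of_mem hQ hu hn hn (Or.inr hb) h₃).2 h₃
  have i₄ : ¬ S.InM u m b := by
    rw [inM_iff_of_mem hQ hu hm hn (Or.inr hb) h₃, h₄]; simp
  have s₁ := ((hu m hm _ _ (isA_e ha) isC_zc).2 (sees_word_of_tbl_A hm' ha h₁)).pos_A_lt_pos_C hm'
    (isA_e ha) isC_zc
  have s₂ := ((hu n hn _ _ isA_za (isC_e hb)).2 (sees_word_of_tbl_C hn' hb h₃)).pos_A_lt_pos_C hn'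
    isA_za (isC_e hb)
  have b₁ := in_za_of_sees hm' (sees_base_of_mem hQ hu hm)
  have b₂ := in_za_of_sees hn' (sees_base_of_mem hQ hu hn)
  have b₃ := in_zc_of_sees hn' (sees_base_of_mem hQ hu hn)
  have k₁ : S.idx a = S.Lf.count S.za + 1 := by
    cases a <;> first | rfl | exact absurd ha id
  have k₂ : S.idx b = S.Lf.count S.zc + 1 := by
    cases b <;> first | rfl | exact absurd hb id
  simp only [InM, In, k₁, k₂] at i₁ i₂ i₃ i₄ b₁ b₂ b₃
  unfold Crosses
  omega

/-- A letter of the middle factor does not occur in a repeated factor with a bound. -/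
theorem notMem_of_repeated {m n : Mark} {α β l z : Letter} (h : S.Sees u (S.e n) α β)
    (hα : S.IsA α) (hβ : S.IsC β) (hl : Tracks (S := S) (S.e n) α β l z) (hz : z.isZ = true)
    (hz' : z ∈ S.md) (hlT : l.isT = false) (hb : S.Sees u (S.e m) S.za S.zc)
    {w₁ w₂ w₃ r : List Letter} (hu : u = w₁ ++ r ++ w₂ ++ r ++ w₃) (hm : S.e m ∈ r) : l ∉ r := by
  intro hlr
  have c₁ := h.count_of_tracks hl hz hz'
  have c₂ := hb.count_bound
  have d₁ := List.one_le_count_iff.2 hlr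
  have d₂ := List.one_le_count_iff.2 hm
  -- Letters `t` occur once, hence not in the repeated factor `r`. But some `t` separates the outer
  -- occurrence of `l` from an occurrence of the bound in the same copy of `r`.
  have hcT : ∀ t ∈ S.Lf ++ S.Rt, t.isT = true → t ∉ r := by
    intro t ht htT htr
    have := hb.count_T isA_za isC_zc htT (List.mem_append.1 ht)
    have := List.one_le_count_iff.2 htr
    simp only [hu, List.count_append] at *
    omega
  have e₁ := count_Lf_add_count_Rt hz (Or.inr (Or.inr hz'))
  rcases Nat.eq_zero_or_pos (S.Lf.count z) with h0 | h0
  · obtain ⟨t, ht, htT, hlt⟩ :=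
      h.outer_right hα hβ hl hz (List.one_le_count_iff.1 (by omega : 1 ≤ S.Rt.count z)) hlT
    have hlt' := hb.pos_T_right isA_za isC_zc htT ht
    refine hcT t (by simp [ht]) htT ?_
    have hct := hb.count_T isA_za isC_zc htT (Or.inr ht)
    subst hu
    simp only [List.count_append] at c₁ c₂
    exact mem_of_pos_between (P := w₁ ++ r ++ w₂) (Q := w₃) (i := 2) (j := 2)
      (by simp only [List.count_append]; omega) (by simp only [List.count_append]; omega)
      (by simp only [List.count_append]; omega) (by simp only [List.count_append]; omega)
      hct.ge hlt' hlt
  · obtain ⟨t, ht, htT, hlt⟩ := h.outer_left hα hβ hl hz (List.one_le_count_iff.1 h0) hlT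
    have hlt' := hb.pos_T_left isA_za isC_zc htT ht
    refine hcT t (by simp [ht]) htT ?_
    have hct := hb.count_T isA_za isC_zc htT (Or.inl ht)
    have hu' : u = w₁ ++ r ++ (w₂ ++ r ++ w₃) := by rw [hu]; simp
    subst hu'
    simp only [List.count_append] at c₁ c₂
    exact mem_of_pos_between (P := w₁) (Q := w₂ ++ r ++ w₃) (i := 1) (j := 1)
      (by omega) (by simp only [List.count_append]; omega)
      (by omega) (by simp only [List.count_append]; omega)
      hct.ge hlt hlt'

theorem isT_e (m : Mark) : (S.e m).isT = false := by
  have := S.isY_e m; cases h : S.e m <;> simp_all [Letter.isT, Letter.isY]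

/-- Each of the two bounds occurs once in either copy of `φ d`, and by `notMem_of_repeated` the
letter `a` avoids both copies. So `a` lies in both intervals or in neither. -/
theorem tbl_eq_of_repeated (hQ : ∀ m, Q m → m.IsBound) (hu : u ∈ S.T Q) {m n k a : Mark}
    (hm : Q m) (hn : Q n) (hk : Q k) (ha : a.IsA ∨ a.IsC) (ht : k.tbl a = true)
    {p q W : List Letter} {φ : Letter → List Letter} (hW : u = p ++ W.flatMap φ ++ q) {d : Letter}
    (hd : W.count d = 2) (hmd : S.e m ∈ φ d) (hnd : S.e n ∈ φ d) : m.tbl a = n.tbl a := by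
  obtain ⟨W₁, W₂, W₃, rfl, -, -, -⟩ := exists_split_of_count_two hd
  have hW' : u = (p ++ W₁.flatMap φ) ++ φ d ++ W₂.flatMap φ ++ φ d ++ (W₃.flatMap φ ++ q) := by
    rw [hW]; simp
  have hk' := hQ k hk
  have bm := sees_base_of_mem hQ hu hm
  have bn := sees_base_of_mem hQ hu hn
  have key : S.e a ∉ φ d ∧ S.idx a ≤ u.count (S.e a) := by
    rcases ha with ha | ha
    · have h := (hu k hk _ _ (isA_e ha) isC_zc).2 (sees_word_of_tbl_A hk' ha ht)
      have tr := tracks_za (S := S) (β := S.zc) hk' (isA_e ha)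
      refine ⟨notMem_of_repeated h (isA_e ha) isC_zc tr S.isZ_za za_mem_md (isT_e a) bm hW' hmd, ?_⟩
      rw [h.count_of_tracks tr S.isZ_za za_mem_md]
      have := count_Lf_add_count_Rt S.isZ_za (Or.inr (Or.inr za_mem_md))
      cases a <;> first | exact absurd ha id | (simp only [idx]; omega)
    · have h := (hu k hk _ _ isA_za (isC_e ha)).2 (sees_word_of_tbl_C hk' ha ht)
      have tr := tracks_zc (S := S) hk' isA_za (isC_e ha)
      refine ⟨notMem_of_repeated h isA_za (isC_e ha) tr S.isZ_zc zc_mem_md (isT_e a) bm hW' hmd, ?_⟩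
      rw [h.count_of_tracks tr S.isZ_zc zc_mem_md]
      have := count_Lf_add_count_Rt S.isZ_zc (Or.inr (Or.inr zc_mem_md))
      cases a <;> first | exact absurd ha id | (simp only [idx]; omega)
  rw [Bool.eq_iff_iff, ← inM_iff_of_mem hQ hu hm hk ha ht, ← inM_iff_of_mem hQ hu hn hk ha ht]
  have c₁ := bm.count_bound
  have c₂ := bn.count_bound
  have hi := key.2
  unfold InM In
  rw [hW'] at c₁ c₂ hi ⊢
  exact pos_iff_of_repeated hmd hnd key.1 c₁ c₂ hi

end MemT

end Pattern

/-! ### Overlapping intervals in the image of a word -/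

section Crosses

variable {u W W₁ W₂ W₃ p q : List Letter} {φ : Letter → List Letter} {c f l : Letter}

-- The two `c` lie in the two copies of `φ l`, and overlapping puts exactly one `f` between these
-- copies. It comes from a letter `d` occurring once in `W₂`; as `d` repeats in `W` while `f` occurs
-- only twice, `d` has one further occurrence, on the side of the other `f`.
open Pattern in
theorem exists_mem_of_crosses (hW : W = W₁ ++ l :: W₂ ++ l :: W₃)
    (hu : u = p ++ W.flatMap φ ++ q) (hc : u.count c = 2) (hf : u.count f = 2) (hcl : c ∈ φ l)
    (hfl : f ∉ φ l) (h₂ : ∀ d ∈ W₂, 2 ≤ W.count d) (hx : Crosses u c f ∨ Crosses u f c) :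
    ∃ d ∈ W₂, f ∈ φ d ∧ W.count d = 2 ∧ (Crosses u c f ∧ d ∈ W₃ ∨ Crosses u f c ∧ d ∈ W₁) := by
  have hu' : u = (p ++ W₁.flatMap φ) ++ φ l ++ W₂.flatMap φ ++ φ l ++ (W₃.flatMap φ ++ q) := by
    rw [hu, hW]; simp
  set X₁ := p ++ W₁.flatMap φ with hX₁
  set X₂ := W₂.flatMap φ with hX₂
  set X₃ := W₃.flatMap φ ++ q with hX₃
  have d₁ := List.one_le_count_iff.2 hcl
  have hf0 := List.count_eq_zero.2 hfl
  have hu₁ : u = X₁ ++ φ l ++ (X₂ ++ φ l ++ X₃) := by rw [hu']; simp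
  have hc' := hc
  have hf' := hf
  rw [hu'] at hc' hf'
  simp only [List.count_append, hf0] at hc' hf'
  have c1 : X₁.length < pos u c 1 ∧ pos u c 1 ≤ X₁.length + (φ l).length := by
    rw [hu₁]; exact pos_mem_middle (by omega) (by rw [List.count_append]; omega)
  have c2 : (X₁ ++ φ l ++ X₂).length < pos u c 2 ∧
      pos u c 2 ≤ (X₁ ++ φ l ++ X₂).length + (φ l).length := by
    rw [hu']
    exact pos_mem_middle (by simp only [List.count_append]; omega)
      (by simp only [List.count_append]; omega)
  have f1 : ∀ i ≤ 2, pos u f i ≤ X₁.length ∨ X₁.length + (φ l).length < pos u f i := by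
    intro i hi
    rw [hu₁]; exact pos_not_mem_middle hfl (by rw [← hu₁]; omega)
  have f2 : ∀ i ≤ 2, pos u f i ≤ (X₁ ++ φ l ++ X₂).length ∨
      (X₁ ++ φ l ++ X₂).length + (φ l).length < pos u f i := by
    intro i hi
    rw [hu']; exact pos_not_mem_middle hfl (by rw [← hu']; omega)
  have g1 : ∀ i ≤ 2, pos u f i ≤ X₁.length ↔ i ≤ X₁.count f := by
    intro i hi
    have hu₂ : u = X₁ ++ (φ l ++ (X₂ ++ φ l ++ X₃)) := by rw [hu']; simp
    rw [hu₂]; exact pos_append_le_iff (by rw [← hu₂]; omega)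
  have g2 : ∀ i ≤ 2, pos u f i ≤ (X₁ ++ φ l ++ X₂).length ↔ i ≤ X₁.count f + X₂.count f := by
    intro i hi
    have hu₂ : u = (X₁ ++ φ l ++ X₂) ++ (φ l ++ X₃) := by rw [hu']; simp
    have := pos_append_le_iff (P := X₁ ++ φ l ++ X₂) (Q := φ l ++ X₃) (a := f) (i := i)
      (by rw [← hu₂]; omega)
    rw [← hu₂] at this
    rw [this]
    simp only [List.count_append, hf0]
    omega
  have a1 := f1 1 (by omega)
  have a2 := f1 2 (by omega)
  have b1 := f2 1 (by omega)
  have b2 := f2 2 (by omega)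
  have e1 := g1 1 (by omega)
  have e2 := g1 2 (by omega)
  have k1 := g2 1 (by omega)
  have k2 := g2 2 (by omega)
  have main : X₂.count f = 1 ∧ (Crosses u c f ∧ X₁.count f = 0 ∨
      Crosses u f c ∧ X₃.count f = 0) := by
    rcases hx with h | h
    · have h' := h
      unfold Crosses at h
      have : X₁.count f = 0 := by omega
      exact ⟨by omega, Or.inl ⟨h', by omega⟩⟩
    · have h' := h
      unfold Crosses at h
      have : X₁.count f = 1 := by omega
      exact ⟨by omega, Or.inr ⟨h', by omega⟩⟩
  obtain ⟨hX, hor⟩ := main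
  have : f ∈ X₂ := List.one_le_count_iff.1 hX.ge
  obtain ⟨d, hd, hfd⟩ := List.mem_flatMap.1 this
  have hdl : l ≠ d := by rintro rfl; exact hfl hfd
  have n1 : W₂.count d ≤ 1 := hX ▸ count_le_count_flatMap hfd
  have n2 := h₂ d hd
  have n3 : W.count d ≤ u.count f := by
    rw [hu, List.count_append, List.count_append]
    have := count_le_count_flatMap (W := W) hfd
    omega
  refine ⟨d, hd, hfd, by omega, ?_⟩
  rw [hW] at n2
  simp only [List.count_append, List.count_cons, beq_iff_eq, hdl, if_false] at n2
  rcases hor with ⟨h, h0⟩ | ⟨h, h0⟩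
  · left
    refine ⟨h, ?_⟩
    have : W₁.count d ≤ X₁.count f := by
      rw [hX₁, List.count_append]
      have := count_le_count_flatMap (W := W₁) hfd
      omega
    exact List.one_le_count_iff.1 (by omega)
  · right
    refine ⟨h, ?_⟩
    have : W₃.count d ≤ X₃.count f := by
      rw [hX₃, List.count_append]
      have := count_le_count_flatMap (W := W₃) hfd
      omega
    exact List.one_le_count_iff.1 (by omega)

end Crosses

/-! ### Excluding the outer factors by counting letters `t` -/

theorem countP_flatMap_le {α β : Type*} {p : α → Bool} {q : β → Bool} {φ : α → List β}
    {v : List α} (h : ∀ a ∈ v, (φ a).countP q ≤ if p a = true then 1 else 0) :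
    (v.flatMap φ).countP q ≤ v.countP p := by
  induction v with
  | nil => simp
  | cons a v ih =>
    have h₁ := h a (by simp)
    have h₂ := ih fun b hb => h b (by simp [hb])
    rw [List.flatMap_cons, List.countP_append, List.countP_cons]
    omega

namespace Pattern

variable {S : Pattern}

theorem countP_isT_sig (v : List Letter) :
    (v.flatMap S.sig).countP Letter.isT = v.countP Letter.isT := by
  have hz : ∀ l : Letter, l.isZ = true → l.isT = false := by
    intro l h; cases l <;> simp_all [Letter.isT, Letter.isZ]
  induction v with
  | nil => rfl
  | cons l v ih =>
    have key : (S.sig l).countP Letter.isT = if l.isT = true then 1 else 0 := by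
      unfold sig
      by_cases h₁ : l = S.za
      · rw [if_pos h₁, S.perm_LA.countP_eq, h₁]
        simp [hz _ S.isZ_za, isT_e]
      · by_cases h₂ : l = S.zc
        · rw [if_neg h₁, if_pos h₂, S.perm_LC.countP_eq, h₂]
          simp [hz _ S.isZ_zc, isT_e]
        · rw [if_neg h₁, if_neg h₂]
          simp [List.countP_cons]
    rw [List.flatMap_cons, List.countP_append, List.countP_cons, ih, key, Nat.add_comm]

/-- A bound does not lie in the image of a letter of the middle factor whose other occurrence lies
in the right outer factor. -/
theorem not_mem_outer_right {m n : Mark} {u W W₁ W₂ V p q : List Letter}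
    {φ : Letter → List Letter} {l d : Letter}
    (bm : S.Sees u (S.e m) S.za S.zc) (bn : S.Sees u (S.e n) S.za S.zc)
    (hW : W = W₁ ++ l :: W₂ ++ l :: (V ++ S.Rt.flatMap S.sig))
    (hu : u = p ++ W.flatMap φ ++ q) (hml : S.e m ∈ φ l) (hnd : S.e n ∈ φ d) (hd : d ∈ W₂)
    (hdR : d ∈ S.Rt.flatMap S.sig) (hdc : W.count d = 2) (hlc : W.count l = 2)
    (h₂ : ∀ d ∈ W₂, 2 ≤ W.count d)
    (hR : ∀ r ∈ S.Rt.flatMap S.sig, r.isT = false → 2 ≤ W.count r)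
    (hT : ∀ r ∈ S.Rt.flatMap S.sig, r.isT = true → W.count r = 1) : False := by
  -- The contradiction: all `t` of `Rt` come from letters behind the outer `d`, each of which yields
  -- at most one `t` and only if it is a `t` itself; but the first `t` of `Rt` stands before `d`.
  set ψ := S.psi (S.e m) S.za S.zc with hψ
  set θ : Letter → List Letter := fun l => (φ l).flatMap ψ with hθ
  have hθf : ∀ v : List Letter, (v.flatMap φ).flatMap ψ = v.flatMap θ := fun v =>
    List.flatMap_assoc
  have hv : u.flatMap ψ = p.flatMap ψ ++ W.flatMap θ ++ q.flatMap ψ := by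
    rw [hu]; simp only [List.flatMap_append, hθf]
  have cm := bm.count_bound
  have cn := bn.count_bound
  -- the decomposition of `u` by the bound `m`
  obtain ⟨U₁, U₂, U₃, hU, k₁, k₂, k₃, f₁, f₃, f₂⟩ := bm.split
  obtain ⟨r₁, r₂, hl⟩ := List.append_of_mem hml
  have hu' : u = (p ++ W₁.flatMap φ ++ r₁) ++ S.e m :: (r₂ ++ W₂.flatMap φ ++ r₁) ++
      S.e m :: (r₂ ++ (V ++ S.Rt.flatMap S.sig).flatMap φ ++ q) := by
    rw [hu, hW]; simp [hl]
  have hcm := cm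
  rw [hu'] at hcm
  simp only [List.count_append, List.count_cons_self] at hcm
  obtain ⟨e₁, e₂, e₃⟩ := split_unique (hU.symm.trans hu') k₁ k₂
    (List.count_eq_zero.1 (by simp only [List.count_append]; omega))
    (List.count_eq_zero.1 (by simp only [List.count_append]; omega))
  have hRt : S.Rt = r₂.flatMap ψ ++ (V ++ S.Rt.flatMap S.sig).flatMap θ ++ q.flatMap ψ := by
    have := f₃
    rw [e₃, ← hψ] at this
    rw [List.flatMap_append, List.flatMap_append, hθf] at this
    exact this.symm
  -- counts in the image of `u`
  have cZ : ∀ z ∈ S.Rt, z.isZ = true → (u.flatMap ψ).count z = 2 := by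
    intro z hz hzZ
    obtain ⟨M', g₁, g₂⟩ := bm.form
    have a₁ := count_Lf_add_count_Rt hzZ (Or.inr (Or.inl hz))
    have a₂ := count_md hzZ (Or.inr (Or.inl hz))
    have a₃ := count_eq_of_filter g₂ (Letter.isY_eq_false_of_isZ hzZ)
    have a₄ : Letter.x ≠ z := by rintro rfl; simp [Letter.isZ] at hzZ
    rw [g₁]
    simp only [List.count_append, List.count_cons, beq_iff_eq, a₄, if_false]
    omega
  have cT : ∀ t ∈ S.Rt, t.isT = true → (u.flatMap ψ).count t = 1 := by
    intro t ht htT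
    rw [(tracks_plain isA_za isC_zc (plain_of_isT (Or.inr ht) htT)).count]
    exact bm.count_T isA_za isC_zc htT (Or.inr ht)
  -- A `z` of `Rt` also occurs between the two `x`, so it comes from `l` or from a letter of `W₂`,
  -- and all of these repeat.
  have hZ : ∀ z ∈ S.Rt, z.isZ = true → ∃ e, 2 ≤ W.count e ∧ z ∈ θ e := by
    intro z hz hzZ
    have a₂ := count_md hzZ (Or.inr (Or.inl hz))
    have a₃ := count_eq_of_filter f₂ (Letter.isY_eq_false_of_isZ hzZ)
    have : z ∈ U₂.flatMap ψ := List.one_le_count_iff.1 (by rw [hψ, a₃, a₂])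
    rw [e₂] at this
    simp only [List.flatMap_append, hθf, List.mem_append] at this
    rcases this with (h | h) | h
    · exact ⟨l, hlc.ge, by simp only [hθ, hl, List.flatMap_append, List.flatMap_cons]; simp [h]⟩
    · obtain ⟨e, he, hze⟩ := List.mem_flatMap.1 h
      exact ⟨e, h₂ e he, hze⟩
    · exact ⟨l, hlc.ge, by simp only [hθ, hl, List.flatMap_append, List.flatMap_cons]; simp [h]⟩
  -- A second source of `z`, besides the repeating letter `e`, would produce a third occurrence.
  have hZr : ∀ z ∈ S.Rt, z.isZ = true → ∀ r ∈ W, z ∈ θ r → 2 ≤ W.count r := by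
    intro z hz hzZ r hr hzr
    obtain ⟨e, he, hze⟩ := hZ z hz hzZ
    by_cases her : e = r
    · rwa [← her]
    · have h₁ := count_add_count_le_count_flatMap (W := W) her hze hzr
      have h₃ := cZ z hz hzZ
      have h₄ := List.one_le_count_iff.2 hr
      rw [hv, List.count_append, List.count_append] at h₃
      omega
  have hZq : ∀ z ∈ S.Rt, z.isZ = true → z ∉ q.flatMap ψ := by
    intro z hz hzZ hzq
    obtain ⟨e, he, hze⟩ := hZ z hz hzZ
    have h₁ := count_le_count_flatMap (W := W) hze
    have h₃ := cZ z hz hzZ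
    have h₄ := List.one_le_count_iff.2 hzq
    rw [hv, List.count_append, List.count_append] at h₃
    omega
  -- The last letter of `Rt` is a `z`, and `hZq` leaves none for `q`.
  have hq : q.flatMap ψ = [] := by
    by_contra hne
    have hlast : S.Rt.getLast? = some ((q.flatMap ψ).getLast hne) := by
      rw [hRt, List.getLast?_append_of_ne_nil _ hne, List.getLast?_eq_some_getLast hne]
    have hmem := List.getLast_mem hne
    exact hZq _ (by rw [hRt]; simp [hmem]) (S.last_Rt _ hlast) hmem
  -- the decomposition of the right outer factor by the letter `d`
  obtain ⟨R₁, R₂, hRd⟩ := List.append_of_mem hdR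
  have hd₂ := List.one_le_count_iff.2 hd
  have hWd : W = (W₁ ++ l :: W₂ ++ l :: (V ++ R₁)) ++ d :: R₂ := by rw [hW, hRd]; simp
  -- The second `S.e n` lies in the image of the outer `d`, and every `t` of `Rt` comes after it.
  -- The image of `d` has no `t`, because `d` repeats.
  have hTR : ∀ t ∈ S.Rt, t.isT = true → t ∈ R₂.flatMap θ := by
    intro t ht htT
    have ct := bm.count_T isA_za isC_zc htT (Or.inr ht)
    have hpos := bn.pos_T_right isA_za isC_zc htT ht
    obtain ⟨s₁, s₂, hs⟩ := List.append_of_mem hnd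
    set P := p ++ (W₁ ++ l :: W₂ ++ l :: (V ++ R₁)).flatMap φ ++ s₁ with hP
    have huP : u = P ++ S.e n :: (s₂ ++ R₂.flatMap φ ++ q) := by
      rw [hu, hWd, hP]; simp [hs]
    have hPn : 1 ≤ P.count (S.e n) := by
      rw [List.one_le_count_iff, hP]
      simp only [List.mem_append, List.flatMap_append, List.flatMap_cons, List.mem_flatMap]
      exact Or.inl (Or.inr (Or.inl (Or.inr (Or.inr ⟨d, hd, hnd⟩))))
    have hPn' : P.count (S.e n) + 1 = 2 := by
      have := cn
      rw [huP, List.count_append, List.count_cons_self] at this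
      omega
    have p₂ := pos_eq_of_eq_append huP hPn'
    have hin : t ∈ s₂ ++ R₂.flatMap φ ++ q := by
      by_contra hcon
      have h0 := List.count_eq_zero.2 hcon
      have hlt : pos u t 1 ≤ P.length + 1 := by
        have huP' : u = (P ++ [S.e n]) ++ (s₂ ++ R₂.flatMap φ ++ q) := by rw [huP]; simp
        have := pos_append_le_iff (P := P ++ [S.e n]) (Q := s₂ ++ R₂.flatMap φ ++ q) (a := t)
          (i := 1) (by rw [← huP', ct])
        rw [← huP', List.length_append, List.length_singleton] at this
        rw [this]
        rw [huP', List.count_append] at ct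
        omega
      omega
    simp only [List.mem_append] at hin
    have hψt : ψ t = [t] := psi_of_plain isA_za isC_zc (plain_of_isT (Or.inr ht) htT)
    rcases hin with (h | h) | h
    · have hφd : t ∈ φ d := by rw [hs]; simp [h]
      have := count_le_count_flatMap (W := W) hφd
      rw [hu, List.count_append, List.count_append] at ct
      omega
    · obtain ⟨r, hr, htr⟩ := List.mem_flatMap.1 h
      exact List.mem_flatMap.2 ⟨r, hr, List.mem_flatMap.2 ⟨t, htr, by rw [hψt]; simp⟩⟩
    · have : t ∈ q.flatMap ψ := List.mem_flatMap.2 ⟨t, h, by rw [hψt]; simp⟩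
      rw [hq] at this
      simp at this
  have hRt' : S.Rt = (r₂.flatMap ψ ++ (V ++ R₁ ++ [d]).flatMap θ) ++ R₂.flatMap θ := by
    nth_rw 1 [hRt]
    rw [hq, hRd]; simp
  set X := r₂.flatMap ψ ++ (V ++ R₁ ++ [d]).flatMap θ with hX
  have hX0 : X.countP Letter.isT = 0 := by
    rw [List.countP_eq_zero]
    intro t ht htT
    have htR : t ∈ S.Rt := by rw [hRt']; simp [ht]
    have := S.count_T t htT
    have a₁ := List.one_le_count_iff.2 ht
    have a₂ := List.one_le_count_iff.2 (hTR t htR htT)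
    rw [hRt', List.count_append] at this
    omega
  -- A letter other than a `t` repeats, so its image has no `t`. A `t` occurs once, so by `hZr` its
  -- image has no `z`; it consists of letters `t`, and no two of these are adjacent in `Rt`.
  have hle : (R₂.flatMap θ).countP Letter.isT ≤ R₂.countP Letter.isT := by
    refine countP_flatMap_le fun r hr => ?_
    have hrR : r ∈ S.Rt.flatMap S.sig := by rw [hRd]; simp [hr]
    have hrW : r ∈ W := by rw [hWd]; simp [hr]
    obtain ⟨a, b, hab⟩ := List.append_of_mem hr
    have hRr : S.Rt = (X ++ a.flatMap θ) ++ θ r ++ b.flatMap θ := by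
      nth_rw 1 [hRt']
      rw [hab]; simp
    have hmem : ∀ t ∈ θ r, t ∈ S.Rt := fun t ht => by rw [hRr]; simp [ht]
    by_cases hrT : r.isT = true
    · rw [if_pos hrT]
      have hall : ∀ t ∈ θ r, t.isT = true := by
        intro t ht
        rcases S.mem_Rt t (hmem t ht) with h | h
        · exact h
        · have := hZr t (hmem t ht) h r hrW ht
          have := hT r hrR hrT
          omega
      have hch : (θ r).IsChain fun a b => ¬ (a.isT = true ∧ b.isT = true) :=
        S.chain_Rt.infix ⟨_, _, hRr.symm⟩
      refine le_trans List.countP_le_length ?_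
      rcases hθr : θ r with _ | ⟨a, _ | ⟨b, l'⟩⟩
      · simp
      · simp
      · rw [hθr] at hch hall
        rw [List.isChain_cons_cons] at hch
        exact absurd ⟨hall a (by simp), hall b (by simp)⟩ hch.1
    · have hrT' : r.isT = false := by simpa using hrT
      rw [if_neg hrT, Nat.le_zero, List.countP_eq_zero]
      intro t ht htT
      have h₁ := hR r hrR hrT'
      have h₃ := count_le_count_flatMap (W := W) ht
      have h₄ := cT t (hmem t ht) htT
      rw [hv, List.count_append, List.count_append] at h₄
      omega
  -- The inequality is strict because `Rt` begins with a `t`, which therefore stands before `d`.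
  have hlt : R₂.countP Letter.isT < S.Rt.countP Letter.isT := by
    rw [← countP_isT_sig (S := S) S.Rt, hRd]
    have hne : S.Rt ≠ [] := by
      rintro h; rw [h] at hdR; simp at hdR
    obtain ⟨t, R', hRR⟩ := List.exists_cons_of_ne_nil hne
    have htT := S.head_Rt t (by rw [hRR]; rfl)
    have hsig : S.sig t = [t] := by
      simp [sig, Letter.ne_of_isT_of_isZ htT S.isZ_za, Letter.ne_of_isT_of_isZ htT S.isZ_zc]
    have hdt : d ≠ t := by
      rintro rfl
      have := hT d hdR htT
      omega
    have heq : t :: R'.flatMap S.sig = R₁ ++ d :: R₂ := by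
      rw [← hRd, hRR, List.flatMap_cons, hsig]; rfl
    cases R₁ with
    | nil =>
      rw [List.nil_append, List.cons.injEq] at heq
      exact absurd heq.1.symm hdt
    | cons t' R₁' =>
      rw [List.cons_append, List.cons.injEq] at heq
      rw [← heq.1]
      simp only [List.cons_append, List.countP_cons, List.countP_append, htT, if_true]
      omega
  have : S.Rt.countP Letter.isT = (R₂.flatMap θ).countP Letter.isT := by
    rw [hRt', List.countP_append, hX0, Nat.zero_add]
  omega

theorem not_mem_outer_left {m n : Mark} {u W W₂ W₃ V p q : List Letter}
    {φ : Letter → List Letter} {l d : Letter}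
    (bm : S.Sees u (S.e m) S.za S.zc) (bn : S.Sees u (S.e n) S.za S.zc)
    (hW : W = S.Lf.flatMap S.sig ++ V ++ l :: W₂ ++ l :: W₃)
    (hu : u = p ++ W.flatMap φ ++ q) (hml : S.e m ∈ φ l) (hnd : S.e n ∈ φ d) (hd : d ∈ W₂)
    (hdL : d ∈ S.Lf.flatMap S.sig) (hdc : W.count d = 2) (hlc : W.count l = 2)
    (h₂ : ∀ d ∈ W₂, 2 ≤ W.count d)
    (hR : ∀ r ∈ S.Lf.flatMap S.sig, r.isT = false → 2 ≤ W.count r)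
    (hT : ∀ r ∈ S.Lf.flatMap S.sig, r.isT = true → W.count r = 1) : False := by
  have hrev : S.dual.Rt.flatMap S.dual.sig = (S.Lf.flatMap S.sig).reverse := by
    rw [dual_Rt, sig_dual, List.reverse_flatMap]
  refine not_mem_outer_right (S := S.dual) (m := m.dual) (n := n.dual) (u := u.reverse)
    (W := W.reverse) (W₁ := W₃.reverse) (W₂ := W₂.reverse) (V := V.reverse) (p := q.reverse)
    (q := p.reverse) (φ := fun l => (φ l).reverse) (l := l) (d := d) ?_ ?_ ?_ ?_ ?_ ?_ ?_ ?_ ?_ ?_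
    ?_ ?_ ?_
  · simpa [sees_dual S.za_ne_zc.symm] using bm
  · simpa [sees_dual S.za_ne_zc.symm] using bn
  · rw [hrev, hW]; simp [List.reverse_append]
  · rw [hu, List.reverse_append, List.reverse_append, List.reverse_flatMap]
    simp [Function.comp_def]
  · simpa using hml
  · simpa using hnd
  · simpa using hd
  · rw [hrev, List.mem_reverse]; exact hdL
  · rwa [List.count_reverse]
  · rwa [List.count_reverse]
  · intro d hd
    rw [List.count_reverse]; exact h₂ d (by simpa using hd)
  · intro r hr
    rw [List.count_reverse]; exact hR r (by rw [hrev] at hr; simpa using hr)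
  · intro r hr
    rw [List.count_reverse]; exact hT r (by rw [hrev] at hr; simpa using hr)

end Pattern

namespace Pattern

variable {S : Pattern}

/-! ### Numbers of occurrences in the words -/

theorem count_word_e (i j : ℕ) (n : Mark) : (S.word i j).count (S.e n) =
    match n with
    | .c₁ => i + 1
    | .c₂ => j + 1
    | _ => 2 := by
  classical
  have cL := count_flatMap_sig_e (S := S) S.Lf (fun m => e_notMem_Lf m) n
  have cR := count_flatMap_sig_e (S := S) S.Rt (fun m => e_notMem_Rt m) n
  have cM := List.count_eq_zero.2 (e_notMem_md (S := S) n)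
  have h₁ := count_Lf_add_count_Rt S.isZ_za (Or.inr (Or.inr za_mem_md))
  have h₂ := count_Lf_add_count_Rt S.isZ_zc (Or.inr (Or.inr zc_mem_md))
  simp only [word, List.count_append, cL, cR, cM, List.count_cons, List.count_nil, beq_iff_eq,
    e_inj, List.count_replicate]
  cases n <;> simp [Mark.IsA, Mark.IsC] <;> omega

theorem two_le_count_word_e {i j : ℕ} (hi : 1 ≤ i) (hj : 1 ≤ j) (n : Mark) :
    2 ≤ (S.word i j).count (S.e n) := by
  rw [count_word_e]; cases n <;> simp <;> omega

theorem count_word_of_not_isY (i j : ℕ) {d : Letter} (hd : d.isY = false) :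
    (S.word i j).count d = S.Lf.count d + S.md.count d + S.Rt.count d := by
  have he : ∀ m, S.e m ≠ d := fun m h => by
    have := S.isY_e m; rw [h, hd] at this; simp at this
  simp only [word, List.count_append, count_flatMap_sig hd, List.count_cons, List.count_nil,
    beq_iff_eq, he, if_false, List.count_replicate]
  omega

theorem count_word_of_isZ (i j : ℕ) {z : Letter} (hz : z.isZ = true)
    (h : z ∈ S.Lf ∨ z ∈ S.Rt ∨ z ∈ S.md) : (S.word i j).count z = 2 := by
  have h₁ := count_Lf_add_count_Rt hz h
  have h₂ := count_md hz h
  rw [count_word_of_not_isY i j (Letter.isY_eq_false_of_isZ hz)]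
  omega

theorem two_le_count_word_of_mem_md {i j : ℕ} {d : Letter} (hd : d ∈ S.md) :
    2 ≤ (S.word i j).count d := by
  have hd' := hd
  rw [mem_md_iff] at hd
  rcases hd with rfl | hd | rfl
  · exact (count_word_of_isZ i j S.isZ_za (Or.inr (Or.inr hd'))).ge
  · rcases S.mem_M₀ d hd with h | h
    · exact (count_word_of_isZ i j h (Or.inr (Or.inr hd'))).ge
    · have h₁ := S.count_Y d hd h
      have h₂ : S.md.count d ≤ (S.word i j).count d := by
        simp only [word, List.count_append]; omega
      have h₃ : S.M₀.count d ≤ S.md.count d := by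
        simp only [md, List.count_cons, List.count_append]; omega
      omega
  · exact (count_word_of_isZ i j S.isZ_zc (Or.inr (Or.inr hd'))).ge

theorem mem_sig {l r : Letter} (h : r ∈ S.sig l) : r = l ∨ ∃ n, r = S.e n := by
  unfold sig at h
  split_ifs at h with h₁ h₂
  · rcases mem_LA.1 h with h | ⟨n, -, h⟩
    · exact Or.inl (h.trans h₁.symm)
    · exact Or.inr ⟨n, h⟩
  · rcases mem_LC.1 h with h | ⟨n, -, h⟩
    · exact Or.inl (h.trans h₂.symm)
    · exact Or.inr ⟨n, h⟩
  · exact Or.inl (by simpa using h)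

theorem two_le_count_word_of_outer {i j : ℕ} (hi : 1 ≤ i) (hj : 1 ≤ j) {v : List Letter}
    (hv : ∀ l ∈ v, l ∈ S.Lf ∨ l ∈ S.Rt) {r : Letter} (hr : r ∈ v.flatMap S.sig)
    (hrT : r.isT = false) : 2 ≤ (S.word i j).count r := by
  obtain ⟨l, hl, hrl⟩ := List.mem_flatMap.1 hr
  rcases mem_sig hrl with rfl | ⟨n, rfl⟩
  · have hz : r.isZ = true := by
      rcases hv r hl with h | h
      · rcases S.mem_Lf r h with h | h
        · simp [h] at hrT
        · exact h
      · rcases S.mem_Rt r h with h | h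
        · simp [h] at hrT
        · exact h
    have := hv r hl
    exact (count_word_of_isZ i j hz (by tauto)).ge
  · exact two_le_count_word_e hi hj n

theorem count_word_of_outer_isT (i j : ℕ) {v : List Letter}
    (hv : ∀ l ∈ v, l ∈ S.Lf ∨ l ∈ S.Rt) {r : Letter} (hr : r ∈ v.flatMap S.sig)
    (hrT : r.isT = true) : (S.word i j).count r = 1 := by
  obtain ⟨l, hl, hrl⟩ := List.mem_flatMap.1 hr
  rcases mem_sig hrl with rfl | ⟨n, rfl⟩
  · have h₁ := S.count_T r hrT
    have h₂ : 1 ≤ S.Lf.count r + S.Rt.count r := by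
      rcases hv r hl with h | h
      · have := List.one_le_count_iff.2 h; omega
      · have := List.one_le_count_iff.2 h; omega
    rw [count_word_of_not_isY i j (Letter.isY_eq_false_of_isT hrT), count_T_md hrT]
    omega
  · simp [isT_e] at hrT

/-! ### Bounds in the image of `c₁` -/

/-- The part of the word before the first `c₁`. -/
noncomputable def pre (S : Pattern) : List Letter :=
  S.Lf.flatMap S.sig ++ [S.e .g, S.e .A₁, S.e .h, S.e .A₂, S.e .k]

/-- The part of the word between the occurrences of `c₁`. -/
def mid (S : Pattern) : List Letter := [S.e .A₃, S.e .g', S.e .c₂] ++ S.md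

/-- The part of the word between the second `c₁` and the right outer factor. -/
def post (S : Pattern) (j : ℕ) : List Letter :=
  [S.e .g, S.e .C₁] ++ List.replicate j (S.e .c₂) ++ [S.e .k, S.e .C₂, S.e .h, S.e .C₃, S.e .g']

theorem word_eq (i j : ℕ) : S.word i j = S.pre ++ List.replicate i (S.e .c₁) ++ S.mid ++
    S.e .c₁ :: (S.post j ++ S.Rt.flatMap S.sig) := by
  simp [word, pre, mid, post]

theorem word_one_eq (j : ℕ) : S.word 1 j = S.pre ++ S.e .c₁ :: S.mid ++
    S.e .c₁ :: (S.post j ++ S.Rt.flatMap S.sig) := by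
  rw [word_eq]; simp

theorem two_le_count_of_mem_mid {i j : ℕ} (hi : 1 ≤ i) (hj : 1 ≤ j) {d : Letter}
    (hd : d ∈ S.mid) : 2 ≤ (S.word i j).count d := by
  simp only [mid, List.mem_append, List.mem_cons, List.not_mem_nil, or_false] at hd
  rcases hd with (rfl | rfl | rfl) | hd
  · exact two_le_count_word_e hi hj _
  · exact two_le_count_word_e hi hj _
  · exact two_le_count_word_e hi hj _
  · exact two_le_count_word_of_mem_md hd

section Steps

variable {u p q : List Letter} {Q : Mark → Prop} {φ : Letter → List Letter} {j : ℕ} {m n : Mark}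

/-- The bound `n` comes from a letter with one occurrence between the two `c₁` and the other to the
right. With the outer factor excluded, only `g'` and `c₂` qualify, the latter only if it is not
doubled. -/
theorem mem_or_mem_of_crosses_right (hj : 1 ≤ j) (hQ : ∀ m, Q m → m.IsBound) (hu : u ∈ S.T Q)
    (hw : u = p ++ (S.word 1 j).flatMap φ ++ q) (hm : Q m) (hn : Q n) (hmc : S.e m ∈ φ (S.e .c₁))
    (a b : Mark) (ha : a.IsA) (hb : b.IsC) (h₁ : m.tbl a = true) (h₂ : n.tbl a = false)
    (h₃ : n.tbl b = true) (h₄ : m.tbl b = false) :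
    S.e n ∈ φ (S.e .g') ∨ S.e n ∈ φ (S.e .c₂) ∧ j = 1 := by
  have hx := crosses_of_tbl hQ hu hm hn a b ha hb h₁ h₂ h₃ h₄
  have bm := sees_base_of_mem hQ hu hm
  have bn := sees_base_of_mem hQ hu hn
  have hlc : (S.word 1 j).count (S.e .c₁) = 2 := count_word_e 1 j .c₁
  have hnc : S.e n ∉ φ (S.e .c₁) := fun h => by
    have := tbl_eq_of_repeated hQ hu hm hn hm (Or.inl ha) h₁ hw hlc hmc h
    rw [h₁, h₂] at this; simp at this
  obtain ⟨d, hd, hnd, hdc, hor⟩ := exists_mem_of_crosses (word_one_eq j) hw bm.count_bound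
    bn.count_bound hmc hnc (fun d hd => two_le_count_of_mem_mid le_rfl hj hd) (Or.inl hx)
  have hd₃ : d ∈ S.post j ++ S.Rt.flatMap S.sig := by
    rcases hor with h | h
    · exact h.2
    · have := h.1
      unfold Crosses at this hx
      omega
  have hdR : d ∉ S.Rt.flatMap S.sig := fun hdR =>
    not_mem_outer_right bm bn (word_one_eq j) hw hmc hnd hd hdR hdc hlc
      (fun d hd => two_le_count_of_mem_mid le_rfl hj hd)
      (fun r hr hrT => two_le_count_word_of_outer le_rfl hj (fun l h => Or.inr h) hr hrT)
      (fun r hr hrT => count_word_of_outer_isT 1 j (fun l h => Or.inr h) hr hrT)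
  have hd₄ : d ∈ S.post j := (List.mem_append.1 hd₃).resolve_right hdR
  simp only [post, List.mem_append, List.mem_cons, List.not_mem_nil, or_false,
    List.mem_replicate] at hd₄
  simp only [mid, List.mem_append, List.mem_cons, List.not_mem_nil, or_false] at hd
  have hmd : ∀ m, S.e m ∉ S.md := e_notMem_md
  rcases hd with (rfl | rfl | rfl) | hd
  · simp at hd₄
  · exact Or.inl hnd
  · refine Or.inr ⟨hnd, ?_⟩
    rw [count_word_e] at hdc
    simpa using hdc
  · rcases hd₄ with ((rfl | rfl) | ⟨-, rfl⟩) | rfl | rfl | rfl | rfl | rfl <;>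
      exact absurd hd (hmd _)

/-- On the left there is no letter to house `n`: outside the outer factor, `pre` and `mid` have no
common letter. -/
theorem false_of_crosses_left (hj : 1 ≤ j) (hQ : ∀ m, Q m → m.IsBound) (hu : u ∈ S.T Q)
    (hw : u = p ++ (S.word 1 j).flatMap φ ++ q) (hm : Q m) (hn : Q n) (hmc : S.e m ∈ φ (S.e .c₁))
    (a b : Mark) (ha : a.IsA) (hb : b.IsC) (h₁ : n.tbl a = true) (h₂ : m.tbl a = false)
    (h₃ : m.tbl b = true) (h₄ : n.tbl b = false) : False := by
  have hx := crosses_of_tbl hQ hu hn hm a b ha hb h₁ h₂ h₃ h₄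
  have bm := sees_base_of_mem hQ hu hm
  have bn := sees_base_of_mem hQ hu hn
  have hlc : (S.word 1 j).count (S.e .c₁) = 2 := count_word_e 1 j .c₁
  have hnc : S.e n ∉ φ (S.e .c₁) := fun h => by
    have := tbl_eq_of_repeated hQ hu hm hn hn (Or.inl ha) h₁ hw hlc hmc h
    rw [h₁, h₂] at this; simp at this
  obtain ⟨d, hd, hnd, hdc, hor⟩ := exists_mem_of_crosses (word_one_eq j) hw bm.count_bound
    bn.count_bound hmc hnc (fun d hd => two_le_count_of_mem_mid le_rfl hj hd) (Or.inr hx)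
  have hd₃ : d ∈ S.pre := by
    rcases hor with h | h
    · have := h.1
      unfold Crosses at this hx
      omega
    · exact h.2
  have hdL : d ∉ S.Lf.flatMap S.sig := fun hdL =>
    not_mem_outer_left (V := [S.e .g, S.e .A₁, S.e .h, S.e .A₂, S.e .k]) bm bn (word_one_eq j) hw
      hmc hnd hd hdL hdc hlc
      (fun d hd => two_le_count_of_mem_mid le_rfl hj hd)
      (fun r hr hrT => two_le_count_word_of_outer le_rfl hj (fun l h => Or.inl h) hr hrT)
      (fun r hr hrT => count_word_of_outer_isT 1 j (fun l h => Or.inl h) hr hrT)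
  have hd₄ := (List.mem_append.1 hd₃).resolve_left hdL
  simp only [List.mem_cons, List.not_mem_nil, or_false] at hd₄
  simp only [mid, List.mem_append, List.mem_cons, List.not_mem_nil, or_false] at hd
  have hmd : ∀ m, S.e m ∉ S.md := e_notMem_md
  rcases hd with (rfl | rfl | rfl) | hd
  · simp at hd₄
  · simp at hd₄
  · simp at hd₄
  · rcases hd₄ with rfl | rfl | rfl | rfl | rfl <;> exact absurd hd (hmd _)

/-- The marks that test the first set. -/
def _root_.Mark.Q₁ : Mark → Prop
  | .g | .h | .k | .c₂ => True
  | _ => False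

/-- The marks that test the second set. -/
def _root_.Mark.Q₂ : Mark → Prop
  | .g' | .h | .k | .c₁ => True
  | _ => False

theorem _root_.Mark.Q₁.isBound {m : Mark} (h : m.Q₁) : m.IsBound := by
  cases m <;> trivial

theorem _root_.Mark.Q₂.isBound {m : Mark} (h : m.Q₂) : m.IsBound := by
  cases m <;> trivial

theorem _root_.Mark.Q₁_dual {m : Mark} : m.dual.Q₁ ↔ m.Q₂ := by cases m <;> rfl
theorem _root_.Mark.Q₂_dual {m : Mark} : m.dual.Q₂ ↔ m.Q₁ := by cases m <;> rfl

/-- The interval of `g` overlaps those of `h`, `k`, `c₂` from the left, which excludes these three.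
If `g` were in the image of `c₁`, then `h`, `k`, `c₂` would have to fit into the images of `g'` and
`c₂`, two of them into the same one. -/
theorem notMem_of_Q₁ (hj : 1 ≤ j) (hQ : ∀ m, Q m → m.IsBound) (hQ₁ : ∀ m : Mark, m.Q₁ → Q m)
    (hu : u ∈ S.T Q) (hw : u = p ++ (S.word 1 j).flatMap φ ++ q) (hm : m.Q₁) :
    S.e m ∉ φ (S.e .c₁) := by
  intro hmc
  have qg : Q .g := hQ₁ _ trivial
  have qh : Q .h := hQ₁ _ trivial
  have qk : Q .k := hQ₁ _ trivial
  have qc : Q .c₂ := hQ₁ _ trivial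
  have left : m ≠ .g → False := by
    intro hne
    refine false_of_crosses_left hj hQ hu hw (hQ₁ m hm) qg hmc .A₁ .C₁ trivial trivial rfl ?_ ?_ rfl
    · cases m <;> first | rfl | exact absurd hm id | exact absurd rfl hne
    · cases m <;> first | rfl | exact absurd hm id | exact absurd rfl hne
  by_cases hmg : m = .g
  · subst hmg
    have hh := mem_or_mem_of_crosses_right hj hQ hu hw qg qh hmc .A₁ .C₁ trivial trivial rfl rfl rfl rfl
    have hk := mem_or_mem_of_crosses_right hj hQ hu hw qg qk hmc .A₁ .C₁ trivial trivial rfl rfl rfl rfl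
    have hc := mem_or_mem_of_crosses_right hj hQ hu hw qg qc hmc .A₁ .C₁ trivial trivial rfl rfl rfl rfl
    -- Of the three intervals only that of `h` contains `A₂`, and only those of `h` and `k` contain
    -- `A₃`. So no two of the bounds share the image of a letter with two occurrences.
    have nhk : ∀ d, (S.word 1 j).count d = 2 → S.e .h ∈ φ d → S.e .k ∈ φ d → False := by
      intro d hd h₁ h₂
      have := tbl_eq_of_repeated hQ hu qh qk qh (a := .A₂) (Or.inl trivial) rfl hw hd h₁ h₂
      simp [Mark.tbl] at this
    have nhc : ∀ d, (S.word 1 j).count d = 2 → S.e .h ∈ φ d → S.e .c₂ ∈ φ d → False := by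
      intro d hd h₁ h₂
      have := tbl_eq_of_repeated hQ hu qh qc qh (a := .A₂) (Or.inl trivial) rfl hw hd h₁ h₂
      simp [Mark.tbl] at this
    have nkc : ∀ d, (S.word 1 j).count d = 2 → S.e .k ∈ φ d → S.e .c₂ ∈ φ d → False := by
      intro d hd h₁ h₂
      have := tbl_eq_of_repeated hQ hu qk qc qk (a := .A₃) (Or.inl trivial) rfl hw hd h₁ h₂
      simp [Mark.tbl] at this
    have cg : (S.word 1 j).count (S.e .g') = 2 := count_word_e 1 j .g'
    have cc : j = 1 → (S.word 1 j).count (S.e .c₂) = 2 := by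
      rintro rfl; exact count_word_e 1 1 .c₂
    rcases hh with hh | ⟨hh, hj'⟩ <;> rcases hk with hk | ⟨hk, hj'⟩ <;>
      rcases hc with hc | ⟨hc, hj'⟩
    · exact nhk _ cg hh hk
    · exact nhk _ cg hh hk
    · exact nhc _ cg hh hc
    · exact nkc _ (cc hj') hk hc
    · exact nkc _ cg hk hc
    · exact nhc _ (cc hj') hh hc
    · exact nhk _ (cc hj') hh hk
    · exact nhk _ (cc hj') hh hk
  · exact left hmg

/-- Here `c₂` occurs three times, so only the image of `g'` remains for the bounds that `c₁`
overlaps from the left. It cannot contain both `c₂` and `g'`, since `C₂` lies in the interval of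
`g'` only. The bound `g'` itself is excluded because `c₁` overlaps it from the left. -/
theorem notMem_of_Q₂ (hu : u ∈ S.T fun m => m.Q₁ ∨ m.Q₂)
    (hw : u = p ++ (S.word 1 2).flatMap φ ++ q) (hm : m.Q₁ ∨ m.Q₂) :
    S.e m ∉ φ (S.e .c₁) := by
  have hQ : ∀ m : Mark, (m.Q₁ ∨ m.Q₂) → m.IsBound := fun m h =>
    h.elim Mark.Q₁.isBound Mark.Q₂.isBound
  have one : m.Q₁ → S.e m ∉ φ (S.e .c₁) := fun h =>
    notMem_of_Q₁ (by omega) hQ (fun m h => Or.inl h) hu hw h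
  intro hmc
  have qc₁ : Mark.c₁.Q₁ ∨ Mark.c₁.Q₂ := Or.inr trivial
  have qg' : Mark.g'.Q₁ ∨ Mark.g'.Q₂ := Or.inr trivial
  have qc₂ : Mark.c₂.Q₁ ∨ Mark.c₂.Q₂ := Or.inl trivial
  cases m with
  | c₁ =>
    have h₁ := mem_or_mem_of_crosses_right (by omega) hQ hu hw qc₁ qc₂ hmc .A₃ .C₁ trivial trivial
      rfl rfl rfl rfl
    have h₂ := mem_or_mem_of_crosses_right (by omega) hQ hu hw qc₁ qg' hmc .A₃ .C₁ trivial trivial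
      rfl rfl rfl rfl
    have h₁' : S.e .c₂ ∈ φ (S.e .g') := h₁.resolve_right (by simp)
    have h₂' : S.e .g' ∈ φ (S.e .g') := h₂.resolve_right (by simp)
    have := tbl_eq_of_repeated hQ hu qg' qc₂ qg' (a := .C₂) (Or.inr trivial) rfl hw
      (count_word_e 1 2 .g') h₂' h₁'
    simp [Mark.tbl] at this
  | g' =>
    exact false_of_crosses_left (by omega) hQ hu hw qg' qc₁ hmc .A₃ .C₁ trivial trivial
      rfl rfl rfl rfl
  | g => exact one trivial hmc
  | h => exact one trivial hmc
  | k => exact one trivial hmc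
  | c₂ => exact one trivial hmc
  | _ => exact absurd hm (by simp [Mark.Q₁, Mark.Q₂])

end Steps

end Pattern

namespace Pattern

variable {S : Pattern}

/-! ### Doubling a letter -/

theorem mem_letters {b : List Letter} (hb : b ∈ S.A) {l : Letter} (hl : l ∈ b) :
    l = .x ∨ l ∈ S.Lf ∨ l ∈ S.Rt ∨ l.isY = true ∨ (l.isZ = true ∧ l ∈ S.md) := by
  obtain ⟨M', rfl, h⟩ := S.form_A b hb
  simp only [List.mem_append, List.mem_cons] at hl
  by_cases hY : l.isY = true
  · tauto
  · rcases hl with (hl | hl | hl) | hl | hl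
    · tauto
    · tauto
    · have h₁ : l ∈ M'.filter (fun l => !l.isY) := List.mem_filter.2 ⟨hl, by simpa using hY⟩
      rw [h] at h₁
      have h₂ : l ∈ S.md := (List.mem_filter.1 h₁).1
      have h₃ := h₂
      rw [mem_md_iff] at h₂
      rcases h₂ with rfl | h₂ | rfl
      · exact Or.inr (Or.inr (Or.inr (Or.inr ⟨S.isZ_za, h₃⟩)))
      · have := S.mem_M₀ l h₂
        tauto
      · exact Or.inr (Or.inr (Or.inr (Or.inr ⟨S.isZ_zc, h₃⟩)))
    · tauto
    · tauto

/-- Between the two occurrences of a letter `zᵢ` there is a letter `tᵢ`. -/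
theorem exists_isT_between {b : List Letter} (hb : b ∈ S.A) {z : Letter} (hz : z.isZ = true)
    (hz' : z ∈ S.md) : b.count z = 2 ∧ ∃ t : Letter, t.isT = true ∧ 1 ≤ b.count t ∧
      pos b z 1 < pos b t 1 ∧ pos b t 1 < pos b z 2 := by
  obtain ⟨M', rfl, h⟩ := S.form_A b hb
  have e₁ := count_Lf_add_count_Rt hz (Or.inr (Or.inr hz'))
  have e₂ := count_md hz (Or.inr (Or.inr hz'))
  have e₃ : M'.count z = S.md.count z := count_eq_of_filter h (Letter.isY_eq_false_of_isZ hz)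
  have e₄ : Letter.x ≠ z := by rintro rfl; simp [Letter.isZ] at hz
  have hc : (S.Lf ++ .x :: M' ++ .x :: S.Rt).count z = 2 := by
    simp only [List.count_append, List.count_cons, beq_iff_eq, e₄, if_false]; omega
  refine ⟨hc, ?_⟩
  rcases Nat.eq_zero_or_pos (S.Lf.count z) with h0 | h0
  · have hzR : z ∈ S.Rt := List.one_le_count_iff.1 (by omega)
    obtain ⟨t, R', hR⟩ := List.exists_cons_of_ne_nil (List.ne_nil_of_mem hzR)
    have hhead := S.head_Rt t (by rw [hR]; rfl)
    have hzt : t ≠ z := Letter.ne_of_isT_of_isZ hhead hz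
    have hxt : Letter.x ≠ t := by rintro rfl; simp [Letter.isT] at hhead
    have c₁ := S.count_T t hhead
    have c₂ := List.one_le_count_iff.2 (show t ∈ S.Rt by rw [hR]; simp)
    have c₃ := count_T_md (S := S) hhead
    have c₄ : M'.count t = S.md.count t :=
      count_eq_of_filter h (Letter.isY_eq_false_of_isT hhead)
    have ct : (S.Lf ++ .x :: M' ++ .x :: S.Rt).count t = 1 := by
      simp only [List.count_append, List.count_cons, beq_iff_eq, hxt, if_false]; omega
    refine ⟨t, hhead, ct.ge, ?_, ?_⟩
    · refine (pos_lt_iff (by omega) (by omega)).2 ⟨S.Lf ++ .x :: M', .x :: S.Rt, rfl, ?_, ?_⟩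
      · simp only [List.count_append, List.count_cons, beq_iff_eq, e₄, if_false]; omega
      · simp only [List.count_append, List.count_cons, beq_iff_eq, hxt, if_false]; omega
    · refine (pos_lt_iff (by omega) (by omega)).2 ⟨S.Lf ++ .x :: M' ++ [.x, t], R', ?_, ?_, ?_⟩
      · rw [hR]; simp
      · rw [List.one_le_count_iff]; simp
      · simp only [List.count_append, List.count_cons, List.count_nil, beq_iff_eq, e₄, hzt,
          if_false]
        omega
  · have hzL : z ∈ S.Lf := List.one_le_count_iff.1 h0
    have hne : S.Lf ≠ [] := List.ne_nil_of_mem hzL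
    have hlast := S.last_Lf _ (List.getLast?_eq_some_getLast hne)
    have hmem : S.Lf.getLast hne ∈ S.Lf := List.getLast_mem hne
    have hdec := List.dropLast_append_getLast hne
    generalize S.Lf.getLast hne = t at *
    have hzt : t ≠ z := Letter.ne_of_isT_of_isZ hlast hz
    have c₁ : S.Lf.count t ≤ 1 := by have := S.count_T t hlast; omega
    have c₂ := h0
    have c₃ := List.one_le_count_iff.2 hmem
    have ct : 1 ≤ (S.Lf ++ .x :: M' ++ .x :: S.Rt).count t := by
      simp only [List.count_append]; omega
    rw [← hdec] at c₁ c₂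
    simp only [List.count_append, List.count_cons, List.count_nil, beq_iff_eq, hzt, if_false,
      if_true] at c₁ c₂
    refine ⟨t, hlast, ct, ?_, ?_⟩
    · refine (pos_lt_iff (by omega) ct).2 ⟨S.Lf.dropLast, t :: .x :: M' ++ .x :: S.Rt, ?_, ?_, ?_⟩
      · nth_rw 1 [← hdec]; simp
      · omega
      · omega
    · refine (pos_lt_iff ct (by omega)).2 ⟨S.Lf, .x :: M' ++ .x :: S.Rt, by simp, c₃, ?_⟩
      omega

/-- A `t` separates the two occurrences of any `z`, so `r` contains no `z`. Only letters `y` remain,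
and contiguity makes everything up to the second copy the same `y`. -/
theorem eq_of_repeated_of_notMem {B₁ B₂ B₃ r : List Letter}
    (hA : B₁ ++ r ++ B₂ ++ r ++ B₃ ∈ S.A) (hx : .x ∉ r)
    (hT : ∀ t ∈ r ++ B₂, t.isT = false) :
    r = [] ∨ ∃ y : Letter, y.isY = true ∧ ∀ l ∈ r ++ B₂, l = y := by
  have hY : ∀ l ∈ r, l.isY = true := by
    intro l hl
    have hlT := hT l (by simp [hl])
    have noZ : l.isZ = true → l ∈ S.md → False := by
      intro hz hz'
      obtain ⟨c₂, t, htT, ct, p₁, p₂⟩ := exists_isT_between hA hz hz'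
      have h₁ := List.one_le_count_iff.2 hl
      simp only [List.count_append] at c₂
      have hb : B₁ ++ r ++ B₂ ++ r ++ B₃ = B₁ ++ (r ++ B₂ ++ r) ++ B₃ := by simp
      rw [hb] at p₁ p₂ ct
      have := mem_of_pos_between (P := B₁) (r := r ++ B₂ ++ r) (Q := B₃) (i := 1) (j := 2)
        (by omega) (by simp only [List.count_append]; omega) (by omega)
        (by simp only [List.count_append]; omega) ct p₁ p₂
      have h' : t ∈ r ++ B₂ := by
        simp only [List.mem_append] at this ⊢; tauto
      simp [hT t h'] at htT
    rcases mem_letters hA (l := l) (by simp [hl]) with rfl | h | h | h | h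
    · exact absurd hl hx
    · rcases S.mem_Lf l h with h' | h'
      · simp [h'] at hlT
      · have := S.count_Z l h' (Or.inl h)
        exact (noZ h' (List.one_le_count_iff.1 this.2.ge)).elim
    · rcases S.mem_Rt l h with h' | h'
      · simp [h'] at hlT
      · have := S.count_Z l h' (Or.inr (Or.inl h))
        exact (noZ h' (List.one_le_count_iff.1 this.2.ge)).elim
    · exact h
    · exact (noZ h.1 h.2).elim
  cases r with
  | nil => exact Or.inl rfl
  | cons y s =>
    right
    refine ⟨y, hY y (by simp), ?_⟩
    have := S.contiguous_A y B₁ (s ++ B₂) (s ++ B₃) (hY y (by simp)) (by simpa using hA)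
    intro l hl
    simp only [List.cons_append, List.mem_cons] at hl
    rcases hl with rfl | hl
    · rfl
    · exact this l hl

theorem mem_replicate_iff {y : Letter} (hy : y.isY = true) (w₁ w₂ : List Letter) (k : ℕ) :
    w₁ ++ List.replicate (k + 2) y ++ w₂ ∈ S.A ↔ w₁ ++ [y, y] ++ w₂ ∈ S.A := by
  induction k with
  | zero => rfl
  | succ k ih =>
    rw [← ih]
    have := S.exponent_A y w₁ (List.replicate k y ++ w₂) hy
    simp only [List.replicate_succ, List.append_assoc, List.cons_append] at this ⊢
    exact this.symm

/-- Words of `A` contain each `t` at most once, so if either word is in `A`, then `r ++ B₂` is free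
of `t`. Unless `r` is empty, the two words then differ only in the exponent of one `y`, which is at
least 2 in both. -/
theorem mem_double_iff {B₁ B₂ B₃ r : List Letter} (hx : .x ∉ r)
    (hT : ∀ t : Letter, t.isT = true → t ∈ r ++ B₂ → 2 ≤ (B₁ ++ r ++ B₂ ++ r ++ B₃).count t) :
    B₁ ++ r ++ B₂ ++ r ++ B₃ ∈ S.A ↔ B₁ ++ r ++ r ++ B₂ ++ r ++ B₃ ∈ S.A := by
  have hcT : ∀ b ∈ S.A, ∀ t : Letter, t.isT = true → b.count t ≤ 1 := by
    intro b hb t ht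
    obtain ⟨M', rfl, h⟩ := S.form_A b hb
    have c₁ := S.count_T t ht
    have c₃ := count_T_md (S := S) ht
    have c₄ : M'.count t = S.md.count t :=
      count_eq_of_filter h (Letter.isY_eq_false_of_isT ht)
    have hxt : Letter.x ≠ t := by rintro rfl; simp [Letter.isT] at ht
    simp only [List.count_append, List.count_cons, beq_iff_eq, hxt, if_false]; omega
  have main : (r = [] ∨ ∃ y : Letter, y.isY = true ∧ ∀ l ∈ r ++ B₂, l = y) →
      (B₁ ++ r ++ B₂ ++ r ++ B₃ ∈ S.A ↔ B₁ ++ r ++ r ++ B₂ ++ r ++ B₃ ∈ S.A) := by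
    rintro (rfl | ⟨y, hy, h⟩)
    · simp
    · obtain ⟨k, rfl⟩ : ∃ k, r = List.replicate k y :=
        ⟨_, List.eq_replicate_of_mem fun l hl => h l (by simp [hl])⟩
      obtain ⟨k', rfl⟩ : ∃ k, B₂ = List.replicate k y :=
        ⟨_, List.eq_replicate_of_mem fun l hl => h l (by simp [hl])⟩
      rcases Nat.eq_zero_or_pos k with rfl | h0
      · simp
      · have e₁ : k + k' + k = (k + k' + k - 2) + 2 := by omega
        have e₂ : k + k + k' + k = (k + k + k' + k - 2) + 2 := by omega
        simp only [List.append_assoc B₁, List.replicate_append_replicate]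
        rw [e₁, e₂, ← List.append_assoc, ← List.append_assoc, mem_replicate_iff hy, mem_replicate_iff hy]
  constructor
  · intro hA
    refine (main (eq_of_repeated_of_notMem hA hx fun t ht => ?_)).1 hA
    by_contra hc
    have htT : t.isT = true := by simpa using hc
    have := hT t htT ht
    have := hcT _ hA t htT
    omega
  · intro hA
    have hA' : B₁ ++ r ++ (r ++ B₂) ++ r ++ B₃ ∈ S.A := by simpa using hA
    have hnT : ∀ t ∈ r ++ (r ++ B₂), t.isT = false := by
      intro t ht
      by_contra hc
      have htT : t.isT = true := by simpa using hc
      have h₁ := hT t htT (by simp only [List.mem_append] at ht ⊢; tauto)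
      have h₂ := hcT _ hA t htT
      simp only [List.count_append] at h₁ h₂
      omega
    refine (main ?_).2 hA
    rcases eq_of_repeated_of_notMem hA' hx hnT with h | ⟨y, hy, h⟩
    · exact Or.inl h
    · exact Or.inr ⟨y, hy, fun l hl => h l (by simp only [List.mem_append] at hl ⊢; tauto)⟩

section Double

variable {p q : List Letter} {Q : Mark → Prop} {φ : Letter → List Letter} {i j : ℕ}

/-- Every tested reading turns the image of `c₁` into a factor without `x`. All letters from the
first `c₁` to the second repeat, so any `t` in their images repeats as well, as `mem_double_iff`
demands. -/
theorem mem_T_word_two_iff (hj : 1 ≤ j)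
    (h : ∀ m, Q m → S.e m ∉ φ (S.e .c₁)) :
    p ++ (S.word 1 j).flatMap φ ++ q ∈ S.T Q ↔ p ++ (S.word 2 j).flatMap φ ++ q ∈ S.T Q := by
  refine forall₂_congr fun m hm => forall₄_congr fun α β hα hβ => iff_congr ?_ Iff.rfl
  have hx : Letter.x ∉ (φ (S.e .c₁)).flatMap (S.psi (S.e m) α β) := by
    rw [← List.count_eq_zero, tracks_x.count, List.count_eq_zero]
    exact h m hm
  have := mem_double_iff (S := S)
    (B₁ := p.flatMap (S.psi (S.e m) α β) ++ (S.pre.flatMap φ).flatMap (S.psi (S.e m) α β))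
    (B₂ := (S.mid.flatMap φ).flatMap (S.psi (S.e m) α β))
    (B₃ := ((S.post j ++ S.Rt.flatMap S.sig).flatMap φ).flatMap (S.psi (S.e m) α β) ++
      q.flatMap (S.psi (S.e m) α β)) hx (by
      intro t _ ht
      have hd : ∃ d, 2 ≤ (S.word 1 j).count d ∧ t ∈ (φ d).flatMap (S.psi (S.e m) α β) := by
        rcases List.mem_append.1 ht with ht | ht
        · exact ⟨_, two_le_count_word_e le_rfl hj .c₁, ht⟩
        · rw [List.flatMap_assoc] at ht
          obtain ⟨d, hd, htd⟩ := List.mem_flatMap.1 ht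
          exact ⟨d, two_le_count_of_mem_mid le_rfl hj hd, htd⟩
      obtain ⟨d, hd, htd⟩ := hd
      have h₁ := count_le_count_flatMap
        (φ := fun l => (φ l).flatMap (S.psi (S.e m) α β)) (W := S.word 1 j) htd
      rw [word_one_eq] at h₁ hd
      simp only [← List.flatMap_assoc, List.flatMap_append, List.flatMap_cons,
        List.count_append] at h₁ hd ⊢
      omega)
  unfold Sees
  rw [word_one_eq, word_eq 2 j]
  simpa [List.flatMap_append, List.flatMap_cons, List.replicate] using this

theorem mem_T_word_two_iff' (hi : 1 ≤ i)
    (h : ∀ m, Q m → S.e m ∉ φ (S.e .c₂)) :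
    p ++ (S.word i 1).flatMap φ ++ q ∈ S.T Q ↔ p ++ (S.word i 2).flatMap φ ++ q ∈ S.T Q := by
  have key := mem_T_word_two_iff (S := S.dual) (p := q.reverse) (q := p.reverse)
    (Q := fun m => Q m.dual) (φ := fun l => (φ l).reverse) hi
    (fun m hm => by
      have hd : Mark.c₁.dual = .c₂ := rfl
      simpa [hd] using h m.dual hm)
  have e : ∀ k, q.reverse ++ (S.dual.word k i).flatMap (fun l => (φ l).reverse) ++ p.reverse =
      (p ++ (S.word i k).flatMap φ ++ q).reverse := by
    intro k
    rw [word_dual, List.reverse_append, List.reverse_append, List.reverse_flatMap]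
    simp [Function.comp_def]
  rw [e, e, mem_T_dual, mem_T_dual] at key
  simpa using key

theorem notMem_T_of_count {m : Mark} {l : Letter} (hQ : ∀ m, Q m → m.IsBound) (hm : Q m)
    {W : List Letter} (hW : 3 ≤ W.count l) (h : S.e m ∈ φ l) :
    p ++ W.flatMap φ ++ q ∉ S.T Q := by
  intro hu
  have h₁ := (sees_base_of_mem hQ hu hm).count_bound
  have h₂ := count_le_count_flatMap (W := W) h
  simp only [List.count_append] at h₁
  omega

/-- If a tested bound lies in the image of `c₁`, both sides fail: the left by `notMem_of_Q₁`, the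
right because the bound would occur three times. -/
theorem mem_T₁_iff : p ++ (S.word 1 1).flatMap φ ++ q ∈ S.T Mark.Q₁ ↔
    p ++ (S.word 2 1).flatMap φ ++ q ∈ S.T Mark.Q₁ := by
  have hQ : ∀ m : Mark, m.Q₁ → m.IsBound := fun m h => h.isBound
  by_cases h : ∀ m : Mark, m.Q₁ → S.e m ∉ φ (S.e .c₁)
  · exact mem_T_word_two_iff le_rfl h
  · simp only [not_forall, not_not] at h
    obtain ⟨m, hm, hmc⟩ := h
    refine iff_of_false (fun hu => ?_) (notMem_T_of_count hQ hm ?_ hmc)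
    · exact notMem_of_Q₁ le_rfl hQ (fun m h => h) hu rfl hm hmc
    · rw [count_word_e]

theorem mem_T₂_iff : p ++ (S.word 1 1).flatMap φ ++ q ∈ S.T Mark.Q₂ ↔
    p ++ (S.word 1 2).flatMap φ ++ q ∈ S.T Mark.Q₂ := by
  have key := mem_T₁_iff (S := S.dual) (p := q.reverse) (q := p.reverse)
    (φ := fun l => (φ l).reverse)
  have e : ∀ k, q.reverse ++ (S.dual.word k 1).flatMap (fun l => (φ l).reverse) ++ p.reverse =
      (p ++ (S.word 1 k).flatMap φ ++ q).reverse := by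
    intro k
    rw [word_dual, List.reverse_append, List.reverse_append, List.reverse_flatMap]
    simp [Function.comp_def]
  rw [e, e, mem_T_dual, mem_T_dual] at key
  simpa only [Mark.Q₁_dual] using key

/-- The passage goes through `S.word 1 1`: first `c₂` is made single, then `c₁` is doubled. No
tested bound lies in the image of `c₂`, since it would occur three times. -/
theorem mem_T_of_mem (hu : p ++ (S.word 1 2).flatMap φ ++ q ∈ S.T fun m => m.Q₁ ∨ m.Q₂) :
    p ++ (S.word 2 1).flatMap φ ++ q ∈ S.T fun m => m.Q₁ ∨ m.Q₂ := by
  have hQ : ∀ m : Mark, (m.Q₁ ∨ m.Q₂) → m.IsBound := fun m h =>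
    h.elim Mark.Q₁.isBound Mark.Q₂.isBound
  have h₁ : ∀ m : Mark, (m.Q₁ ∨ m.Q₂) → S.e m ∉ φ (S.e .c₁) := fun m hm =>
    notMem_of_Q₂ hu rfl hm
  have h₂ : ∀ m : Mark, (m.Q₁ ∨ m.Q₂) → S.e m ∉ φ (S.e .c₂) := fun m hm h =>
    notMem_T_of_count hQ hm (by rw [count_word_e]) h hu
  exact (mem_T_word_two_iff le_rfl h₁).1 ((mem_T_word_two_iff' le_rfl h₂).2 hu)

theorem mem_T_inter_iff : p ++ (S.word 2 1).flatMap φ ++ q ∈ S.T (fun m => m.Q₁ ∨ m.Q₂) ↔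
    p ++ (S.word 1 2).flatMap φ ++ q ∈ S.T fun m => m.Q₁ ∨ m.Q₂ := by
  refine ⟨fun hu => ?_, mem_T_of_mem⟩
  have key := mem_T_of_mem (S := S.dual) (p := q.reverse) (q := p.reverse)
    (φ := fun l => (φ l).reverse)
  have e : ∀ k l, q.reverse ++ (S.dual.word k l).flatMap (fun l => (φ l).reverse) ++ p.reverse =
      (p ++ (S.word l k).flatMap φ ++ q).reverse := by
    intro k l
    rw [word_dual, List.reverse_append, List.reverse_append, List.reverse_flatMap]
    simp [Function.comp_def]
  rw [e, e, mem_T_dual, mem_T_dual] at key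
  simp only [Mark.Q₁_dual, Mark.Q₂_dual, or_comm] at key hu ⊢
  exact key hu

end Double

/-! ### Nondistributivity from a pattern -/

theorem T_inter (Q Q' : Mark → Prop) : S.T Q ∩ S.T Q' = S.T fun m => Q m ∨ Q' m := by
  ext u
  constructor
  · rintro ⟨h₁, h₂⟩ m (hm | hm)
    · exact h₁ m hm
    · exact h₂ m hm
  · exact fun h => ⟨fun m hm => h m (Or.inl hm), fun m hm => h m (Or.inr hm)⟩

theorem toList_lift (φ : Letter → Word) (w : Word) :
    (FreeMonoid.lift φ w).toList = w.toList.flatMap fun l => (φ l).toList := by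
  induction w using FreeMonoid.inductionOn' with
  | one => rfl
  | of_mul a w ih =>
    rw [map_mul, FreeMonoid.toList_mul, ih, FreeMonoid.toList_mul, List.flatMap_append]
    simp

/-- A test is a substitution followed by membership in `A`, and identities are preserved by
substitutions. -/
theorem stableSet_T {V : MonoidVariety} (h : StableSet V {u : Word | u.toList ∈ S.A})
    (Q : Mark → Prop) : StableSet V {u : Word | u.toList ∈ S.T Q} := by
  have key : ∀ (u v : Word), (u, v) ∈ V.identities → ∀ c α β,
      S.Sees u.toList c α β → S.Sees v.toList c α β := by
    intro u v huv c α β hu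
    have := h _ _ (MonoidVariety.identities_lift huv
      fun l => FreeMonoid.ofList (S.psi c α β l)) (by
        simp only [Set.mem_ofPred_eq, toList_lift]; exact hu)
    simp only [Set.mem_ofPred_eq, toList_lift] at this
    exact this
  intro u v huv hu m hm α β hα hβ
  rw [← hu m hm α β hα hβ]
  exact ⟨key _ _ (MonoidVariety.identities_symm huv) _ _ _, key _ _ huv _ _ _⟩

theorem synCon_T {Q : Mark → Prop} {w w' : List Letter}
    (h : ∀ p q φ, p ++ w.flatMap φ ++ q ∈ S.T Q ↔ p ++ w'.flatMap φ ++ q ∈ S.T Q) :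
    synCon {u : Word | u.toList ∈ S.T Q} (FreeMonoid.ofList w) (FreeMonoid.ofList w') := by
  intro p q φ
  have := h p.toList q.toList fun l => (φ l).toList
  simp only [Set.mem_ofPred_eq, FreeMonoid.toList_mul, toList_lift, FreeMonoid.toList_ofList]
  exact this

/-- A variety for which the set of a pattern is stable has a nondistributive lattice of
subvarieties. -/
theorem not_isDistributiveLattice (S : Pattern) (V : MonoidVariety)
    (h : StableSet V {u : Word | u.toList ∈ S.A}) : ¬ IsDistributiveLattice V.Subvarieties := by
  have hint : {u : Word | u.toList ∈ S.T Mark.Q₁} ∩ {u : Word | u.toList ∈ S.T Mark.Q₂} =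
      {u : Word | u.toList ∈ S.T fun m => m.Q₁ ∨ m.Q₂} := by
    rw [← T_inter]; rfl
  refine not_isDistributiveLattice_of_sets V (FreeMonoid.ofList (S.word 1 1))
    (FreeMonoid.ofList (S.word 2 1)) (FreeMonoid.ofList (S.word 1 2))
    {u | u.toList ∈ S.T Mark.Q₁} {u | u.toList ∈ S.T Mark.Q₂}
    (stableSet_T h _) (stableSet_T h _) (synCon_T fun p q φ => mem_T₁_iff)
    (synCon_T fun p q φ => mem_T₂_iff) ?_ ?_ ?_
  · rw [hint]
    exact synCon_T fun p q φ => mem_T_inter_iff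
  · rw [hint]
    exact fun m _ α β _ _ => Iff.rfl
  · rw [hint]
    intro hu
    have hQ : ∀ m : Mark, (m.Q₁ ∨ m.Q₂) → m.IsBound := fun m h =>
      h.elim Mark.Q₁.isBound Mark.Q₂.isBound
    -- The bound `c₁` is tested in the second set, but it occurs three times in `S.word 2 1`.
    have h₁ := (sees_base_of_mem hQ hu (m := .c₁) (Or.inr trivial)).count_bound
    have h₂ : (S.word 2 1).count (S.e .c₁) = 2 := h₁
    rw [count_word_e] at h₂
    simp at h₂

end Pattern

/-! ### The classes of `γ''` -/

theorem sublist_destutter' {l : List Letter} : ∀ {b : Letter} {s : List Letter},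
    s.IsChain (· ≠ ·) → s.Sublist (b :: l) → s.Sublist (l.destutter' (· ≠ ·) b) := by
  induction l with
  | nil => intro b s _ h; simpa using h
  | cons a l ih =>
    intro b s hs h
    by_cases hba : b ≠ a
    · rw [List.destutter'_cons_pos l hba]
      cases h with
      | cons _ h => exact (ih hs h).cons b
      | cons_cons _ h => exact (ih hs.tail h).cons_cons b
    · rw [List.destutter'_cons_neg l hba]
      rw [not_not] at hba
      subst hba
      cases h with
      | cons _ h => exact ih hs h
      | cons_cons _ h =>
        refine ih hs ?_
        cases h with
        | cons _ h => exact h.cons_cons b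
        | cons_cons _ h => simp at hs

/-- Consequently words with equal island sequences have the same scattered subwords without equal
neighbours; this is how `γ` is exploited below. -/
theorem sublist_destutter {l s : List Letter} (hs : s.IsChain (· ≠ ·)) (h : s.Sublist l) :
    s.Sublist (l.destutter (· ≠ ·)) := by
  cases l with
  | nil => simpa using h
  | cons a l => exact sublist_destutter' hs h

/-- Factors of `W` are not identified with anything in the Rees quotient, so they are isoterms. -/
theorem lift_eq_of_mem_factorClosure {W : Set Word} {u v : Word}
    (h : (MonoidVariety.generatedBy (ReesQuotient W)).fic u v) (φ : Letter → Word)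
    (hv : FreeMonoid.lift φ v ∈ factorClosure W) : FreeMonoid.lift φ u = FreeMonoid.lift φ v := by
  have hs : Satisfies (ReesQuotient W) (u, v) := h _ (MonoidVariety.isLeast_generatedBy _).1
  rcases (satisfies_quotient_iff _ _).1 hs φ with h | h
  · exact h
  · exact absurd hv h.2

theorem infix_of_mem_factorClosure {w : Word}
    (h : w ∈ factorClosure ({wordXYXTY, wordYTXYX} : Set Word)) :
    w.toList <:+: [Letter.x, .y 0, .x, .t 0, .y 0] ∨
      w.toList <:+: [Letter.y 0, .t 0, .x, .y 0, .x] := by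
  obtain ⟨u, rfl | rfl, p, s, h⟩ := h
  · exact Or.inl ⟨p.toList, s.toList, congrArg FreeMonoid.toList h.symm⟩
  · exact Or.inr ⟨p.toList, s.toList, congrArg FreeMonoid.toList h.symm⟩

theorem not_square_infix {w : List Letter} (hw : w ≠ []) (h : w ++ w <:+:
      [Letter.x, .y 0, .x, .t 0, .y 0] ∨ w ++ w <:+: [Letter.y 0, .t 0, .x, .y 0, .x]) : False := by
  have hlen : w.length + w.length ≤ 5 := by
    rcases h with h | h
    · simpa using h.length_le
    · simpa using h.length_le
  rcases w with _ | ⟨a, _ | ⟨b, _ | ⟨c, w⟩⟩⟩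
  · exact hw rfl
  · rcases h with ⟨p, s, h⟩ | ⟨p, s, h⟩ <;> have hl := congrArg List.length h <;>
      rcases p with _ | ⟨p₁, _ | ⟨p₂, _ | ⟨p₃, _ | ⟨p₄, p⟩⟩⟩⟩ <;> simp at h hl <;>
      first | omega | grind
  · rcases h with ⟨p, s, h⟩ | ⟨p, s, h⟩ <;> have hl := congrArg List.length h <;>
      rcases p with _ | ⟨p₁, _ | ⟨p₂, p⟩⟩ <;> simp at h hl <;> first | omega | grind
  · simp at hlen; omega

/-- Neither `xyxty` nor `ytxyx` contains a square of a nonempty word, so unless `φ c` is empty, both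
sides fall into the ideal. -/
theorem gammaPP_square (c : Letter) :
    gammaPP (FreeMonoid.ofList [c, c]) (FreeMonoid.ofList [c, c, c]) := by
  refine ⟨⟨?_, ?_⟩, ?_⟩
  · ext l
    simp only [simpleLetters, Set.mem_ofPred_eq, FreeMonoid.toList_ofList, List.count_cons,
      List.count_nil]
    split_ifs <;> simp
  · simp [islandLetters, List.destutter]
  · intro M _ hM
    refine hM _ ?_
    refine (satisfies_quotient_iff _ _).2 fun φ => ?_
    have e₁ : FreeMonoid.lift φ (FreeMonoid.ofList [c, c]) = φ c * φ c := by
      have : (FreeMonoid.ofList [c, c] : Word) = FreeMonoid.of c * FreeMonoid.of c := rfl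
      rw [this, map_mul, FreeMonoid.lift_eval_of]
    have e₂ : FreeMonoid.lift φ (FreeMonoid.ofList [c, c, c]) = φ c * φ c * φ c := by
      have : (FreeMonoid.ofList [c, c, c] : Word) =
        FreeMonoid.of c * FreeMonoid.of c * FreeMonoid.of c := rfl
      rw [this, map_mul, map_mul, FreeMonoid.lift_eval_of]
    simp only [e₁, e₂]
    by_cases hc : φ c = 1
    · rw [hc]; exact Or.inl rfl
    · have hne : (φ c).toList ≠ [] := hc
      have hn : ∀ s, φ c * φ c * s ∉ factorClosure ({wordXYXTY, wordYTXYX} : Set Word) := by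
        intro s hs
        refine not_square_infix hne ?_
        have hi : (φ c).toList ++ (φ c).toList <:+: (φ c * φ c * s).toList :=
          ⟨[], s.toList, rfl⟩
        rcases infix_of_mem_factorClosure hs with h | h
        · exact Or.inl (hi.trans h)
        · exact Or.inr (hi.trans h)
      exact Or.inr ⟨by simpa using hn 1, hn _⟩

theorem gammaPP_exponent (w₁ w₂ : List Letter) (c : Letter) :
    gammaPP (FreeMonoid.ofList (w₁ ++ c :: c :: w₂)) (FreeMonoid.ofList (w₁ ++ c :: c :: c :: w₂)) :=
  have h := gammaPP.mul (gammaPP.refl (FreeMonoid.ofList w₁))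
    (gammaPP.mul (gammaPP_square c) (gammaPP.refl (FreeMonoid.ofList w₂)))
  h

/-! ### The class of the word of a frame -/

namespace Frame

variable (F : Frame)

/-- The word of the frame. -/
def wd : List Letter := F.Lf ++ .x :: (F.za :: (F.M₀ ++ [F.zc])) ++ .x :: F.Rt

theorem toList_lift_ofList (φ : Letter → List Letter) (w : List Letter) :
    (FreeMonoid.lift (fun l => FreeMonoid.ofList (φ l)) (FreeMonoid.ofList w)).toList =
      w.flatMap φ := by
  rw [Pattern.toList_lift]; rfl

variable {F} {b : List Letter}

/-- The substitution that reads `z`, `t` as `y`, `t` and forgets the other letters but `x`. -/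
noncomputable def proj (z t l : Letter) : List Letter :=
  if l = z then [.y 0] else if l = t then [.t 0] else if l = .x then [.x] else []

theorem flatMap_proj_eq_nil {z t : Letter} {v : List Letter} (hz : z ∉ v) (ht : t ∉ v)
    (hx : .x ∉ v) : v.flatMap (proj z t) = [] := by
  rw [List.flatMap_eq_nil_iff]
  intro l hl
  have h₁ : l ≠ z := fun h => hz (h ▸ hl)
  have h₂ : l ≠ t := fun h => ht (h ▸ hl)
  have h₃ : l ≠ .x := fun h => hx (h ▸ hl)
  simp [proj, h₁, h₂, h₃]

theorem x_notMem_md : Letter.x ∉ F.za :: (F.M₀ ++ [F.zc]) := by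
  intro h
  simp only [List.mem_cons, List.mem_append, List.not_mem_nil, or_false] at h
  have h₁ := F.isZ_za
  have h₂ := F.isZ_zc
  rcases h with h | h | h
  · rw [← h] at h₁; simp [Letter.isZ] at h₁
  · rcases F.mem_M₀ _ h with h | h <;> simp [Letter.isZ, Letter.isY] at h
  · rw [← h] at h₂; simp [Letter.isZ] at h₂

theorem x_notMem_Lf : Letter.x ∉ F.Lf := fun h => by
  rcases F.mem_Lf _ h with h | h <;> simp [Letter.isT, Letter.isZ] at h

theorem x_notMem_Rt : Letter.x ∉ F.Rt := fun h => by
  rcases F.mem_Rt _ h with h | h <;> simp [Letter.isT, Letter.isZ] at h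

theorem isT_notMem_md {t : Letter} (ht : t.isT = true) : t ∉ F.za :: (F.M₀ ++ [F.zc]) := by
  intro h
  simp only [List.mem_cons, List.mem_append, List.not_mem_nil, or_false] at h
  rcases h with h | h | h
  · exact Letter.ne_of_isT_of_isZ ht F.isZ_za h
  · rcases F.mem_M₀ _ h with h | h
    · exact Letter.ne_of_isT_of_isZ ht h rfl
    · exact Letter.ne_of_isT_of_isY ht h rfl
  · exact Letter.ne_of_isT_of_isZ ht F.isZ_zc h

/-- The letter `t` is the last one of `Lf` or the first one of `Rt`, according to the side of the
outer `z`. It separates the two `z`, and erasing the rest leaves `ytxyx` or `xyxty`. -/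
theorem exists_flatMap_proj {z : Letter} (hz : z.isZ = true)
    (h : z ∈ F.za :: (F.M₀ ++ [F.zc])) : ∃ t : Letter, t ≠ z ∧ t.isT = true ∧
      (F.wd.flatMap (proj z t) = [.y 0, .t 0, .x, .y 0, .x] ∨
        F.wd.flatMap (proj z t) = [.x, .y 0, .x, .t 0, .y 0]) := by
  obtain ⟨c₁, c₂⟩ := F.count_Z z hz (Or.inr (Or.inr h))
  obtain ⟨M₁, M₂, hM⟩ := List.append_of_mem h
  have hzx : z ≠ .x := by rintro rfl; simp [Letter.isZ] at hz
  have pz : ∀ t, proj z t z = [.y 0] := fun t => by simp [proj]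
  have px : ∀ t, t ≠ .x → proj z t .x = [.x] := fun t ht => by simp [proj, hzx.symm, ht.symm]
  have pt : ∀ t, t ≠ z → proj z t t = [.t 0] := fun t ht => by simp [proj, ht]
  have hxM := x_notMem_md (F := F)
  have htM : ∀ t : Letter, t.isT = true → t ∉ F.za :: (F.M₀ ++ [F.zc]) := fun t ht =>
    isT_notMem_md ht
  unfold wd
  generalize F.za :: (F.M₀ ++ [F.zc]) = D at *
  have hmd : ∀ t : Letter, t.isT = true → D.flatMap (proj z t) = [.y 0] := by
    intro t ht
    have htM := htM t ht
    rw [hM] at c₂ hxM htM ⊢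
    rw [List.count_append, List.count_cons_self] at c₂
    simp only [List.mem_append, List.mem_cons, not_or] at hxM htM
    rw [List.flatMap_append, List.flatMap_cons,
      flatMap_proj_eq_nil (List.count_eq_zero.1 (by omega)) htM.1 hxM.1,
      flatMap_proj_eq_nil (List.count_eq_zero.1 (by omega)) htM.2.2 hxM.2.2, pz]
    rfl
  rcases Nat.eq_zero_or_pos (F.Lf.count z) with h0 | h0
  · have hzR : z ∈ F.Rt := List.one_le_count_iff.1 (by omega)
    obtain ⟨t, R', hR⟩ := List.exists_cons_of_ne_nil (List.ne_nil_of_mem hzR)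
    have hhead := F.head_Rt t (by rw [hR]; rfl)
    have hzt : t ≠ z := Letter.ne_of_isT_of_isZ hhead hz
    have htx : t ≠ .x := by rintro rfl; simp [Letter.isT] at hhead
    have ct := F.count_T t hhead
    refine ⟨t, hzt, hhead, Or.inr ?_⟩
    have hxR := x_notMem_Rt (F := F)
    rw [hR] at hzR c₁ ct hxR
    have hzR' : z ∈ R' := (List.mem_cons.1 hzR).resolve_left hzt.symm
    obtain ⟨R₁, R₂, rfl⟩ := List.append_of_mem hzR'
    simp only [List.count_cons, List.count_append, beq_iff_eq, hzt, hzt.symm, if_false,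
      if_true] at c₁ ct
    simp only [List.mem_append, List.mem_cons, not_or] at hxR
    rw [List.flatMap_append, List.flatMap_append, List.flatMap_cons, List.flatMap_cons,
      hmd t hhead, hR, List.flatMap_cons, List.flatMap_append, List.flatMap_cons, px t htx,
      pt t hzt, pz,
      flatMap_proj_eq_nil (v := F.Lf) (List.count_eq_zero.1 (by omega))
        (List.count_eq_zero.1 (by omega)) x_notMem_Lf,
      flatMap_proj_eq_nil (v := R₁) (List.count_eq_zero.1 (by omega))
        (List.count_eq_zero.1 (by omega)) hxR.2.1,
      flatMap_proj_eq_nil (v := R₂) (List.count_eq_zero.1 (by omega))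
        (List.count_eq_zero.1 (by omega)) hxR.2.2.2]
    rfl
  · have hzL : z ∈ F.Lf := List.one_le_count_iff.1 h0
    have hne : F.Lf ≠ [] := List.ne_nil_of_mem hzL
    have hlast := F.last_Lf _ (List.getLast?_eq_some_getLast hne)
    have hdec := List.dropLast_append_getLast hne
    generalize F.Lf.getLast hne = t at *
    generalize F.Lf.dropLast = L' at *
    have hzt : t ≠ z := Letter.ne_of_isT_of_isZ hlast hz
    have htx : t ≠ .x := by rintro rfl; simp [Letter.isT] at hlast
    have ct := F.count_T t hlast
    refine ⟨t, hzt, hlast, Or.inl ?_⟩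
    have hxL := x_notMem_Lf (F := F)
    rw [← hdec] at hzL c₁ ct hxL
    have hzL' : z ∈ L' := by
      rcases List.mem_append.1 hzL with h | h
      · exact h
      · simp at h; exact absurd h.symm hzt
    obtain ⟨R₁, R₂, rfl⟩ := List.append_of_mem hzL'
    simp only [List.count_cons, List.count_append, List.count_nil, beq_iff_eq, hzt, hzt.symm,
      if_false, if_true] at c₁ ct
    simp only [List.mem_append, List.mem_cons, not_or] at hxL
    rw [List.flatMap_append, List.flatMap_append, List.flatMap_cons, List.flatMap_cons,
      hmd t hlast, ← hdec, List.flatMap_append, List.flatMap_append, List.flatMap_cons,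
      List.flatMap_cons, List.flatMap_nil, px t htx, pt t hzt, pz,
      flatMap_proj_eq_nil (v := F.Rt) (List.count_eq_zero.1 (by omega))
        (List.count_eq_zero.1 (by omega)) x_notMem_Rt,
      flatMap_proj_eq_nil (v := R₁) (List.count_eq_zero.1 (by omega))
        (List.count_eq_zero.1 (by omega)) hxL.1.1,
      flatMap_proj_eq_nil (v := R₂) (List.count_eq_zero.1 (by omega))
        (List.count_eq_zero.1 (by omega)) hxL.1.2.2]
    rfl

/-- The class of the word of a frame. -/
def cls (F : Frame) : Set (List Letter) :=
  {b | gammaPP (FreeMonoid.ofList b) (FreeMonoid.ofList F.wd)}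

/-- The congruence `γ` would permit other exponents; the isoterms `xyxty` and `ytxyx` fix the
numbers of `z` and `x`. -/
theorem count_of_mem_cls (hb : b ∈ F.cls) {z : Letter} (hz : z.isZ = true)
    (h : z ∈ F.za :: (F.M₀ ++ [F.zc])) : b.count z = 2 ∧ b.count .x = 2 := by
  obtain ⟨t, htz, htT, hp⟩ := exists_flatMap_proj hz h
  have hzx : z ≠ .x := by rintro rfl; simp [Letter.isZ] at hz
  have htx : t ≠ .x := by rintro rfl; simp [Letter.isT] at htT
  have hf : FreeMonoid.lift (fun l => FreeMonoid.ofList (proj z t l)) (FreeMonoid.ofList F.wd) ∈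
      factorClosure ({wordXYXTY, wordYTXYX} : Set Word) := by
    rcases hp with hp | hp
    · refine ⟨wordYTXYX, by simp, 1, 1, ?_⟩
      rw [one_mul, mul_one]
      exact (hp.symm.trans (toList_lift_ofList (proj z t) F.wd).symm)
    · refine ⟨wordXYXTY, by simp, 1, 1, ?_⟩
      rw [one_mul, mul_one]
      exact (hp.symm.trans (toList_lift_ofList (proj z t) F.wd).symm)
  have heq := congrArg FreeMonoid.toList
    (lift_eq_of_mem_factorClosure hb.2 (fun l => FreeMonoid.ofList (proj z t l)) hf)
  rw [toList_lift_ofList, toList_lift_ofList] at heq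
  have tz : ∀ d, (proj z t d).count (.y 0) = if d = z then 1 else 0 := by
    intro d; unfold proj; split_ifs <;> simp
  have tx : ∀ d, (proj z t d).count .x = if d = .x then 1 else 0 := by
    intro d
    unfold proj
    by_cases h₁ : d = z
    · simp [h₁, hzx]
    · by_cases h₂ : d = t
      · simp [h₂, htz, htx]
      · by_cases h₃ : d = .x <;> simp [h₁, h₂, h₃, hzx.symm, htx.symm]
  rw [← count_flatMap_of_count fun d (_ : d ∈ b) => tz d,
    ← count_flatMap_of_count fun d (_ : d ∈ b) => tx d, heq]
  rcases hp with hp | hp <;> rw [hp] <;> simp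

theorem mem_iff_of_mem_cls (hb : b ∈ F.cls) (l : Letter) : l ∈ b ↔ l ∈ F.wd := by
  have h : b.destutter (· ≠ ·) = F.wd.destutter (· ≠ ·) := hb.1.2
  rw [← GammaAux.mem_destutter, h, GammaAux.mem_destutter]

theorem sublist_of_mem_cls (hb : b ∈ F.cls) {s : List Letter} (hs : s.IsChain (· ≠ ·))
    (h : s.Sublist b) : s.Sublist F.wd := by
  have h₁ : b.destutter (· ≠ ·) = F.wd.destutter (· ≠ ·) := hb.1.2
  have := sublist_destutter hs h
  rw [h₁] at this
  exact this.trans (List.destutter_sublist _ _)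

theorem sublist_of_mem_cls' (hb : b ∈ F.cls) {s : List Letter} (hs : s.IsChain (· ≠ ·))
    (h : s.Sublist F.wd) : s.Sublist b := by
  have h₁ : b.destutter (· ≠ ·) = F.wd.destutter (· ≠ ·) := hb.1.2
  have := sublist_destutter hs h
  rw [← h₁] at this
  exact this.trans (List.destutter_sublist _ _)

end Frame

namespace Frame

variable {F : Frame} {b : List Letter}

theorem isY_eq_false_of_isZ {l : Letter} (h : l.isZ = true) : l.isY = false := by
  cases l <;> simp_all [Letter.isZ, Letter.isY]

theorem isY_eq_false_of_isT {l : Letter} (h : l.isT = true) : l.isY = false := by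
  cases l <;> simp_all [Letter.isT, Letter.isY]

theorem isY_eq_false_of_mem {l : Letter} (h : l ∈ F.Lf ∨ l ∈ F.Rt) : l.isY = false := by
  rcases h with h | h
  · rcases F.mem_Lf l h with h | h
    · exact isY_eq_false_of_isT h
    · exact isY_eq_false_of_isZ h
  · rcases F.mem_Rt l h with h | h
    · exact isY_eq_false_of_isT h
    · exact isY_eq_false_of_isZ h

theorem isZ_of_mem_md {l : Letter} (h : l ∈ F.za :: (F.M₀ ++ [F.zc])) (hY : l.isY = false) :
    l.isZ = true := by
  simp only [List.mem_cons, List.mem_append, List.not_mem_nil, or_false] at h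
  rcases h with rfl | h | rfl
  · exact F.isZ_za
  · rcases F.mem_M₀ l h with h | h
    · exact h
    · simp [h] at hY
  · exact F.isZ_zc

theorem count_wd (l : Letter) : F.wd.count l = F.Lf.count l + F.Rt.count l +
    (F.za :: (F.M₀ ++ [F.zc])).count l + if l = .x then 2 else 0 := by
  rw [wd, List.count_append, List.count_append, List.count_cons (a := l) (b := .x),
    List.count_cons (a := l) (b := .x)]
  by_cases h : l = .x
  · subst h; simp; omega
  · simp [h, Ne.symm h]; omega

theorem mem_wd {l : Letter} :
    l ∈ F.wd ↔ l ∈ F.Lf ∨ l ∈ F.Rt ∨ l ∈ F.za :: (F.M₀ ++ [F.zc]) ∨ l = .x := by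
  rw [wd]; simp only [List.mem_append, List.mem_cons]; tauto

theorem count_eq_of_mem_cls (hb : b ∈ F.cls) {l : Letter} (hl : l.isY = false) :
    b.count l = F.wd.count l := by
  by_cases hm : l ∈ F.wd
  · rw [count_wd]
    have hZ : l.isZ = true → l ∈ F.Lf ∨ l ∈ F.Rt ∨ l ∈ F.za :: (F.M₀ ++ [F.zc]) →
        b.count l = F.Lf.count l + F.Rt.count l + (F.za :: (F.M₀ ++ [F.zc])).count l +
          if l = .x then 2 else 0 := by
      intro hz h
      obtain ⟨c₁, c₂⟩ := F.count_Z l hz h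
      have hlx : l ≠ .x := by rintro rfl; simp [Letter.isZ] at hz
      have := (count_of_mem_cls hb hz (List.one_le_count_iff.1 c₂.ge)).1
      rw [if_neg hlx]
      omega
    have hT : l.isT = true → l ∈ F.Lf ∨ l ∈ F.Rt →
        b.count l = F.Lf.count l + F.Rt.count l + (F.za :: (F.M₀ ++ [F.zc])).count l +
          if l = .x then 2 else 0 := by
      intro ht h
      have c₁ := F.count_T l ht
      have c₂ := List.count_eq_zero.2 (isT_notMem_md (F := F) ht)
      have hlx : l ≠ .x := by rintro rfl; simp [Letter.isT] at ht
      have c₃ : 1 ≤ F.Lf.count l + F.Rt.count l := by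
        rcases h with h | h
        · have := List.one_le_count_iff.2 h; omega
        · have := List.one_le_count_iff.2 h; omega
      have hw : F.wd.count l = 1 := by rw [count_wd, if_neg hlx]; omega
      have hs : simpleLetters (FreeMonoid.ofList b) = simpleLetters (FreeMonoid.ofList F.wd) :=
        hb.1.1
      have : l ∈ simpleLetters (FreeMonoid.ofList b) := by rw [hs]; exact hw
      have : b.count l = 1 := this
      rw [if_neg hlx]
      omega
    rcases mem_wd.1 hm with h | h | h | rfl
    · rcases F.mem_Lf l h with h' | h'
      · exact hT h' (Or.inl h)
      · exact hZ h' (Or.inl h)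
    · rcases F.mem_Rt l h with h' | h'
      · exact hT h' (Or.inr h)
      · exact hZ h' (Or.inr (Or.inl h))
    · exact hZ (isZ_of_mem_md h hl) (Or.inr (Or.inr h))
    · have := (count_of_mem_cls hb F.isZ_za (by simp)).2
      rw [this, List.count_eq_zero.2 x_notMem_Lf, List.count_eq_zero.2 x_notMem_Rt,
        List.count_eq_zero.2 x_notMem_md]
      simp
  · rw [List.count_eq_zero.2 hm, List.count_eq_zero.2 (mt (mem_iff_of_mem_cls hb l).1 hm)]

theorem filter_eq_self {v : List Letter} (h : ∀ l ∈ v, l.isY = false) :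
    v.filter (fun l => !l.isY) = v :=
  List.filter_eq_self.2 fun l hl => by simp [h l hl]

theorem filter_wd : F.wd.filter (fun l => !l.isY) =
    F.Lf ++ .x :: (F.za :: (F.M₀ ++ [F.zc])).filter (fun l => !l.isY) ++ .x :: F.Rt := by
  have h₁ := filter_eq_self fun l (hl : l ∈ F.Lf) => isY_eq_false_of_mem (Or.inl hl)
  have h₂ := filter_eq_self fun l (hl : l ∈ F.Rt) => isY_eq_false_of_mem (Or.inr hl)
  rw [wd, List.filter_append, List.filter_append, h₁, List.filter_cons_of_pos (a := Letter.x) (by rfl),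
    List.filter_cons_of_pos (a := Letter.x) (by rfl), h₂]

theorem isChain_filter_wd : (F.wd.filter (fun l => !l.isY)).IsChain (· ≠ ·) := by
  have nL : F.Lf.Nodup := List.nodup_iff_count_le_one.2 fun l => by
    by_cases h : l ∈ F.Lf
    · rcases F.mem_Lf l h with h' | h'
      · have := F.count_T l h'; omega
      · have := F.count_Z l h' (Or.inl h); omega
    · rw [List.count_eq_zero.2 h]; omega
  have nR : F.Rt.Nodup := List.nodup_iff_count_le_one.2 fun l => by
    by_cases h : l ∈ F.Rt
    · rcases F.mem_Rt l h with h' | h'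
      · have := F.count_T l h'; omega
      · have := F.count_Z l h' (Or.inr (Or.inl h)); omega
    · rw [List.count_eq_zero.2 h]; omega
  set D := (F.za :: (F.M₀ ++ [F.zc])).filter (fun l => !l.isY) with hD
  have xD : Letter.x ∉ D := fun h => x_notMem_md (List.mem_filter.1 h).1
  have nD : D.Nodup := List.nodup_iff_count_le_one.2 fun l => by
    by_cases h : l ∈ D
    · obtain ⟨h₁, h₂⟩ := List.mem_filter.1 h
      have hz := isZ_of_mem_md h₁ (by simpa using h₂)
      have := (F.count_Z l hz (Or.inr (Or.inr h₁))).2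
      rw [hD, List.count_filter (by simpa using h₂)]
      exact this.le
    · rw [List.count_eq_zero.2 h]; omega
  have hDne : D ≠ [] := List.ne_nil_of_mem (a := F.za)
    (List.mem_filter.2 ⟨by simp, by simp [isY_eq_false_of_isZ F.isZ_za]⟩)
  have c₂ : (Letter.x :: D).Nodup := List.nodup_cons.2 ⟨xD, nD⟩
  have c₃ : (Letter.x :: F.Rt).Nodup := List.nodup_cons.2 ⟨x_notMem_Rt, nR⟩
  rw [filter_wd, ← hD, List.isChain_append, List.isChain_append]
  refine ⟨⟨List.Pairwise.isChain nL, List.Pairwise.isChain c₂, ?_⟩, List.Pairwise.isChain c₃, ?_⟩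
  · intro a ha c hc
    obtain rfl : c = .x := by simpa using hc.symm
    rintro rfl
    exact x_notMem_Lf (List.mem_of_mem_getLast? ha)
  · intro a ha c hc
    obtain rfl : c = .x := by simpa using hc.symm
    rintro rfl
    rw [List.getLast?_append_of_ne_nil _ (by simp), List.getLast?_cons,
      List.getLast?_eq_some_getLast hDne] at ha
    simp only [Option.getD_some, Option.mem_def, Option.some.injEq] at ha
    exact xD (ha ▸ List.getLast_mem hDne)

/-- Without the `y`, the word of the frame has no equal neighbours, so it remains a scattered
subword of `b`. Equal numbers of occurrences leave no room for more. -/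
theorem filter_eq_of_mem_cls (hb : b ∈ F.cls) :
    b.filter (fun l => !l.isY) = F.wd.filter (fun l => !l.isY) := by
  have hs : (F.wd.filter (fun l => !l.isY)).Sublist (b.filter (fun l => !l.isY)) := by
    have := (sublist_of_mem_cls' hb isChain_filter_wd List.filter_sublist).filter
      (fun l => !l.isY)
    simpa [List.filter_filter] using this
  have hp : (F.wd.filter (fun l => !l.isY)).Perm (b.filter (fun l => !l.isY)) := by
    rw [List.perm_iff_count]
    intro l
    by_cases hl : l.isY = true
    · rw [List.count_eq_zero.2, List.count_eq_zero.2] <;> simp [List.mem_filter, hl]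
    · have hl' : l.isY = false := by simpa using hl
      rw [List.count_filter (by simp [hl']), List.count_filter (by simp [hl']),
        count_eq_of_mem_cls hb hl']
  exact (hs.eq_of_length hp.length_eq).symm

theorem sublist_right {P Q : List Letter} {y : Letter} {s : List Letter} (hy : y ∉ P)
    (h : (y :: s).Sublist (P ++ Q)) : (y :: s).Sublist Q := by
  obtain ⟨l₁, l₂, h₁, h₂, h₃⟩ := List.sublist_append_iff.1 h
  cases l₁ with
  | nil => rw [h₁]; exact h₃
  | cons a l₁ =>
    rw [List.cons_append, List.cons.injEq] at h₁
    exact absurd (h₂.subset (by simp [h₁.1])) hy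

theorem sublist_left {P Q : List Letter} {y : Letter} {s : List Letter} (hy : y ∉ Q)
    (h : (s ++ [y]).Sublist (P ++ Q)) : (s ++ [y]).Sublist P := by
  have h' := List.reverse_sublist.2 h
  rw [List.reverse_append, List.reverse_append] at h'
  have := sublist_right (by simpa using hy) h'
  rw [← List.reverse_sublist]
  simpa using this

theorem form_of_mem_cls (hb : b ∈ F.cls) : ∃ M', b = F.Lf ++ .x :: M' ++ .x :: F.Rt ∧
    M'.filter (fun l => !l.isY) =
      (F.za :: (F.M₀ ++ [F.zc])).filter (fun l => !l.isY) := by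
  have hx := (count_of_mem_cls hb F.isZ_za (by simp)).2
  have hf := filter_eq_of_mem_cls hb
  obtain ⟨B₁, B₂, B₃, rfl, k₁, k₂, k₃⟩ := exists_split_of_count_two hx
  rw [filter_wd, List.filter_append, List.filter_append, List.filter_cons_of_pos (by rfl),
    List.filter_cons_of_pos (by rfl)] at hf
  obtain ⟨e₁, e₂, e₃⟩ := split_unique hf (fun h => k₁ (List.mem_filter.1 h).1)
    (fun h => k₂ (List.mem_filter.1 h).1) x_notMem_Lf
    (fun h => x_notMem_md (List.mem_filter.1 h).1)
  have hza : F.za ∈ B₂ := by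
    have : F.za ∈ B₂.filter (fun l => !l.isY) := by
      rw [e₂]; exact List.mem_filter.2 ⟨by simp, by simp [isY_eq_false_of_isZ F.isZ_za]⟩
    exact (List.mem_filter.1 this).1
  have hzx : F.za ≠ .x := by
    intro h; have := F.isZ_za; rw [h] at this; simp [Letter.isZ] at this
  have hzY := isY_eq_false_of_isZ F.isZ_za
  have mid : [Letter.x, F.za, .x].Sublist (.x :: B₂ ++ [.x]) := by
    refine List.Sublist.cons_cons _ ?_
    exact List.Sublist.append (l₁ := [F.za]) (List.singleton_sublist.2 hza) (List.Sublist.refl _)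
  -- A `y` before the first `x` would give the subword `y x za x`, but in the word of the frame only
  -- one `x` follows a `y`. The `za` is inserted to avoid equal neighbours.
  have n₁ : ∀ l ∈ B₁, l.isY = false := by
    intro y hy
    by_contra hY
    have hY : y.isY = true := by simpa using hY
    have hyx : y ≠ .x := by rintro rfl; simp [Letter.isY] at hY
    have hs : [y, .x, F.za, .x].Sublist (B₁ ++ Letter.x :: B₂ ++ Letter.x :: B₃) := by
      have h₁ := List.Sublist.append (List.singleton_sublist.2 hy) mid
      have h₂ : (B₁ ++ (Letter.x :: B₂ ++ [Letter.x])).Sublist (B₁ ++ Letter.x :: B₂ ++ Letter.x :: B₃) := by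
        have : B₁ ++ Letter.x :: B₂ ++ Letter.x :: B₃ = (B₁ ++ (Letter.x :: B₂ ++ [Letter.x])) ++ B₃ := by simp
        rw [this]; exact List.sublist_append_left _ _
      exact h₁.trans h₂
    have hs' := sublist_of_mem_cls hb (by simp [hyx, hzx, hzx.symm]) hs
    rw [wd, List.append_assoc] at hs'
    have h₃ := sublist_right (fun h => by
      simp [isY_eq_false_of_mem (Or.inl h)] at hY) hs'
    rw [List.cons_append] at h₃
    have h₄ : [y, .x, F.za, .x].Sublist ((F.za :: (F.M₀ ++ [F.zc])) ++ .x :: F.Rt) :=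
      sublist_right (P := [.x]) (by simpa using hyx) h₃
    have h₅ := h₄.count_le .x
    rw [List.count_append, List.count_eq_zero.2 x_notMem_md, List.count_cons_self,
      List.count_eq_zero.2 x_notMem_Rt] at h₅
    simp [hyx, hzx] at h₅
  have n₃ : ∀ l ∈ B₃, l.isY = false := by
    intro y hy
    by_contra hY
    have hY : y.isY = true := by simpa using hY
    have hyx : y ≠ .x := by rintro rfl; simp [Letter.isY] at hY
    have hs : [Letter.x, F.za, .x, y].Sublist (B₁ ++ Letter.x :: B₂ ++ Letter.x :: B₃) := by
      have h₁ := List.Sublist.append mid (List.singleton_sublist.2 hy)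
      have h₂ : ((Letter.x :: B₂ ++ [Letter.x]) ++ B₃).Sublist (B₁ ++ Letter.x :: B₂ ++ Letter.x :: B₃) := by
        have : B₁ ++ Letter.x :: B₂ ++ Letter.x :: B₃ = B₁ ++ ((Letter.x :: B₂ ++ [Letter.x]) ++ B₃) := by simp
        rw [this]; exact List.sublist_append_right _ _
      exact h₁.trans h₂
    have hs' := sublist_of_mem_cls hb (by simp [hyx.symm, hzx, hzx.symm]) hs
    rw [wd] at hs'
    have hyR : y ∉ Letter.x :: F.Rt := by
      intro h
      rcases List.mem_cons.1 h with h | h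
      · exact hyx h
      · simp [isY_eq_false_of_mem (Or.inr h)] at hY
    have h₄ : [Letter.x, F.za, .x, y].Sublist (F.Lf ++ .x :: (F.za :: (F.M₀ ++ [F.zc]))) :=
      sublist_left (s := [.x, F.za, .x]) hyR hs'
    have h₅ := h₄.count_le .x
    have h₆ : (F.Lf ++ Letter.x :: (F.za :: (F.M₀ ++ [F.zc]))).count .x = 1 := by
      rw [List.count_append, List.count_eq_zero.2 x_notMem_Lf, List.count_cons_self,
        List.count_eq_zero.2 x_notMem_md]
    rw [h₆] at h₅
    simp [hyx, hzx] at h₅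
  rw [filter_eq_self n₁] at e₁
  rw [filter_eq_self n₃] at e₃
  exact ⟨B₂, by rw [e₁, e₃], e₂⟩

theorem contiguous_of_mem_cls
    (hc : ∀ y l : Letter, y.isY = true → l ≠ y → ¬ [y, l, y].Sublist F.M₀)
    {y : Letter} {B₁ B₂ B₃ : List Letter} (hy : y.isY = true)
    (hb : B₁ ++ y :: B₂ ++ y :: B₃ ∈ F.cls) : ∀ l ∈ B₂, l = y := by
  intro l hl
  by_contra hne
  have hyx : y ≠ .x := by rintro rfl; simp [Letter.isY] at hy
  have hs : [y, l, y].Sublist (B₁ ++ y :: B₂ ++ y :: B₃) := by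
    have h₁ : [y, l, y].Sublist (y :: (B₂ ++ y :: B₃)) :=
      (List.Sublist.append (l₁ := [l]) (List.singleton_sublist.2 hl)
        ((List.nil_sublist B₃).cons_cons y)).cons_cons y
    rw [List.append_assoc]
    exact h₁.trans (List.sublist_append_right _ _)
  have hs' := sublist_of_mem_cls hb (by simp [hne, Ne.symm hne]) hs
  have hyL : y ∉ F.Lf ++ [.x, F.za] := by
    intro h
    simp only [List.mem_append, List.mem_cons, List.not_mem_nil, or_false] at h
    rcases h with h | h | rfl
    · simp [isY_eq_false_of_mem (Or.inl h)] at hy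
    · exact hyx h
    · simp [isY_eq_false_of_isZ F.isZ_za] at hy
  have hyR : y ∉ F.zc :: .x :: F.Rt := by
    intro h
    simp only [List.mem_cons] at h
    rcases h with rfl | h | h
    · simp [isY_eq_false_of_isZ F.isZ_zc] at hy
    · exact hyx h
    · simp [isY_eq_false_of_mem (Or.inr h)] at hy
  have e : F.wd = (F.Lf ++ [.x, F.za]) ++ (F.M₀ ++ (F.zc :: .x :: F.Rt)) := by simp [wd]
  rw [e] at hs'
  exact hc y l hy hne (sublist_left (s := [y, l]) hyR (sublist_right hyL hs'))

/-- A numbering of the marks. -/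
def _root_.Mark.code : Mark → ℕ
  | .g => 0
  | .h => 1
  | .k => 2
  | .c₁ => 3
  | .g' => 4
  | .c₂ => 5
  | .A₁ => 6
  | .A₂ => 7
  | .A₃ => 8
  | .C₁ => 9
  | .C₂ => 10
  | .C₃ => 11

theorem _root_.Mark.code_injective : Function.Injective Mark.code := by
  intro a b h
  cases a <;> cases b <;> first | rfl | (simp [Mark.code] at h)

theorem exists_fresh (v : List Letter) : ∃ N : ℕ, ∀ i, N ≤ i → Letter.y i ∉ v := by
  induction v with
  | nil => exact ⟨0, fun i _ => by simp⟩
  | cons l v ih =>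
    obtain ⟨N, hN⟩ := ih
    cases l with
    | y j =>
      refine ⟨max N (j + 1), fun i hi => ?_⟩
      simp only [List.mem_cons, Letter.y.injEq, not_or]
      exact ⟨by omega, hN i (by omega)⟩
    | _ => exact ⟨N, fun i hi => by simp [hN i hi]⟩

/-- A variety for which a suitable set containing the word of a frame is stable has a
nondistributive lattice of subvarieties. -/
theorem not_isDistributiveLattice (F : Frame) (A : Set (List Letter)) (mem_A : F.wd ∈ A)
    (form_A : ∀ b ∈ A, ∃ M', b = F.Lf ++ .x :: M' ++ .x :: F.Rt ∧
      M'.filter (fun l => !l.isY) = (F.za :: (F.M₀ ++ [F.zc])).filter (fun l => !l.isY))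
    (contiguous_A : ∀ (y : Letter) (B₁ B₂ B₃ : List Letter), y.isY = true →
      B₁ ++ y :: B₂ ++ y :: B₃ ∈ A → ∀ l ∈ B₂, l = y)
    (exponent_A : ∀ (y : Letter) (w₁ w₂ : List Letter), y.isY = true →
      (w₁ ++ y :: y :: w₂ ∈ A ↔ w₁ ++ y :: y :: y :: w₂ ∈ A))
    (V : MonoidVariety) (h : StableSet V {u : Word | u.toList ∈ A}) :
    ¬ IsDistributiveLattice V.Subvarieties := by
  -- The auxiliary letters are letters `y` with numbers from `N` on, which do not occur in `M₀`.
  obtain ⟨N, hN⟩ := exists_fresh F.M₀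
  let e : Mark → Letter := fun m => .y (N + m.code)
  exact Pattern.not_isDistributiveLattice
    { F with
      A := A
      e := e
      LA := [F.za, e .A₁, e .A₂, e .A₃]
      LC := [F.zc, e .C₁, e .C₂, e .C₃]
      mem_A := mem_A
      form_A := form_A
      contiguous_A := contiguous_A
      exponent_A := exponent_A
      inj_e := fun a b hab => Mark.code_injective (by
        have : N + a.code = N + b.code := Letter.y.inj hab
        omega)
      isY_e := fun _ => rfl
      notMem_e := fun m => hN _ (by omega)
      perm_LA := List.Perm.refl _
      perm_LC := List.Perm.refl _ } V h

theorem not_isDistributiveLattice_sapirVariety (F : Frame)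
    (hc : ∀ y l : Letter, y.isY = true → l ≠ y → ¬ [y, l, y].Sublist F.M₀) :
    ¬ IsDistributiveLattice
      (sapirVariety gammaPP (conClass gammaPP (FreeMonoid.ofList F.wd))).Subvarieties :=
  F.not_isDistributiveLattice F.cls (gammaPP.refl _) (fun _ hb => form_of_mem_cls hb)
    (fun _ _ _ _ hy hb => contiguous_of_mem_cls hc hy hb)
    (fun y w₁ w₂ _ => ⟨fun h => gammaPP.trans (gammaPP.symm (gammaPP_exponent w₁ w₂ y)) h,
      fun h => gammaPP.trans (gammaPP_exponent w₁ w₂ y) h⟩)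
    _ (stableSet_conClass gammaPP (FreeMonoid.ofList F.wd))

end Frame

/-! ### The frames of the words `aWord` -/

/-- The index of a letter. -/
def Letter.index (l : Letter) : ℕ := l.code.2

/-- The factors of the part of `aWord` to the left of the letters `x`. -/
def blockL (hp : ℕ → Bool) (j : ℕ) : List Letter :=
  .z j :: .t j :: if hp j then [.zp j, .tp j] else []

/-- The factors of the part of `aWord` to the right of the letters `x`. -/
def blockR (hp : ℕ → Bool) (j : ℕ) : List Letter :=
  .t j :: .z j :: if hp j then [.tp j, .zp j] else []

/-- The factors of the part of `aWord` between the letters `x`. -/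
def blockM (hp : ℕ → Bool) (hy : Bool) (j : ℕ) : List Letter :=
  .z j :: ((if hy then [.y j, .y j] else []) ++ if hp j then [.zp j] else [])

/-- The part to the left of the letters `x`. -/
def leftPart (n : ℕ) (hp : ℕ → Bool) : List Letter :=
  (List.finRange n).flatMap fun i : Fin n => blockL hp i

/-- The part to the right of the letters `x`. -/
def rightPart (n m : ℕ) (hp : ℕ → Bool) : List Letter :=
  (List.finRange m).flatMap fun i : Fin m => blockR hp (n + i)

/-- The part between the letters `x`. -/
def middlePart {k : ℕ} (π : Equiv.Perm (Fin k)) (hp : ℕ → Bool) (hy : Fin k → Bool) :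
    List Letter :=
  (List.finRange k).flatMap fun i => blockM hp (hy i) (π i)

theorem index_of_mem_blockL {hp : ℕ → Bool} {j : ℕ} {l : Letter} (h : l ∈ blockL hp j) :
    l.index = j := by
  unfold blockL at h
  split_ifs at h <;> simp at h <;> rcases h with rfl | rfl | rfl | rfl <;> rfl

theorem index_of_mem_blockR {hp : ℕ → Bool} {j : ℕ} {l : Letter} (h : l ∈ blockR hp j) :
    l.index = j := by
  unfold blockR at h
  split_ifs at h <;> simp at h <;> rcases h with rfl | rfl | rfl | rfl <;> rfl

theorem index_of_mem_blockM {hp : ℕ → Bool} {hy : Bool} {j : ℕ} {l : Letter}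
    (h : l ∈ blockM hp hy j) : l.index = j := by
  unfold blockM at h
  split_ifs at h <;> simp at h <;> rcases h with rfl | rfl | rfl <;> rfl

theorem count_flatMap_of_forall_notMem {ι : Type*} {L : List ι} (hL : L.Nodup)
    {f : ι → List Letter} {l : Letter} {i : ι} (hi : i ∈ L)
    (h : ∀ j ∈ L, j ≠ i → l ∉ f j) : (L.flatMap f).count l = (f i).count l := by
  obtain ⟨s, t, rfl⟩ := List.append_of_mem hi
  have hn := List.nodup_middle.1 hL
  rw [List.nodup_cons, List.mem_append, not_or] at hn
  have h₁ : l ∉ s.flatMap f := by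
    rw [List.mem_flatMap]
    rintro ⟨j, hj, hl⟩
    exact h j (by simp [hj]) (by rintro rfl; exact hn.1.1 hj) hl
  have h₂ : l ∉ t.flatMap f := by
    rw [List.mem_flatMap]
    rintro ⟨j, hj, hl⟩
    exact h j (by simp [hj]) (by rintro rfl; exact hn.1.2 hj) hl
  rw [List.flatMap_append, List.flatMap_cons, List.count_append, List.count_append,
    List.count_eq_zero.2 h₁, List.count_eq_zero.2 h₂]
  omega

theorem count_leftPart {n : ℕ} {hp : ℕ → Bool} (l : Letter) :
    (leftPart n hp).count l = if l.index < n then (blockL hp l.index).count l else 0 := by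
  unfold leftPart
  split_ifs with h
  · rw [count_flatMap_of_forall_notMem (List.nodup_finRange n)
      (List.mem_finRange ⟨l.index, h⟩)]
    rintro j - hj hl
    exact hj (Fin.ext (index_of_mem_blockL hl).symm)
  · rw [List.count_eq_zero, List.mem_flatMap]
    rintro ⟨j, -, hl⟩
    have := index_of_mem_blockL hl
    omega

theorem count_rightPart {n m : ℕ} {hp : ℕ → Bool} (l : Letter) :
    (rightPart n m hp).count l =
      if n ≤ l.index ∧ l.index < n + m then (blockR hp l.index).count l else 0 := by
  unfold rightPart
  split_ifs with h
  · rw [count_flatMap_of_forall_notMem (List.nodup_finRange m)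
      (List.mem_finRange ⟨l.index - n, by omega⟩)]
    · congr 2
      simp only
      omega
    · rintro j - hj hl
      have := index_of_mem_blockR hl
      exact hj (Fin.ext (by simp only; omega))
  · rw [List.count_eq_zero, List.mem_flatMap]
    rintro ⟨j, -, hl⟩
    have := index_of_mem_blockR hl
    omega

theorem count_middlePart {k : ℕ} {π : Equiv.Perm (Fin k)} {hp : ℕ → Bool} {hy : Fin k → Bool}
    (l : Letter) : (middlePart π hp hy).count l =
      if h : l.index < k then (blockM hp (hy (π.symm ⟨l.index, h⟩)) l.index).count l else 0 := by
  unfold middlePart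
  split_ifs with h
  · rw [count_flatMap_of_forall_notMem (List.nodup_finRange k)
      (List.mem_finRange (π.symm ⟨l.index, h⟩))]
    · simp
    · rintro j - hj hl
      have := index_of_mem_blockM hl
      refine hj ?_
      rw [Equiv.eq_symm_apply]
      exact Fin.ext this.symm
  · rw [List.count_eq_zero, List.mem_flatMap]
    rintro ⟨j, -, hl⟩
    have := index_of_mem_blockM hl
    omega

theorem isT_or_isZ_of_mem_blockL {hp : ℕ → Bool} {j : ℕ} {l : Letter} (h : l ∈ blockL hp j) :
    l.isT = true ∨ l.isZ = true := by
  unfold blockL at h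
  split_ifs at h <;> simp at h <;> rcases h with rfl | rfl | rfl | rfl <;>
    simp [Letter.isT, Letter.isZ]

theorem isT_or_isZ_of_mem_blockR {hp : ℕ → Bool} {j : ℕ} {l : Letter} (h : l ∈ blockR hp j) :
    l.isT = true ∨ l.isZ = true := by
  unfold blockR at h
  split_ifs at h <;> simp at h <;> rcases h with rfl | rfl | rfl | rfl <;>
    simp [Letter.isT, Letter.isZ]

theorem isZ_or_isY_of_mem_blockM {hp : ℕ → Bool} {hy : Bool} {j : ℕ} {l : Letter}
    (h : l ∈ blockM hp hy j) : l.isZ = true ∨ l.isY = true := by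
  unfold blockM at h
  split_ifs at h <;> simp at h <;> rcases h with rfl | rfl | rfl <;>
    simp [Letter.isY, Letter.isZ]

theorem isZ_or_isY_of_mem_middlePart {k : ℕ} {π : Equiv.Perm (Fin k)} {hp : ℕ → Bool}
    {hy : Fin k → Bool} {l : Letter} (h : l ∈ middlePart π hp hy) :
    l.isZ = true ∨ l.isY = true := by
  obtain ⟨j, -, hl⟩ := List.mem_flatMap.1 h
  exact isZ_or_isY_of_mem_blockM hl

/-- The list `u` is a chain for `R`, starts with a letter satisfying `p` and ends with a letter
satisfying `q`. -/
def ChainBetween (R : Letter → Letter → Prop) (p q : Letter → Prop) (u : List Letter) : Prop :=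
  u.IsChain R ∧ (∀ l, u.head? = some l → p l) ∧ ∀ l, u.getLast? = some l → q l

theorem ChainBetween.append {R : Letter → Letter → Prop} {p q : Letter → Prop}
    (h : ∀ a b, q a → p b → R a b) {u v : List Letter} (hu : ChainBetween R p q u)
    (hv : ChainBetween R p q v) : ChainBetween R p q (u ++ v) := by
  refine ⟨List.isChain_append.2 ⟨hu.1, hv.1, fun a ha b hb => h a b (hu.2.2 a ha) (hv.2.1 b hb)⟩,
    ?_, ?_⟩
  · intro l hl
    rw [List.head?_append] at hl
    cases hh : u.head? with
    | none => rw [hh] at hl; exact hv.2.1 l hl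
    | some a => rw [hh] at hl; exact hu.2.1 l (hh.trans hl)
  · intro l hl
    rw [List.getLast?_append] at hl
    cases hh : v.getLast? with
    | none => rw [hh] at hl; exact hu.2.2 l hl
    | some a => rw [hh] at hl; exact hv.2.2 l (hh.trans hl)

theorem ChainBetween.flatMap {R : Letter → Letter → Prop} {p q : Letter → Prop}
    (h : ∀ a b, q a → p b → R a b) {ι : Type*} {f : ι → List Letter}
    (hf : ∀ i, ChainBetween R p q (f i)) (L : List ι) : ChainBetween R p q (L.flatMap f) := by
  induction L with
  | nil => exact ⟨List.isChain_nil, by simp, by simp⟩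
  | cons i L ih => exact (hf i).append h ih

theorem chainBetween_leftPart (n : ℕ) (hp : ℕ → Bool) :
    ChainBetween (fun a b => ¬ (a.isT = true ∧ b.isT = true)) (fun l => l.isZ = true)
      (fun l => l.isT = true) (leftPart n hp) := by
  refine ChainBetween.flatMap
    (fun (a b : Letter) _ hb (h : a.isT = true ∧ b.isT = true) => Letter.ne_of_isT_of_isZ (a := b) h.2 hb rfl) (fun i => ?_) _
  unfold blockL
  split_ifs <;> simp [ChainBetween, Letter.isT, Letter.isZ]

theorem chainBetween_rightPart (n m : ℕ) (hp : ℕ → Bool) :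
    ChainBetween (fun a b => ¬ (a.isT = true ∧ b.isT = true)) (fun l => l.isT = true)
      (fun l => l.isZ = true) (rightPart n m hp) := by
  refine ChainBetween.flatMap
    (fun (a b : Letter) ha _ (h : a.isT = true ∧ b.isT = true) => Letter.ne_of_isT_of_isZ (a := a) h.1 ha rfl) (fun i => ?_) _
  unfold blockR
  split_ifs <;> simp [ChainBetween, Letter.isT, Letter.isZ]

/-- The hypotheses provide distinct places for `za` and `zc`: the last block may end with a `y` only
if no primed letter follows, and a single block has a second `z` only in the form of a primed
letter. -/
theorem exists_middlePart_eq {k : ℕ} {π : Equiv.Perm (Fin k)} {hp : ℕ → Bool} {hy : Fin k → Bool}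
    (h₁ : ∀ i : Fin k, hy i = true → (i : ℕ) + 1 = k → hp (π i) = true)
    (h₂ : k = 1 → ∀ i, hp (π i) = true) (hk : k ≠ 0) :
    ∃ za M₀ zc, middlePart π hp hy = za :: (M₀ ++ [zc]) ∧ za.isZ = true ∧ zc.isZ = true := by
  obtain ⟨k, rfl⟩ := Nat.exists_eq_succ_of_ne_zero hk
  have hb : ∃ r z, blockM hp (hy (Fin.last k)) (π (Fin.last k)) = r ++ [z] ∧ z.isZ = true ∧
      (k = 0 → r.head? = some (.z (π (Fin.last k)))) := by
    by_cases hl : hp (π (Fin.last k)) = true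
    · exact ⟨.z (π (Fin.last k)) :: (if hy (Fin.last k) then [.y (π (Fin.last k)),
        .y (π (Fin.last k))] else []), .zp (π (Fin.last k)), by simp [blockM, hl], rfl,
        fun _ => rfl⟩
    · have : hy (Fin.last k) = false := by
        by_contra h
        exact hl (h₁ _ (by simpa using h) (by simp))
      refine ⟨[], .z (π (Fin.last k)), by simp [blockM, hl, this], rfl, ?_⟩
      rintro rfl
      exact absurd (h₂ rfl _) hl
  obtain ⟨r, z, hr, hz, hr'⟩ := hb
  cases k with
  | zero =>
    cases r with
    | nil => simp at hr'
    | cons a r =>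
      refine ⟨a, r, z, ?_, ?_, hz⟩
      · have : middlePart π hp hy = blockM hp (hy (Fin.last 0)) (π (Fin.last 0)) := by
          simp [middlePart, List.finRange_succ]
        rw [this, hr]; rfl
      · have := hr' rfl
        simp at this
        rw [this]; rfl
  | succ k =>
    have e : middlePart π hp hy = blockM hp (hy 0) (π 0) ++
        (((List.finRange k).map fun i => i.castSucc.succ).flatMap
          (fun i => blockM hp (hy i) (π i)) ++ (r ++ [z])) := by
      rw [middlePart, List.finRange_succ, List.finRange_succ_last, List.map_append,
        List.flatMap_cons, List.flatMap_append, ← hr]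
      simp [List.flatMap_map, Fin.succ_last]
    rw [e]
    refine ⟨.z (π 0), (blockM hp (hy 0) (π 0)).tail ++
      (((List.finRange k).map fun i => i.castSucc.succ).flatMap
        (fun i => blockM hp (hy i) (π i)) ++ r), z, ?_, rfl, hz⟩
    simp [blockM]

/-- A letter `y` belongs to one block only, where it occurs as a square. -/
theorem exists_middlePart_eq_append_of_isY {k : ℕ} {π : Equiv.Perm (Fin k)} {hp : ℕ → Bool}
    {hy : Fin k → Bool} {y : Letter} (hY : y.isY = true) (h : y ∈ middlePart π hp hy) :
    ∃ P Q, middlePart π hp hy = P ++ y :: y :: Q ∧ y ∉ P ∧ y ∉ Q := by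
  have hc : (middlePart π hp hy).count y ≤ 2 := by
    rw [count_middlePart]
    unfold blockM
    cases y with
    | y i =>
      simp only [show (Letter.y i).index = i from rfl]
      split_ifs <;> simp
    | _ => simp [Letter.isY] at hY
  obtain ⟨i, hi, hyi⟩ := List.mem_flatMap.1 h
  obtain ⟨r, hr⟩ : ∃ r, blockM hp (hy i) (π i) = .z (π i) :: y :: y :: r := by
    unfold blockM at hyi ⊢
    split_ifs at hyi ⊢ <;> simp at hyi <;>
      rcases hyi with rfl | hyi | hyi <;> simp_all [Letter.isY]
  obtain ⟨s, t, hst⟩ := List.append_of_mem hi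
  obtain ⟨P, Q, hPQ⟩ : ∃ P Q, middlePart π hp hy = P ++ y :: y :: Q := by
    refine ⟨s.flatMap (fun i => blockM hp (hy i) (π i)) ++ [.z (π i)],
      r ++ t.flatMap (fun i => blockM hp (hy i) (π i)), ?_⟩
    rw [middlePart, hst, List.flatMap_append, List.flatMap_cons, hr]
    simp
  refine ⟨P, Q, hPQ, ?_, ?_⟩ <;>
  · rw [hPQ, List.count_append, List.count_cons_self, List.count_cons_self] at hc
    exact List.count_eq_zero.1 (by omega)

theorem exists_frame {n m k : ℕ} (hk : k = n + m) (π : Equiv.Perm (Fin k)) (hp : ℕ → Bool)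
    (hy : Fin k → Bool) (h₁ : ∀ i : Fin k, hy i = true → (i : ℕ) + 1 = k → hp (π i) = true)
    (h₂ : k = 1 → ∀ i, hp (π i) = true) (h₀ : k ≠ 0) :
    ∃ F : Frame, F.wd = leftPart n hp ++ .x :: middlePart π hp hy ++ .x :: rightPart n m hp ∧
      ∀ y l : Letter, y.isY = true → l ≠ y → ¬ [y, l, y].Sublist F.M₀ := by
  obtain ⟨za, M₀, zc, hM, hza, hzc⟩ := exists_middlePart_eq h₁ h₂ h₀
  have hmem : ∀ l, l ∈ leftPart n hp ∨ l ∈ rightPart n m hp ∨ l ∈ middlePart π hp hy →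
      l.isZ = true → (leftPart n hp).count l + (rightPart n m hp).count l = 1 ∧
        (middlePart π hp hy).count l = 1 := by
    intro l hl hz
    rw [← List.one_le_count_iff, ← List.one_le_count_iff, ← List.one_le_count_iff] at hl
    rw [count_leftPart, count_rightPart, count_middlePart] at hl ⊢
    subst hk
    cases l with
    | z j =>
      have e₁ : (blockL hp j).count (.z j) = 1 := by unfold blockL; split_ifs <;> simp
      have e₂ : (blockR hp j).count (.z j) = 1 := by unfold blockR; split_ifs <;> simp
      have e₃ : ∀ b, (blockM hp b j).count (.z j) = 1 := by
        intro b; unfold blockM; split_ifs <;> simp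
      simp only [show (Letter.z j).index = j from rfl, e₁, e₂, e₃] at hl ⊢
      split_ifs at hl ⊢ <;> omega
    | zp j =>
      have e₁ : (blockL hp j).count (.zp j) = if hp j then 1 else 0 := by
        unfold blockL; split_ifs <;> simp
      have e₂ : (blockR hp j).count (.zp j) = if hp j then 1 else 0 := by
        unfold blockR; split_ifs <;> simp
      have e₃ : ∀ b, (blockM hp b j).count (.zp j) = if hp j then 1 else 0 := by
        intro b; unfold blockM; split_ifs <;> simp
      simp only [show (Letter.zp j).index = j from rfl, e₁, e₂, e₃] at hl ⊢
      split_ifs at hl ⊢ <;> omega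
    | _ => simp [Letter.isZ] at hz
  have hsub : M₀.Sublist (middlePart π hp hy) := by
    rw [hM]
    exact (List.sublist_append_left _ _).trans (List.sublist_cons_self _ _)
  let F : Frame :=
    { Lf := leftPart n hp
      M₀ := M₀
      Rt := rightPart n m hp
      za := za
      zc := zc
      mem_Lf := fun l hl => by
        obtain ⟨j, -, hl⟩ := List.mem_flatMap.1 hl
        exact isT_or_isZ_of_mem_blockL hl
      mem_Rt := fun l hl => by
        obtain ⟨j, -, hl⟩ := List.mem_flatMap.1 hl
        exact isT_or_isZ_of_mem_blockR hl
      mem_M₀ := fun l hl => isZ_or_isY_of_mem_middlePart (hsub.subset hl)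
      isZ_za := hza
      isZ_zc := hzc
      za_ne_zc := by
        rintro rfl
        have := (hmem za (Or.inr (Or.inr (by rw [hM]; simp))) hza).2
        rw [hM] at this
        simp at this
      count_T := fun l hl => by
        rw [count_leftPart, count_rightPart]
        cases l with
        | t j =>
          have e₁ : (blockL hp j).count (.t j) = 1 := by unfold blockL; split_ifs <;> simp
          have e₂ : (blockR hp j).count (.t j) = 1 := by unfold blockR; split_ifs <;> simp
          simp only [show (Letter.t j).index = j from rfl, e₁, e₂]
          split_ifs <;> omega
        | tp j =>
          have e₁ : (blockL hp j).count (.tp j) ≤ 1 := by unfold blockL; split_ifs <;> simp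
          have e₂ : (blockR hp j).count (.tp j) ≤ 1 := by unfold blockR; split_ifs <;> simp
          simp only [show (Letter.tp j).index = j from rfl]
          split_ifs <;> omega
        | _ => simp [Letter.isT] at hl
      count_Z := fun l hl h => by
        rw [← hM] at h ⊢
        exact hmem l h hl
      count_Y := fun l hl hY => by
        obtain ⟨P, Q, e, -, -⟩ := exists_middlePart_eq_append_of_isY hY (hsub.subset hl)
        have h₁ : 2 ≤ (middlePart π hp hy).count l := by
          rw [e, List.count_append, List.count_cons_self, List.count_cons_self]; omega
        have h₂ : za ≠ l := (Letter.ne_of_isY_of_isZ hY hza).symm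
        have h₃ : zc ≠ l := (Letter.ne_of_isY_of_isZ hY hzc).symm
        rw [hM] at h₁
        simpa [h₂, h₃] using h₁
      chain_Lf := (chainBetween_leftPart n hp).1
      chain_Rt := (chainBetween_rightPart n m hp).1
      head_Lf := (chainBetween_leftPart n hp).2.1
      last_Lf := (chainBetween_leftPart n hp).2.2
      head_Rt := (chainBetween_rightPart n m hp).2.1
      last_Rt := (chainBetween_rightPart n m hp).2.2 }
  refine ⟨F, by rw [hM]; rfl, fun y l hY _ h => ?_⟩
  have h : ([y, l] ++ [y]).Sublist (middlePart π hp hy) := h.trans hsub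
  obtain ⟨P, Q, e, hP, hQ⟩ := exists_middlePart_eq_append_of_isY hY (h.subset (by simp))
  rw [e] at h
  have h' : ([y, l] ++ [y]).Sublist ([y, y] ++ Q) := Frame.sublist_right hP h
  have := (Frame.sublist_left hQ h').length_le
  simp at this

theorem toList_prod_ofFn {k : ℕ} (f : Fin k → Word) :
    (List.ofFn f).prod.toList = (List.finRange k).flatMap fun i => (f i).toList := by
  rw [List.ofFn_eq_map]
  induction List.finRange k with
  | nil => rfl
  | cons i L ih => rw [List.map_cons, List.prod_cons, FreeMonoid.toList_mul, ih, List.flatMap_cons]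

/-- The numbers `j` for which the letters `zⱼ'` and `tⱼ'` occur in `aWord p n m π`. -/
def hasPrime (p : Fin 4) (n j : ℕ) : Bool :=
  match p with
  | 0 => decide (n ≤ j)
  | 1 => decide (j < n)
  | _ => false

/-- The positions `i` for which the letter `y` with number `j` occurs in `aWord p n m π`, where
`j` is the image of `i`. -/
def hasY (p : Fin 4) (n k i j : ℕ) : Bool :=
  match p with
  | 0 => decide (n ≤ j)
  | 1 => decide (j < n)
  | 2 => decide (j < n ∧ i + 1 < k)
  | 3 => decide (n ≤ j ∧ i + 1 < k)

theorem toList_aWord (p : Fin 4) (n m : ℕ) (π : Equiv.Perm (Fin (n + m))) :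
    (aWord p n m π).toList = leftPart n (hasPrime p n) ++
      .x :: middlePart π (hasPrime p n) (fun i => hasY p n (n + m) i (π i)) ++
        .x :: rightPart n m (hasPrime p n) := by
  have hL : ∀ (f : Fin n → Word), (∀ i, (f i).toList = blockL (hasPrime p n) i) →
      (List.ofFn f).prod.toList = leftPart n (hasPrime p n) := fun f hf => by
    simp only [toList_prod_ofFn, hf, leftPart]
  have hR : ∀ (f : Fin m → Word), (∀ i, (f i).toList = blockR (hasPrime p n) (n + i)) →
      (List.ofFn f).prod.toList = rightPart n m (hasPrime p n) := fun f hf => by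
    simp only [toList_prod_ofFn, hf, rightPart]
  have hM : ∀ (f : Fin (n + m) → Word),
      (∀ i, (f i).toList = blockM (hasPrime p n) (hasY p n (n + m) i (π i)) (π i)) →
      (List.ofFn f).prod.toList =
        middlePart π (hasPrime p n) (fun i => hasY p n (n + m) i (π i)) := fun f hf => by
    simp only [toList_prod_ofFn, hf, middlePart]
  have key : ∀ u v w : Word, (u * Letter.x.word * v * Letter.x.word * w).toList =
      u.toList ++ .x :: v.toList ++ .x :: w.toList := by
    intro u v w
    simp [FreeMonoid.toList_mul, Letter.word, FreeMonoid.toList_of]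
  match p with
  | 0 =>
    refine (key _ _ _).trans ?_
    rw [hL, hM, hR]
    · intro i
      simp [blockR, hasPrime, tz, Letter.word]
    · intro i
      simp only [blockM, hasPrime, hasY, decide_eq_true_eq]
      split_ifs <;> first | omega | contradiction | simp [zyyz, zyy, Letter.word, pow_two]
    · intro i
      simp [blockL, hasPrime, zt, Letter.word]
  | 1 =>
    refine (key _ _ _).trans ?_
    rw [hL, hM, hR]
    · intro i
      simp [blockR, hasPrime, tz, Letter.word]
    · intro i
      simp only [blockM, hasPrime, hasY, decide_eq_true_eq]
      split_ifs <;> first | omega | contradiction | simp [zyyz, zyy, Letter.word, pow_two]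
    · intro i
      simp [blockL, hasPrime, zt, Letter.word]
  | 2 =>
    refine (key _ _ _).trans ?_
    rw [hL, hM, hR]
    · intro i
      simp [blockR, hasPrime, tz, Letter.word]
    · intro i
      simp only [blockM, hasPrime, hasY, decide_eq_true_eq]
      split_ifs <;> first | omega | contradiction | simp [zyy, Letter.word, pow_two]
    · intro i
      simp [blockL, hasPrime, zt, Letter.word]
  | 3 =>
    refine (key _ _ _).trans ?_
    rw [hL, hM, hR]
    · intro i
      simp [blockR, hasPrime, tz, Letter.word]
    · intro i
      simp only [blockM, hasPrime, hasY, decide_eq_true_eq]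
      split_ifs <;> first | omega | contradiction | simp [zyy, Letter.word, pow_two]
    · intro i
      simp [blockL, hasPrime, zt, Letter.word]

/-! ### The words with a single block -/

/-- The first letters must agree, because the restriction to these two letters shows which one comes
first; then induction applies. -/
theorem eq_of_filter_pair_eq {S u v : List Letter} (hu : ∀ l ∈ u, l ∈ S) (hv : ∀ l ∈ v, l ∈ S)
    (h : ∀ c ∈ S, ∀ d ∈ S, v.filter (fun l => l = c ∨ l = d) = u.filter (fun l => l = c ∨ l = d)) :
    v = u := by
  induction u generalizing v with
  | nil =>
    cases v with
    | nil => rfl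
    | cons d v => simpa using h d (hv d (by simp)) d (hv d (by simp))
  | cons c u ih =>
    cases v with
    | nil => simpa using h c (hu c (by simp)) c (hu c (by simp))
    | cons d v =>
      have hcd := h c (hu c (by simp)) d (hv d (by simp))
      simp only [List.filter_cons, or_true, true_or, decide_true, if_true] at hcd
      obtain rfl : d = c := (List.cons.inj hcd).1
      refine congrArg _ (ih (fun l hl => hu l (by simp [hl])) (fun l hl => hv l (by simp [hl])) ?_)
      intro a ha b hb
      have := h a ha b hb
      simp only [List.filter_cons] at this
      split_ifs at this
      · exact (List.cons.inj this).2
      · exact this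

/-- The substitution that reads `c`, `s`, `d` as the letters `z 0`, `t 0`, `x` and forgets the other
letters. -/
noncomputable def rename (c s d l : Letter) : List Letter :=
  if l = c then [.z 0] else if l = s then [.t 0] else if l = d then [.x] else []

/-- The renaming is injective on its three letters, and the local `φ` undoes it. -/
theorem filter_eq_of_flatMap_rename_eq {c s d : Letter} {u v : List Letter}
    (h : v.flatMap (rename c s d) = u.flatMap (rename c s d)) {a b : Letter}
    (ha : a = c ∨ a = s ∨ a = d) (hb : b = c ∨ b = s ∨ b = d) :
    v.filter (fun l => l = a ∨ l = b) = u.filter (fun l => l = a ∨ l = b) := by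
  let φ : Letter → List Letter := fun l =>
    match l with
    | .z _ => [c]
    | .t _ => [s]
    | .x => [d]
    | _ => []
  have hφ : ∀ w : List Letter, (w.flatMap (rename c s d)).flatMap φ =
      w.filter (fun l => l = c ∨ l = s ∨ l = d) := by
    intro w
    induction w with
    | nil => rfl
    | cons l w ih =>
      rw [List.flatMap_cons, List.flatMap_append, ih, List.filter_cons]
      unfold rename
      split_ifs <;> simp_all [φ]
  have hf : ∀ w : List Letter, w.filter (fun l => l = a ∨ l = b) =
      (w.filter (fun l => l = c ∨ l = s ∨ l = d)).filter (fun l => l = a ∨ l = b) := by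
    intro w
    rw [List.filter_filter]
    refine List.filter_congr fun l _ => ?_
    rcases ha with rfl | rfl | rfl <;> rcases hb with rfl | rfl | rfl <;> simp <;> tauto
  rw [hf v, hf u, ← hφ v, ← hφ u, h]

/-- Five readings as `ztxzx` cover all pairs among the five letters, and restrictions to pairs
determine a word. -/
theorem eq_of_forall_context {i j : ℕ} (hij : i ≠ j) {v : List Letter}
    (hv : ∀ (p q : List Letter) (φ : Letter → List Letter),
      p ++ [Letter.z i, .t i, .z j, .t j, .x, .z i, .z j, .x].flatMap φ ++ q =
        [.z 0, .t 0, .x, .z 0, .x] →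
      p ++ v.flatMap φ ++ q = [.z 0, .t 0, .x, .z 0, .x]) :
    v = [.z i, .t i, .z j, .t j, .x, .z i, .z j, .x] := by
  have cancel : ∀ (p q : List Letter) (φ : Letter → List Letter),
      p ++ [Letter.z i, .t i, .z j, .t j, .x, .z i, .z j, .x].flatMap φ ++ q =
        [.z 0, .t 0, .x, .z 0, .x] →
      v.flatMap φ = [Letter.z i, .t i, .z j, .t j, .x, .z i, .z j, .x].flatMap φ := by
    intro p q φ h
    have h' := (hv p q φ h).trans h.symm
    exact List.append_cancel_left (List.append_cancel_right h')
  have k₁ := cancel [] [] (rename (.z i) (.t i) .x) (by simp [rename, hij.symm])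
  have k₂ := cancel [] [] (rename (.z j) (.t j) .x) (by simp [rename, hij])
  have k₃ := cancel [] [] (rename (.z i) (.t j) .x) (by simp [rename, hij, hij.symm])
  -- Here `t j`, `t i`, `z j` play the roles of `z`, `t`, `x`, and the context supplies the missing
  -- initial `z`.
  have k₄ := cancel [.z 0] [] (rename (.t j) (.t i) (.z j)) (by simp [rename, hij])
  have k₅ := cancel [] [] (rename (.z i) (.t i) (.z j)) (by simp [rename, hij.symm])
  refine eq_of_filter_pair_eq (S := [.z i, .t i, .z j, .t j, .x])
    (by simp) (fun l hl => ?_) fun c hc d hd => ?_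
  · by_contra hlS
    simp only [List.mem_cons, List.not_mem_nil, or_false, not_or] at hlS
    -- The context is already the whole word `ztxzx`, so the image of a foreign letter must be
    -- empty.
    have h := cancel [.z 0, .t 0, .x, .z 0, .x] [] (fun d => if d = l then [.x] else [])
      (by simp [Ne.symm hlS.1, Ne.symm hlS.2.1, Ne.symm hlS.2.2.1, Ne.symm hlS.2.2.2.1,
        Ne.symm hlS.2.2.2.2])
    have h' : v.flatMap (fun d => if d = l then [Letter.x] else []) = [] := by
      rw [h]
      simp [Ne.symm hlS.1, Ne.symm hlS.2.1, Ne.symm hlS.2.2.1, Ne.symm hlS.2.2.2.1,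
        Ne.symm hlS.2.2.2.2]
    have := List.flatMap_eq_nil_iff.1 h' l hl
    simp at this
  · simp only [List.mem_cons, List.not_mem_nil, or_false] at hc hd
    rcases hc with rfl | rfl | rfl | rfl | rfl <;> rcases hd with rfl | rfl | rfl | rfl | rfl <;>
      first
      | (refine filter_eq_of_flatMap_rename_eq k₁ ?_ ?_ <;> simp; done)
      | (refine filter_eq_of_flatMap_rename_eq k₂ ?_ ?_ <;> simp; done)
      | (refine filter_eq_of_flatMap_rename_eq k₃ ?_ ?_ <;> simp; done)
      | (refine filter_eq_of_flatMap_rename_eq k₄ ?_ ?_ <;> simp; done)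
      | (refine filter_eq_of_flatMap_rename_eq k₅ ?_ ?_ <;> simp)

/-- The letters of `w` can be renamed so that `w` becomes one of the isoterms `ytxyx`, `xyxty`, and
equal island sequences exclude letters that the renaming would erase. So the class of `w` is a
singleton. -/
theorem eq_of_gammaPP {u w : List Letter}
    (hw : w.flatMap (Frame.proj (.z 0) (.t 0)) = [.y 0, .t 0, .x, .y 0, .x] ∨
      w.flatMap (Frame.proj (.z 0) (.t 0)) = [.x, .y 0, .x, .t 0, .y 0])
    (hs : ∀ l ∈ w, l = .z 0 ∨ l = .t 0 ∨ l = .x)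
    (h : gammaPP (FreeMonoid.ofList u) (FreeMonoid.ofList w)) : u = w := by
  have hf : FreeMonoid.lift (fun l => FreeMonoid.ofList (Frame.proj (.z 0) (.t 0) l))
      (FreeMonoid.ofList w) ∈ factorClosure ({wordXYXTY, wordYTXYX} : Set Word) := by
    rcases hw with hp | hp
    · refine ⟨wordYTXYX, by simp, 1, 1, ?_⟩
      rw [one_mul, mul_one]
      exact hp.symm.trans (Frame.toList_lift_ofList _ w).symm
    · refine ⟨wordXYXTY, by simp, 1, 1, ?_⟩
      rw [one_mul, mul_one]
      exact hp.symm.trans (Frame.toList_lift_ofList _ w).symm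
  have heq := congrArg FreeMonoid.toList (lift_eq_of_mem_factorClosure h.2 _ hf)
  rw [Frame.toList_lift_ofList, Frame.toList_lift_ofList] at heq
  have hu : ∀ l ∈ u, l = .z 0 ∨ l = .t 0 ∨ l = .x := by
    intro l hl
    have hd : u.destutter (· ≠ ·) = w.destutter (· ≠ ·) := h.1.2
    rw [← GammaAux.mem_destutter, hd, GammaAux.mem_destutter] at hl
    exact hs l hl
  let φ : Letter → List Letter := fun l =>
    match l with
    | .y _ => [.z 0]
    | .t _ => [.t 0]
    | .x => [.x]
    | _ => []
  have hφ : ∀ v : List Letter, (∀ l ∈ v, l = .z 0 ∨ l = .t 0 ∨ l = .x) →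
      (v.flatMap (Frame.proj (.z 0) (.t 0))).flatMap φ = v := by
    intro v hv
    induction v with
    | nil => rfl
    | cons l v ih =>
      rw [List.flatMap_cons, List.flatMap_append, ih fun a ha => hv a (by simp [ha])]
      rcases hv l (by simp) with rfl | rfl | rfl <;> simp [Frame.proj, φ]
  rw [← hφ u hu, heq, hφ w hs]

theorem append_flatMap_append_eq_of_mem_identities {w u v : List Letter}
    (hw : ∀ b, gammaPP (FreeMonoid.ofList b) (FreeMonoid.ofList w) → b = w)
    (h : (FreeMonoid.ofList u, FreeMonoid.ofList v) ∈
      (sapirVariety gammaPP (conClass gammaPP (FreeMonoid.ofList w))).identities)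
    (p q : List Letter) (φ : Letter → List Letter) (hu : p ++ u.flatMap φ ++ q = w) :
    p ++ v.flatMap φ ++ q = w := by
  have e : ∀ b : List Letter, FreeMonoid.ofList p *
      FreeMonoid.lift (fun l => FreeMonoid.ofList (φ l)) (FreeMonoid.ofList b) *
        FreeMonoid.ofList q = FreeMonoid.ofList (p ++ b.flatMap φ ++ q) := by
    intro b
    rw [← Frame.toList_lift_ofList]
    rfl
  have hid := MonoidVariety.identities_mul (MonoidVariety.identities_lift h
    fun l => FreeMonoid.ofList (φ l)) (FreeMonoid.ofList p) (FreeMonoid.ofList q)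
  rw [e, e] at hid
  refine hw _ (stableSet_conClass gammaPP (FreeMonoid.ofList w) _ _ hid ?_)
  rw [hu]
  exact gammaPP.refl _

/-- For a word without `y` that is an isoterm for `V`, the singleton can serve as `A`; the
conditions on `y` are then vacuous. -/
theorem Frame.not_isDistributiveLattice_of_forall_eq (F : Frame) (V : MonoidVariety)
    (hY : ∀ l ∈ F.wd, l.isY = false)
    (h : ∀ v, (FreeMonoid.ofList F.wd, FreeMonoid.ofList v) ∈ V.identities → v = F.wd) :
    ¬ IsDistributiveLattice V.Subvarieties := by
  have hnot : ∀ {y : Letter} {u : List Letter}, y.isY = true → y ∈ u → u ≠ F.wd := by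
    rintro y u hy hu rfl
    simp [hY y hu] at hy
  refine F.not_isDistributiveLattice {F.wd} rfl ?_ ?_ ?_ V ?_
  · rintro b rfl
    exact ⟨_, rfl, rfl⟩
  · intro y B₁ B₂ B₃ hy hb
    exact absurd hb (hnot hy (by simp))
  · intro y w₁ w₂ hy
    exact iff_of_false (hnot hy (by simp)) (hnot hy (by simp))
  · intro u v huv hu
    have hu : u = FreeMonoid.ofList F.wd := hu
    rw [hu] at huv
    exact h v.toList huv

/-- The word `ztxzx` has no frame, since its only `z` cannot be both `za` and `zc`. The word `z t z'
t' x z z' x` has a frame and is an isoterm for the same variety. -/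
theorem not_isDistributiveLattice_left :
    ¬ IsDistributiveLattice (sapirVariety gammaPP (conClass gammaPP
      (FreeMonoid.ofList [.z 0, .t 0, .x, .z 0, .x]))).Subvarieties := by
  obtain ⟨F, hF, -⟩ := exists_frame (n := 2) (m := 0) rfl (Equiv.refl _) (fun _ => false)
    (fun _ => false) (by simp) (by simp) (by simp)
  have hF : F.wd = [.z 0, .t 0, .z 1, .t 1, .x, .z 0, .z 1, .x] := by
    rw [hF]
    simp [leftPart, rightPart, middlePart, blockL, blockM, List.finRange_succ]
  refine F.not_isDistributiveLattice_of_forall_eq _ (by rw [hF]; simp [Letter.isY]) ?_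
  intro v hv
  rw [hF] at hv ⊢
  refine eq_of_forall_context zero_ne_one
    (append_flatMap_append_eq_of_mem_identities (fun b hb => eq_of_gammaPP ?_ ?_ hb) hv)
  · left; simp [Frame.proj]
  · simp

theorem not_isDistributiveLattice_right :
    ¬ IsDistributiveLattice (sapirVariety gammaPP (conClass gammaPP
      (FreeMonoid.ofList [.x, .z 0, .x, .t 0, .z 0]))).Subvarieties := by
  obtain ⟨F, hF, -⟩ := exists_frame (n := 0) (m := 2) rfl (Equiv.refl _) (fun _ => false)
    (fun _ => false) (by simp) (by simp) (by simp)
  have hF : F.wd = [.x, .z 0, .z 1, .x, .t 0, .z 0, .t 1, .z 1] := by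
    rw [hF]
    simp [leftPart, rightPart, middlePart, blockR, blockM, List.finRange_succ]
  refine F.not_isDistributiveLattice_of_forall_eq _ (by rw [hF]; simp [Letter.isY]) ?_
  intro v hv
  rw [hF] at hv ⊢
  have key := append_flatMap_append_eq_of_mem_identities
    (fun b hb => eq_of_gammaPP (Or.inr (by simp [Frame.proj])) (by simp) hb) hv
  have hv' : v.reverse = [.z 1, .t 1, .z 0, .t 0, .x, .z 1, .z 0, .x] := by
    refine eq_of_forall_context one_ne_zero fun p q φ h => ?_
    have := key q.reverse p.reverse (fun l => (φ l).reverse) (by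
      rw [← List.reverse_inj]
      simpa using h)
    rw [← List.reverse_inj] at this
    simpa [List.reverse_flatMap, Function.comp_def] using this
  rw [← v.reverse_reverse, hv']
  rfl

theorem mainTheorem7 (n m : ℕ) (hdiff : n ≤ m + 1 ∧ m ≤ n + 1) (hpos : 1 ≤ n + m)
    (π : Equiv.Perm (Fin (n + m))) (hπ : IsNMPerm n m π) (p : Fin 4) :
    ¬ IsDistributiveLattice
      (sapirVariety gammaPP (conClass gammaPP (aWord p n m π))).Subvarieties := by
  have hw := toList_aWord p n m π
  -- The exceptional case is a single block without a primed letter, where the middle factor is one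
  -- letter.
  by_cases h : n + m = 1 → ∀ i, hasPrime p n (π i) = true
  · obtain ⟨F, hF, hc⟩ := exists_frame rfl π (hasPrime p n)
      (fun i => hasY p n (n + m) i (π i)) (fun i hi hk => by
        match p with
        | 0 => exact hi
        | 1 => exact hi
        | 2 => simp [hasY, hk] at hi
        | 3 => simp [hasY, hk] at hi) h (by omega)
    have e : aWord p n m π = FreeMonoid.ofList F.wd := by
      rw [hF, ← hw]; rfl
    rw [e]
    exact F.not_isDistributiveLattice_sapirVariety hc
  · push Not at h
    obtain ⟨hk, i, hi⟩ := h
    rcases Nat.eq_zero_or_pos m with rfl | hm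
    · obtain rfl : n = 1 := by omega
      have e : aWord p 1 0 π = FreeMonoid.ofList [.z 0, .t 0, .x, .z 0, .x] := by
        have : (aWord p 1 0 π).toList = [.z 0, .t 0, .x, .z 0, .x] := by
          rw [hw]
          match p with
          | 1 => simp [hasPrime] at hi
          | 0 => simp [leftPart, rightPart, middlePart, blockL, blockM, hasPrime, hasY,
              List.finRange_succ]
          | 2 => simp [leftPart, rightPart, middlePart, blockL, blockM, hasPrime, hasY,
              List.finRange_succ]
          | 3 => simp [leftPart, rightPart, middlePart, blockL, blockM, hasPrime, hasY,
              List.finRange_succ]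
        rw [← this]; rfl
      rw [e]
      exact not_isDistributiveLattice_left
    · obtain rfl : m = 1 := by omega
      obtain rfl : n = 0 := by omega
      have e : aWord p 0 1 π = FreeMonoid.ofList [.x, .z 0, .x, .t 0, .z 0] := by
        have : (aWord p 0 1 π).toList = [.x, .z 0, .x, .t 0, .z 0] := by
          rw [hw]
          match p with
          | 0 => simp [hasPrime] at hi
          | 1 => simp [leftPart, rightPart, middlePart, blockR, blockM, hasPrime, hasY,
              List.finRange_succ]
          | 2 => simp [leftPart, rightPart, middlePart, blockR, blockM, hasPrime, hasY,
              List.finRange_succ]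
          | 3 => simp [leftPart, rightPart, middlePart, blockR, blockM, hasPrime, hasY,
              List.finRange_succ]
        rw [← this]; rfl
      rw [e]
      exact not_isDistributiveLattice_right
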